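/- Let $X$ be a separable real Banach space with a centered non-degenerate Gaussian measure $\mu$, let $H$ be its Cameron--Martin space (for $h\in H$, $\hat h$ denotes the element of the closure of $X^*$ in $L^2(X,\mu)$ with $h=\int_X \hat h(x)\,x\,d\mu(x)$, and $\langle h,k\rangle_H=\int_X\hat h\hat k\,d\mu$), and let $(e_i)$ be an orthonormal basis of $H$ with $\hat e_i\in X^*$. Let $\mathcal H_2$ be the space of Hilbert--Schmidt operators on $H$, $\mathscr{FC}^k_b(X)$ the space of functions $x\mapsto g(x_1^*(x),\dots,x_n^*(x))$ with $x_i^*\in X^*$, $g\in C^k_b(\mathbb R^n)$, and $W^{k,p}(X,\mu)$ the Gaussian Sobolev spaces (the completions of $\mathscr{FC}_b^\infty(X)$ with respect to the $L^p$ norms of the function and of its derivatives along $H$ up to order $k$, measured in Hilbert--Schmidt norms); for a Borel set $\Omega$, $W^{1,p}(\Omega,\mu)$ is defined by the same approximation procedure in $L^p(\Omega,\mu)$. Let $\rho$ be the Feyel--de La Pradelle Hausdorff--Gauss surface measure, $\rho(A)=\sup_F\int_X\theta_F(\{z\in F: x-\pi_Fx+z\in A\})\,d\mu(x)$, where $F$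 runs over the subspaces of $H$ of finite dimension $m\ge1$, $\pi_Fx=\sum_i\hat f_i(x)f_i$ for an orthonormal basis $(f_i)$ of $F$, and $\theta_F$ is the $(m-1)$-dimensional spherical Hausdorff measure on $F$ multiplied by $(2\pi)^{-m/2}e^{-|z|_H^2/2}$. Let $C_{k,p}$ be the Gaussian capacity, given for open $A$ by $C_{k,p}(A)=\inf\{\|f\|_{L^p(X,\mu)}: (I-L_p)^{-k/2}f\ge1\ \mu\text{-a.e. in }A\}$, with $L_p$ the generator of the Ornstein--Uhlenbeck semigroup. A Borel function $f$ is called $(k,p)$-precise if for every $\varepsilon>0$ there is an open set $A$ with $C_{k,p}(A)\le\varepsilon$ such that $f|_{X\setminus A}$ is continuous (likewise for $H$- and $\mathcal H_2$-valued functions). Let $G:X\to\mathbb R$ be a version of a function in $W^{3,q}(X,\mu)$ for every $q>1$, put $\Omega=G^{-1}(-\infty,0]$, and let versions $\nabla_HG:X\to H$ and $\nabla_H^2G:X\to\mathcal H_2$ of its first and second derivatives along $H$ be fixed such that: 1. $G$ is convex and $(3,q)$-precise for every $q>1$; 2. $\nabla_HG$ is $(2,q)$-precise and $\nabla^2_HG$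 is $(1,q)$-precise for every $q>1$; 3. $\mu(\Omega)>0$ and $\Omega$ is closed; 4. $|\nabla_HG|_H^{-1}\in L^q(\Omega,\mu)$ for every $q>1$; 5. for $\rho$-a.e. $x\in G^{-1}(0)$, as $t\to0$, $\frac{G(x+th)-G(x)}t\to\langle\nabla_HG(x),h\rangle_H$ and $\frac{\nabla_HG(x+th)-\nabla_HG(x)}t\to\nabla_H^2G(x)h$ in $H$, uniformly with respect to $h\in H$ with $|h|_H=1$; 6. $\nabla_HG(x)\ne0$ for $\rho$-a.e. $x\in G^{-1}(0)$. For $p>1$ and $\varphi\in W^{1,p}(\Omega,\mu)$ let $\operatorname{Tr}\varphi$ be the trace of $\varphi$ on $G^{-1}(0)$, that is the limit in $L^1(G^{-1}(0),\rho)$ of $\varphi_n|_{G^{-1}(0)}$, where $(\varphi_n)$ are bounded Lipschitz functions on $\Omega$ converging to $\varphi$ in $W^{1,p}(\Omega,\mu)$; traces of $H$-valued and operator-valued functions are taken componentwise with respect to $(e_i)$. Let $\Phi\in\mathcal Z(\Omega,H)$, that is $\Phi=\sum_{i=1}^n\varphi_ih_i$ with $n\in\mathbb N$, $h_i\in H$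 and $\varphi_i$ restrictions to $\Omega$ of functions in $\mathscr{FC}^2_b(X)$, and $\langle\Phi,\operatorname{Tr}(\nabla_HG)\rangle_H=0$ $\rho$-a.e. in $G^{-1}(0)$. Then for $\rho$-a.e. $x\in G^{-1}(0)$ $$\langle\operatorname{Tr}(\nabla_H^2G)(x)\Phi(x),\Phi(x)\rangle_H=-\langle(\nabla_H\Phi(x))\Phi(x),\operatorname{Tr}(\nabla_HG)(x)\rangle_H ,$$ where $(\nabla_H\Phi(x))k$ is the derivative of $\Phi$ at $x$ in the direction $k\in H$. -/

import Mathlib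

open MeasureTheory ProbabilityTheory Filter Topology
open scoped ENNReal NNReal ContDiff InnerProductSpace

noncomputable section

namespace GaussLevel

section Basic

variable {X : Type*} [NormedAddCommGroup X] [NormedSpace ℝ X] [MeasurableSpace X] [BorelSpace X]

/-- `X*_μ`, the closure of the dual `X*` in `L²(X, μ)`, with the `L²` inner product. The covariance
operator `R_μ` (`GaussLevel.incl` below) is injective on it and its range, with the transported
inner product, is the Cameron–Martin space `H`. So this space is `H`; an element is `ĥ`, and
`incl μ ĥ` is the corresponding point `h` of `X`. -/
abbrev CM (μ : Measure X) : Type _ :=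
  ↥(LinearMap.range (StrongDual.toLp (𝕜 := ℝ) μ 2).toLinearMap).topologicalClosure

/-- `R_μ ĥ = ∫ ĥ(x) x dμ(x)`, the inclusion of the Cameron–Martin space in `X`. -/
def incl (μ : Measure X) (h : CM μ) : X := ∫ x, ((h : Lp ℝ 2 μ) x) • x ∂μ

/-- A centered measure with nondegenerate covariance. -/
def CenteredNondegenerate (μ : Measure X) : Prop :=
  (∀ L : StrongDual ℝ X, ∫ x, L x ∂μ = 0) ∧
    ∀ L : StrongDual ℝ X, L ≠ 0 → 0 < ∫ x, (L x) ^ 2 ∂μ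

/-! ### Cylindrical functions -/

/-- `C_b^k(ℝⁿ)`: the derivatives of orders `0, …, k` exist, are continuous and bounded. -/
def IsCkb {n : ℕ} (k : ℕ∞) (g : (Fin n → ℝ) → ℝ) : Prop :=
  ContDiff ℝ (k : WithTop ℕ∞) g ∧
    ∀ j : ℕ, (j : ℕ∞) ≤ k → ∃ C : ℝ, ∀ y, ‖iteratedFDeriv ℝ j g y‖ ≤ C

/-- `FC_b^k(X)`. -/
def IsCyl (k : ℕ∞) (f : X → ℝ) : Prop :=
  ∃ (n : ℕ) (L : Fin n → StrongDual ℝ X) (g : (Fin n → ℝ) → ℝ),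
    IsCkb k g ∧ f = fun x => g (fun i => L i x)

/-! ### The Hausdorff–Gauss surface measure of Feyel and de La Pradelle -/

/-- The `k`-dimensional spherical Hausdorff measure: `k`-dimensional premeasure
`ω_k r^k` on balls of radius `r`, where `ω_k` is the volume of the unit ball of `ℝ^k`;
sets that are not balls are not used in coverings. -/
def sphericalHausdorff (k : ℕ) (F : Type*) [MetricSpace F] [MeasurableSpace F] [BorelSpace F] :
    Measure F :=
  Measure.mkMetric' fun s : Set F =>
    ⨅ (c : F) (r : ℝ) (_ : 0 < r) (_ : s = Metric.closedBall c r),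
      ENNReal.ofReal (Real.pi ^ ((k : ℝ) / 2) / Real.Gamma ((k : ℝ) / 2 + 1) * r ^ k)

/-- The upper integral of a function, equal to `∫⁻` if the function is `μ`-measurable. -/
def upperLIntegral (μ : Measure X) (f : X → ℝ≥0∞) : ℝ≥0∞ :=
  ⨅ (g : X → ℝ≥0∞) (_ : Measurable g) (_ : ∀ x, f x ≤ g x), ∫⁻ x, g x ∂μ

/-- `∫ f dθ_F` on the slice `(x - π_F x) + F`, where `F` is the span in `H` of the orthonormal
family `u`, identified with `ℝ^(m+1)`, `π_F x = ∑ û_i(x) u_i` is the measurable projection onto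
`F`, and `θ_F` is the `m`-dimensional spherical Hausdorff measure with density
`(2π)^(-(m+1)/2) exp(-|z|²/2)`. -/
def sliceIntegral (μ : Measure X) {m : ℕ} (u : Fin (m + 1) → CM μ) (f : X → ℝ≥0∞) (x : X) :
    ℝ≥0∞ :=
  ∫⁻ z : EuclideanSpace ℝ (Fin (m + 1)),
    f (x - (∑ i, ((u i : Lp ℝ 2 μ) x) • incl μ (u i)) + ∑ i, z i • incl μ (u i)) *
      ENNReal.ofReal ((2 * Real.pi) ^ (-((m + 1 : ℕ) : ℝ) / 2) * Real.exp (-‖z‖ ^ 2 / 2))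
    ∂(sphericalHausdorff m (EuclideanSpace ℝ (Fin (m + 1))))

/-- `∫ f dρ = sup_F ∫ f dρ^F`, where `F` ranges over the finite-dimensional subspaces of `H`
of positive dimension and `∫ f dρ^F = ∫ (∫ f dθ_F) dμ` is the iterated integral over the slices
parallel to `F`. For Borel `f` the slice integral is `μ`-measurable, so that the upper integral
is the integral. -/
def rhoIntegral (μ : Measure X) (f : X → ℝ≥0∞) : ℝ≥0∞ :=
  ⨆ (m : ℕ) (u : Fin (m + 1) → CM μ) (_ : Orthonormal ℝ u),
    upperLIntegral μ (sliceIntegral μ u f)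

/-- The surface measure `ρ` of a (Borel) set. -/
def rho (μ : Measure X) (A : Set X) : ℝ≥0∞ := rhoIntegral μ (A.indicator fun _ => 1)

/-- `P x` for `ρ`-a.e. `x ∈ S`. -/
def RhoAE (μ : Measure X) (S : Set X) (P : X → Prop) : Prop :=
  ∃ N : Set X, MeasurableSet N ∧ rho μ N = 0 ∧ ∀ x ∈ S, x ∉ N → P x

/-! ### Capacities -/

/-- The Ornstein–Uhlenbeck semigroup. -/
def ou (μ : Measure X) (t : ℝ) (f : X → ℝ) (x : X) : ℝ :=
  ∫ y, f (Real.exp (-t) • x + Real.sqrt (1 - Real.exp (-2 * t)) • y) ∂μ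

/-- `(I - L)^(-k/2) f = Γ(k/2)⁻¹ ∫₀^∞ t^(k/2 - 1) e^(-t) T(t)f dt`, where `L` is the generator
of the Ornstein–Uhlenbeck semigroup `T(t)`. -/
def ouPotential (μ : Measure X) (k : ℕ) (f : X → ℝ) (x : X) : ℝ :=
  (Real.Gamma ((k : ℝ) / 2))⁻¹ *
    ∫ t in Set.Ioi (0 : ℝ), t ^ ((k : ℝ) / 2 - 1) * Real.exp (-t) * ou μ t f x

/-- The capacity `C_{k,p}` of an open set. -/
def capOpen (μ : Measure X) (k : ℕ) (p : ℝ) (A : Set X) : ℝ≥0∞ :=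
  ⨅ (f : X → ℝ) (_ : MemLp f (ENNReal.ofReal p) μ)
    (_ : ∀ᵐ x ∂μ, x ∈ A → 1 ≤ ouPotential μ k f x), eLpNorm f (ENNReal.ofReal p) μ

/-! ### Hilbert–Schmidt tensors, Sobolev spaces and precise versions

A Hilbert–Schmidt tensor of order `j` on `H` is given by its coefficients
`(Fin j → ι) → ℝ` in an orthonormal basis `e` of `H`, its norm being the `ℓ²` norm. -/

/-- The `ℓ²` norm of a family of coefficients. -/
def l2norm {α : Type*} (a : α → ℝ) : ℝ≥0∞ := (∑' s, ENNReal.ofReal (a s ^ 2)) ^ (1 / 2 : ℝ)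

variable {ι : Type*} {μ : Measure X}

/-- The coefficients of `∇_H^j f (x)` for a smooth `f`. -/
def hPartial (e : HilbertBasis ι ℝ (CM μ)) (f : X → ℝ) (j : ℕ) (x : X) (s : Fin j → ι) : ℝ :=
  iteratedFDeriv ℝ j f x fun a => incl μ (e (s a))

/-- `D 0` is (a Borel version of) a function of `W^{k,p}(Ω, μ)` and `D 1, …, D k` are its
derivatives along `H`: there is a sequence of functions in `FC_b^∞` which converges, with its
derivatives, to `D 0, …, D k` in `L^p(Ω, μ)`. -/
def IsSobolev (e : HilbertBasis ι ℝ (CM μ)) (Ω : Set X) (k : ℕ) (p : ℝ)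
    (D : (j : ℕ) → X → (Fin j → ι) → ℝ) : Prop :=
  (∀ j ≤ k, ∀ s, Measurable fun x => D j x s) ∧
    ∃ f : ℕ → X → ℝ, (∀ n, IsCyl ⊤ (f n)) ∧
      ∀ j ≤ k, Tendsto
        (fun n => ∫⁻ x in Ω, l2norm (fun s => D j x s - hPartial e (f n) j x s) ^ p ∂μ)
        atTop (𝓝 0)

/-- Borel measurable and `C_{k,p}`-quasicontinuous. -/
def IsPrecise (μ : Measure X) {α : Type*} (k : ℕ) (p : ℝ) (a : X → α → ℝ) : Prop :=
  (∀ s, Measurable fun x => a x s) ∧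
    ∀ ε : ℝ≥0∞, 0 < ε → ∃ A : Set X, IsOpen A ∧ capOpen μ k p A ≤ ε ∧
      ∀ x ∈ Aᶜ, Tendsto (fun y => l2norm (fun s => a y s - a x s)) (𝓝[Aᶜ] x) (𝓝 0)

/-- A function as a tensor field of order `0`. -/
def coeff₀ (ι : Type*) (f : X → ℝ) : X → (Fin 0 → ι) → ℝ := fun x _ => f x

/-- The coefficients of an `H`-valued function. -/
def coeff₁ (e : HilbertBasis ι ℝ (CM μ)) (F : X → CM μ) : X → (Fin 1 → ι) → ℝ :=
  fun x s => ⟪F x, e (s 0)⟫_ℝ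

/-- The coefficients of an operator-valued function. -/
def coeff₂ (e : HilbertBasis ι ℝ (CM μ)) (A : X → CM μ →L[ℝ] CM μ) : X → (Fin 2 → ι) → ℝ :=
  fun x s => ⟪A x (e (s 0)), e (s 1)⟫_ℝ

/-! ### Differentiability along `H` -/

/-- `F (x + t h) = F x + t (A h) + o(t)` as `t → 0`, uniformly for `h ∈ H` of norm `1`. -/
def HasHDerivAt {E : Type*} [NormedAddCommGroup E] [NormedSpace ℝ E] (F : X → E)
    (A : CM μ →L[ℝ] E) (x : X) : Prop :=
  TendstoUniformlyOn (fun (t : ℝ) (h : CM μ) => t⁻¹ • (F (x + t • incl μ h) - F x))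
    (fun h => A h) (𝓝[≠] 0) (Metric.sphere 0 1)

/-! ### The hypotheses on the domain `Ω = {G ≤ 0}` -/

/-- The standing hypotheses on `G`, with the fixed versions `DG` of `∇_H G` and `D2G` of
`∇_H² G`. -/
structure DomainHyp (e : HilbertBasis ι ℝ (CM μ)) (G : X → ℝ) (DG : X → CM μ)
    (D2G : X → CM μ →L[ℝ] CM μ) : Prop where
  hilbertSchmidt : ∀ x, l2norm (coeff₂ e D2G x) < ⊤
  sobolev : ∀ q : ℝ, 1 < q → ∃ D : (j : ℕ) → X → (Fin j → ι) → ℝ,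
    IsSobolev e Set.univ 3 q D ∧ D 0 = coeff₀ ι G ∧ D 1 = coeff₁ e DG ∧ D 2 = coeff₂ e D2G
  convex : ConvexOn ℝ Set.univ G
  precise₀ : ∀ q : ℝ, 1 < q → IsPrecise μ 3 q (coeff₀ ι G)
  precise₁ : ∀ q : ℝ, 1 < q → IsPrecise μ 2 q (coeff₁ e DG)
  precise₂ : ∀ q : ℝ, 1 < q → IsPrecise μ 1 q (coeff₂ e D2G)
  measure_pos : 0 < μ {x | G x ≤ 0}
  isClosed : IsClosed {x | G x ≤ 0}
  integrable_inv : ∀ q : ℝ, 1 < q → ∫⁻ x in {x | G x ≤ 0}, (‖DG x‖ₑ⁻¹) ^ q ∂μ < ⊤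
  twiceDifferentiable : RhoAE μ (G ⁻¹' {0}) fun x =>
    HasHDerivAt G (innerSL ℝ (DG x)) x ∧ HasHDerivAt DG (D2G x) x
  nonzero : RhoAE μ (G ⁻¹' {0}) fun x => DG x ≠ 0

/-! ### Traces -/

/-- `T` is (a Borel version of) the trace on `G⁻¹(0)` of the function `φ ∈ W^{1,p}(Ω, μ)`,
`Ω = {G ≤ 0}`: the limit in `L¹(G⁻¹(0), ρ)` of a sequence `ψ n` of bounded Lipschitz functions on
`Ω` which converges to `φ` in `W^{1,p}(Ω, μ)`. -/
def IsTrace (e : HilbertBasis ι ℝ (CM μ)) (G : X → ℝ) (p : ℝ) (φ T : X → ℝ) : Prop :=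
  Measurable T ∧
  ∃ (D : (j : ℕ) → X → (Fin j → ι) → ℝ) (ψ : ℕ → X → ℝ)
    (Dψ : ℕ → (j : ℕ) → X → (Fin j → ι) → ℝ),
    IsSobolev e {x | G x ≤ 0} 1 p D ∧ D 0 = coeff₀ ι φ ∧
    (∀ n, (∃ K : ℝ≥0, LipschitzOnWith K (ψ n) {x | G x ≤ 0}) ∧
      (∃ C : ℝ, ∀ x, G x ≤ 0 → |ψ n x| ≤ C) ∧
      IsSobolev e {x | G x ≤ 0} 1 p (Dψ n) ∧ Dψ n 0 = coeff₀ ι (ψ n)) ∧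
    (∀ j ≤ 1, Tendsto
      (fun n => ∫⁻ x in {x | G x ≤ 0}, l2norm (fun s => D j x s - Dψ n j x s) ^ p ∂μ)
      atTop (𝓝 0)) ∧
    Tendsto (fun n => rhoIntegral μ ((G ⁻¹' {0}).indicator fun x => ‖ψ n x - T x‖ₑ))
      atTop (𝓝 0)

/-- The trace of an `H`-valued function, taken componentwise. -/
def IsVectorTrace (e : HilbertBasis ι ℝ (CM μ)) (G : X → ℝ) (p : ℝ) (F T : X → CM μ) : Prop :=
  ∀ i, IsTrace e G p (fun x => ⟪F x, e i⟫_ℝ) (fun x => ⟪T x, e i⟫_ℝ)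

/-- The trace of an operator-valued function, taken componentwise. -/
def IsOperatorTrace (e : HilbertBasis ι ℝ (CM μ)) (G : X → ℝ) (p : ℝ)
    (A T : X → CM μ →L[ℝ] CM μ) : Prop :=
  ∀ i j, IsTrace e G p (fun x => ⟪A x (e j), e i⟫_ℝ) (fun x => ⟪T x (e j), e i⟫_ℝ)

/-! ### Tangential fields -/

/-- `Φ ∈ Z(Ω, H)`, where `TDG` is the trace of `∇_H G`. The coefficients of a field in `Z(Ω, H)`
are restrictions to `Ω` of functions in `FC_b²(X)`; here `Φ` is the field given by such
functions on the whole of `X`, so that only its values on `Ω ⊇ G⁻¹(0)` matter below. -/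
def MemZ (G : X → ℝ) (TDG Φ : X → CM μ) : Prop :=
  (∃ (n : ℕ) (h : Fin n → CM μ) (φ : Fin n → X → ℝ),
    (∀ i, IsCyl 2 (φ i)) ∧ Φ = fun x => ∑ i, φ i x • h i) ∧
  RhoAE μ (G ⁻¹' {0}) fun x => ⟪Φ x, TDG x⟫_ℝ = 0

/-- `(∇_H Φ(x)) k`, the derivative of a smooth field `Φ` at `x` in the direction `k ∈ H`. -/
def hDeriv (Φ : X → CM μ) (x : X) (k : CM μ) : CM μ := fderiv ℝ Φ x (incl μ k)

end Basic

end GaussLevel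

end

open MeasureTheory ProbabilityTheory Filter Topology
open scoped ENNReal NNReal ContDiff InnerProductSpace

set_option linter.unusedSectionVars false

namespace GaussLevel

variable {X : Type*} [NormedAddCommGroup X] [NormedSpace ℝ X] [CompleteSpace X]
  [SecondCountableTopology X] [MeasurableSpace X] [BorelSpace X] {μ : Measure X}

/-! At a point `y` of the level where `G` and its gradient are differentiable along `H`, the
identity is the product rule: `⟪Φ, DG⟫` vanishes on the level, `Φ y` is tangent to the level, and
differentiating along `Φ y` produces the two terms. Two obstacles remain. The orthogonality is known
only `ρ`-a.e., so good points of the level must be found near `y` in the direction `Φ y`; and the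
traces are `L¹` limits that have to be identified with the pointwise derivatives.

Both are settled on lines. Taking one-dimensional `F` in the definition of `ρ` shows that a `ρ`-null
set is missed entirely by almost every line of a given direction (`RhoAE.ae_line`). Convexity gives
the way back. A differentiability point of the level carries a subgradient, so pieces of the level
with slope bounded below are Lipschitz graphs. In planes this carries statements about almost all
lines of direction `u` to the points where other lines cross the level
(`transversalAE_of_invariant`); in finite-dimensional slices it turns statements at transversal
points into `ρ`-a.e. statements (`TransversalAE.rhoAE`). Slices tangent to the level at a regular
point are negligible, since the infimum over parallel slices is convex in the displacement and so
rarely vanishes if it is negative somewhere (`ae_slice_inf_ne_zero`).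

Sobolev functions are absolutely continuous on almost all lines, and the trace is the end value of
the continuous version on a segment in `{G ≤ 0}` (`IsTrace.line`). Pointwise differentiability at
the end point then identifies the traces of `DG` and `D2G` with their restrictions
(`gradient_trace_eq`, `hessian_trace_eq`). Finally, the good points needed for the product rule come
from an intermediate value argument (`exists_levelSet_approx`), and `tangential_second_deriv`
differentiates along them. -/

/-! ### The inclusion of the Cameron–Martin space. -/

theorem integrable_smul_id [IsGaussian μ] (f : Lp ℝ 2 μ) : Integrable (fun x => (f x) • x) μ := by
  have h1 : MemLp f 2 μ := Lp.memLp f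
  have h2 : MemLp (id : X → X) 2 μ := IsGaussian.memLp_two_id
  exact memLp_one_iff_integrable.1 (h2.smul (r := 1) h1)

theorem coeFn_toLp_dual [IsGaussian μ] (L : StrongDual ℝ X) :
    ∀ᵐ x ∂μ, (StrongDual.toLp μ 2 L) x = L x := by
  have h2 : MemLp (id : X → X) 2 μ := IsGaussian.memLp_two_id
  rw [StrongDual.toLp_apply h2]
  exact MemLp.coeFn_toLp (h2.continuousLinearMap_comp L)

theorem dual_incl [IsGaussian μ] (L : StrongDual ℝ X) (h : CM μ) :
    L (incl μ h) = ⟪(h : Lp ℝ 2 μ), StrongDual.toLp μ 2 L⟫_ℝ := by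
  rw [incl, ← L.integral_comp_comm (integrable_smul_id _), L2.inner_def]
  refine integral_congr_ae ?_
  filter_upwards [coeFn_toLp_dual L] with x hx
  rw [hx]
  simp [mul_comm]

/-- The inclusion of the Cameron–Martin space as a continuous linear map. -/
noncomputable def inclCLM (μ : Measure X) [IsGaussian μ] : CM μ →L[ℝ] X :=
  LinearMap.mkContinuous
    { toFun := incl μ
      map_add' := fun f g => by
        rw [incl, incl, incl, ← integral_add (integrable_smul_id _) (integrable_smul_id _)]
        refine integral_congr_ae ?_
        filter_upwards [Lp.coeFn_add (f : Lp ℝ 2 μ) (g : Lp ℝ 2 μ)] with x hx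
        rw [Submodule.coe_add, hx, Pi.add_apply, add_smul]
      map_smul' := fun c f => by
        rw [incl, incl, RingHom.id_apply, ← integral_smul]
        refine integral_congr_ae ?_
        filter_upwards [Lp.coeFn_smul c (f : Lp ℝ 2 μ)] with x hx
        rw [Submodule.coe_smul, hx, Pi.smul_apply, smul_eq_mul, mul_smul] }
    ‖StrongDual.toLp (𝕜 := ℝ) μ 2‖ fun h => by
      refine NormedSpace.norm_le_dual_bound ℝ _ (by positivity) fun L => ?_
      change ‖L (incl μ h)‖ ≤ _
      rw [dual_incl]
      calc _ ≤ ‖(h : Lp ℝ 2 μ)‖ * ‖StrongDual.toLp μ 2 L‖ := norm_inner_le_norm _ _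
        _ ≤ ‖h‖ * (‖StrongDual.toLp (𝕜 := ℝ) μ 2‖ * ‖L‖) := by
          gcongr
          · exact le_rfl
          · exact ContinuousLinearMap.le_opNorm _ _
        _ = _ := by ring

theorem incl_add [IsGaussian μ] (f g : CM μ) : incl μ (f + g) = incl μ f + incl μ g :=
  (inclCLM μ).map_add f g

theorem incl_sub [IsGaussian μ] (f g : CM μ) : incl μ (f - g) = incl μ f - incl μ g :=
  (inclCLM μ).map_sub f g

theorem incl_neg [IsGaussian μ] (f : CM μ) : incl μ (-f) = -incl μ f :=
  (inclCLM μ).map_neg f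

theorem incl_zero [IsGaussian μ] : incl μ (0 : CM μ) = 0 := (inclCLM μ).map_zero

theorem incl_smul [IsGaussian μ] (c : ℝ) (f : CM μ) : incl μ (c • f) = c • incl μ f :=
  (inclCLM μ).map_smul c f

theorem incl_sum [IsGaussian μ] {κ : Type*} (s : Finset κ) (f : κ → CM μ) :
    incl μ (∑ i ∈ s, f i) = ∑ i ∈ s, incl μ (f i) :=
  map_sum (inclCLM μ) f s

theorem continuous_incl [IsGaussian μ] : Continuous (incl μ) := (inclCLM μ).continuous

/-! ### Characteristic functions, and Fubini along Cameron–Martin lines. -/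

theorem norm_exp_mul_I_sub_exp_mul_I_le (a b : ℝ) :
    ‖Complex.exp (a * Complex.I) - Complex.exp (b * Complex.I)‖ ≤ ‖a - b‖ := by
  have h : Complex.exp (a * Complex.I) - Complex.exp (b * Complex.I)
      = Complex.exp (b * Complex.I) * (Complex.exp (Complex.I * ((a - b : ℝ) : ℂ)) - 1) := by
    rw [mul_sub, ← Complex.exp_add]
    congr 2
    · push_cast; ring
    · ring
  rw [h, norm_mul, Complex.norm_exp_ofReal_mul_I, one_mul]
  exact Real.norm_exp_I_mul_ofReal_sub_one_le

theorem integrable_exp_mul_I {ν : Measure X} [IsFiniteMeasure ν] {f : X → ℝ}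
    (hf : AEStronglyMeasurable f ν) :
    Integrable (fun x => Complex.exp (f x * Complex.I)) ν := by
  refine Integrable.of_bound (C := 1) ?_ (Eventually.of_forall fun x => ?_)
  · have : Continuous fun a : ℝ => Complex.exp (a * Complex.I) := by fun_prop
    exact this.comp_aestronglyMeasurable hf
  · rw [Complex.norm_exp_ofReal_mul_I]

theorem continuous_charFun_Lp [IsGaussian μ] :
    Continuous fun f : Lp ℝ 2 μ => ∫ x, Complex.exp (f x * Complex.I) ∂μ := by
  refine LipschitzWith.continuous (K := 1) (LipschitzWith.of_dist_le_mul fun f g => ?_)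
  rw [dist_eq_norm, ← integral_sub (integrable_exp_mul_I (Lp.aestronglyMeasurable f))
    (integrable_exp_mul_I (Lp.aestronglyMeasurable g)), NNReal.coe_one, one_mul, dist_eq_norm,
    Lp.norm_def]
  have hfg : MemLp (fun x => f x - g x) 2 μ := (Lp.memLp f).sub (Lp.memLp g)
  have h1 : Integrable (fun x => f x - g x) μ := hfg.integrable (by norm_num)
  calc _ ≤ ∫ x, ‖f x - g x‖ ∂μ := by
        refine norm_integral_le_of_norm_le h1.norm (Eventually.of_forall fun x => ?_)
        exact norm_exp_mul_I_sub_exp_mul_I_le _ _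
    _ = (eLpNorm (fun x => f x - g x) 1 μ).toReal := by
        rw [eLpNorm_one_eq_lintegral_enorm, integral_norm_eq_lintegral_enorm h1.1]
    _ ≤ (eLpNorm (fun x => f x - g x) 2 μ).toReal := by
        refine ENNReal.toReal_mono hfg.2.ne ?_
        exact eLpNorm_le_eLpNorm_of_exponent_le (by norm_num) hfg.1
    _ = _ := by
        congr 1
        exact eLpNorm_congr_ae (Lp.coeFn_sub f g).symm

/-- Continuous functionals are centered Gaussian variables whose variance is the squared `L²` norm;
the formula is a closed condition in `L²`, so it passes to the closure of the dual. -/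
theorem charFun_CM [IsGaussian μ] (hμ : ∀ L : StrongDual ℝ X, ∫ x, L x ∂μ = 0) (f : CM μ) :
    ∫ x, Complex.exp (((f : Lp ℝ 2 μ) x) * Complex.I) ∂μ = Complex.exp (-(‖f‖ ^ 2 : ℝ) / 2) := by
  have hcl : IsClosed {f : Lp ℝ 2 μ | ∫ x, Complex.exp (f x * Complex.I) ∂μ
      = Complex.exp (-(‖f‖ ^ 2 : ℝ) / 2)} :=
    isClosed_eq continuous_charFun_Lp (by fun_prop)
  have hsub : ((LinearMap.range (StrongDual.toLp (𝕜 := ℝ) μ 2).toLinearMap : Submodule ℝ _) :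
      Set (Lp ℝ 2 μ)) ⊆ {f : Lp ℝ 2 μ | ∫ x, Complex.exp (f x * Complex.I) ∂μ
      = Complex.exp (-(‖f‖ ^ 2 : ℝ) / 2)} := by
    rintro _ ⟨L, rfl⟩
    have hL := coeFn_toLp_dual (μ := μ) L
    have hV : ‖StrongDual.toLp μ 2 L‖ ^ 2 = Var[L; μ] := by
      rw [← real_inner_self_eq_norm_sq, L2.inner_def,
        variance_of_integral_eq_zero (by fun_prop) (hμ L)]
      refine integral_congr_ae ?_
      filter_upwards [hL] with x hx
      rw [hx]
      simp [sq]
    have := IsGaussian.charFunDual_eq (μ := μ) L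
    have h0 : ∫ x, ((L x : ℝ) : ℂ) ∂μ = 0 := by rw [integral_complex_ofReal, hμ L]; simp
    rw [charFunDual_apply] at this
    change ∫ x, Complex.exp ((StrongDual.toLp μ 2 L) x * Complex.I) ∂μ
      = Complex.exp (-(‖StrongDual.toLp μ 2 L‖ ^ 2 : ℝ) / 2)
    rw [hV]
    calc _ = ∫ v, Complex.exp (L v * Complex.I) ∂μ := by
          refine integral_congr_ae ?_
          filter_upwards [hL] with x hx
          rw [hx]
      _ = _ := by
          rw [this, h0]
          congr 1
          ring
  exact (hcl.closure_subset_iff.2 hsub) f.2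

/-- A Gaussian measure is the mixture of its conditional laws on the lines parallel to `u`:
moving the point `x - ℓ x • u` by an independent Gaussian multiple of `u` does not change the
law. -/
def LineDecomp (μ : Measure X) (u : CM μ) (ℓ : X → ℝ) (v : ℝ≥0) : Prop :=
  Measurable ℓ ∧ v ≠ 0 ∧
    (μ.prod (gaussianReal 0 v)).map (fun q : X × ℝ => q.1 + (q.2 - ℓ q.1) • incl μ u) = μ

theorem measurable_line_map {ℓ : X → ℝ} (hℓ : Measurable ℓ) (h : X) :
    Measurable fun q : X × ℝ => q.1 + (q.2 - ℓ q.1) • h := by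
  fun_prop

/-- Subtracting the orthogonal projection on `u` leaves a part independent of `û`, so the component
along `u` can be resampled. The check is by characteristic functions: Pythagoras splits the
exponent. -/
theorem exists_lineDecomp [IsGaussian μ] (hμ : ∀ L : StrongDual ℝ X, ∫ x, L x ∂μ = 0) (u : CM μ)
    (hu : u ≠ 0) : ∃ ℓ v, LineDecomp μ u ℓ v := by
  -- With this factor `ℓ` is the coordinate of the projection on `u`, and its variance is `r`.
  set r : ℝ := (‖u‖ ^ 2)⁻¹ with hr
  have hn : ‖u‖ ≠ 0 := norm_ne_zero_iff.2 hu
  set ℓ : X → ℝ := fun x => r * ((u : Lp ℝ 2 μ) x) with hℓdef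
  have hℓ : Measurable ℓ := (Lp.stronglyMeasurable (u : Lp ℝ 2 μ)).measurable.const_mul r
  have hr0 : 0 < r := by positivity
  obtain ⟨v, hv⟩ : ∃ v : ℝ≥0, (v : ℝ) = r := ⟨r.toNNReal, Real.coe_toNNReal r hr0.le⟩
  refine ⟨ℓ, v, hℓ, fun h => hr0.ne' (by rw [← hv, h]; rfl), ?_⟩
  have hmap := measurable_line_map hℓ (incl μ u)
  have : IsProbabilityMeasure ((μ.prod (gaussianReal 0 v)).map
      (fun q : X × ℝ => q.1 + (q.2 - ℓ q.1) • incl μ u)) :=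
    Measure.isProbabilityMeasure_map hmap.aemeasurable
  refine Measure.ext_of_charFunDual ?_
  ext L
  set a : CM μ := ⟨StrongDual.toLp μ 2 L, Submodule.le_topologicalClosure _ ⟨L, rfl⟩⟩ with ha
  have haL : ∀ᵐ x ∂μ, ((a : Lp ℝ 2 μ) x) = L x := coeFn_toLp_dual L
  set d : ℝ := L (incl μ u) with hd
  have hd' : d = ⟪u, a⟫_ℝ := dual_incl L u
  have key : ∀ᵐ x ∂μ, (((a - (d * r) • u : CM μ) : Lp ℝ 2 μ) x) = L x - d * ℓ x := by
    filter_upwards [haL, Lp.coeFn_sub (a : Lp ℝ 2 μ) (((d * r) • u : CM μ) : Lp ℝ 2 μ),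
      Lp.coeFn_smul (d * r) (u : Lp ℝ 2 μ)] with x h1 h2 h3
    rw [Submodule.coe_sub, h2, Pi.sub_apply, h1, Submodule.coe_smul, h3]
    simp [hℓdef, mul_assoc]
  have hnorm : ‖a - (d * r) • u‖ ^ 2 = ‖a‖ ^ 2 - d ^ 2 * r := by
    have h1 : ⟪a, (d * r) • u⟫_ℝ = d * r * d :=
      (real_inner_smul_right a u (d * r)).trans
        (congrArg (d * r * ·) ((real_inner_comm u a).trans hd'.symm))
    rw [norm_sub_sq_real, norm_smul, h1, mul_pow,
      Real.norm_eq_abs, sq_abs, hr]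
    field_simp
    ring
  rw [charFunDual_apply, charFunDual_apply,
    integral_map hmap.aemeasurable (Measurable.aestronglyMeasurable (by fun_prop))]
  calc _ = ∫ q : X × ℝ, Complex.exp ((L q.1 - d * ℓ q.1 : ℝ) * Complex.I)
          * Complex.exp (d * q.2 * Complex.I) ∂(μ.prod (gaussianReal 0 v)) := by
        refine integral_congr_ae (Eventually.of_forall fun q => ?_)
        simp only [← Complex.exp_add, map_add, map_smul, smul_eq_mul]
        rw [← hd]
        congr 1
        push_cast
        ring
    _ = (∫ x, Complex.exp ((L x - d * ℓ x : ℝ) * Complex.I) ∂μ)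
          * ∫ t, Complex.exp (d * t * Complex.I) ∂(gaussianReal 0 v) :=
        integral_prod_mul (μ := μ) (fun x => Complex.exp ((L x - d * ℓ x : ℝ) * Complex.I))
          (fun t : ℝ => Complex.exp (d * t * Complex.I))
    _ = Complex.exp (-(‖a - (d * r) • u‖ ^ 2 : ℝ) / 2) * Complex.exp (-(r * d ^ 2 / 2)) := by
        congr 1
        · rw [← charFun_CM hμ]
          refine integral_congr_ae ?_
          filter_upwards [key] with x hx
          rw [hx]
        · have := charFun_gaussianReal (μ := 0) (v := v) d
          rw [charFun_apply_real] at this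
          rw [this]
          congr 1
          rw [hv]
          simp
    _ = Complex.exp (-(‖a‖ ^ 2 : ℝ) / 2) := by
        rw [← Complex.exp_add, hnorm]
        congr 1
        push_cast
        ring
    _ = _ := by
        rw [← charFun_CM hμ]
        refine integral_congr_ae ?_
        filter_upwards [haL] with x hx
        rw [hx]

theorem LineDecomp.ae_ae {u : CM μ} {ℓ : X → ℝ} {v : ℝ≥0} [IsGaussian μ]
    (h : LineDecomp μ u ℓ v) {P : X → Prop}
    (hP : ∀ᵐ x ∂μ, P x) : ∀ᵐ x ∂μ, ∀ᵐ t : ℝ, P (x + (t - ℓ x) • incl μ u) := by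
  rw [← h.2.2] at hP
  have h1 := Measure.ae_ae_of_ae_prod
    (ae_of_ae_map (measurable_line_map h.1 (incl μ u)).aemeasurable hP)
  filter_upwards [h1] with x hx
  exact (gaussianReal_absolutelyContinuous' 0 h.2.1).ae_le hx

theorem ae_add_const {P : ℝ → Prop} (hP : ∀ᵐ t : ℝ, P t) (c : ℝ) : ∀ᵐ t : ℝ, P (t + c) :=
  (measurePreserving_add_right volume c).quasiMeasurePreserving.ae hP

/-- The offset `ℓ x` only translates the parameter, so it disappears from Lebesgue-a.e. statements.
-/
theorem ae_ae_add_smul [IsGaussian μ] (hμ : ∀ L : StrongDual ℝ X, ∫ x, L x ∂μ = 0) (u : CM μ)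
    {P : X → Prop} (hP : ∀ᵐ x ∂μ, P x) : ∀ᵐ x ∂μ, ∀ᵐ s : ℝ, P (x + s • incl μ u) := by
  by_cases hu : u = 0
  · filter_upwards [hP] with x hx
    exact Eventually.of_forall fun s => by simpa [hu, incl_zero] using hx
  obtain ⟨ℓ, v, h⟩ := exists_lineDecomp hμ u hu
  filter_upwards [h.ae_ae hP] with x hx
  filter_upwards [ae_add_const hx (ℓ x)] with s hs
  simpa using hs

/-- A Borel set whose sections by almost all lines parallel to `u` are Lebesgue null is null. -/
theorem ae_notMem_of_ae_ae [IsGaussian μ] (hμ : ∀ L : StrongDual ℝ X, ∫ x, L x ∂μ = 0)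
    (u : CM μ) {D : Set X} (hD : MeasurableSet D)
    (h : ∀ᵐ x ∂μ, ∀ᵐ s : ℝ, x + s • incl μ u ∉ D) : ∀ᵐ x ∂μ, x ∉ D := by
  by_cases hu : u = 0
  · filter_upwards [h] with x hx
    obtain ⟨s, hs⟩ := hx.exists
    simpa [hu, incl_zero] using hs
  obtain ⟨ℓ, v, hd⟩ := exists_lineDecomp hμ u hu
  have hmap := measurable_line_map hd.1 (incl μ u)
  rw [← hd.2.2]
  rw [ae_map_iff hmap.aemeasurable hD.compl]
  refine (Measure.ae_prod_iff_ae_ae (hmap hD.compl)).2 ?_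
  filter_upwards [h] with x hx
  have := ae_add_const hx (-ℓ x)
  filter_upwards [(gaussianReal_absolutelyContinuous 0 hd.2.1).ae_le this] with t ht
  simpa [sub_eq_add_neg] using ht

/-- Translation by `h` shifts the parameter of each line of direction `h` by one, which preserves
Lebesgue null sets. No density formula is needed. -/
theorem ae_add_incl [IsGaussian μ] (hμ : ∀ L : StrongDual ℝ X, ∫ x, L x ∂μ = 0) (h : CM μ)
    {P : X → Prop} (hP : ∀ᵐ x ∂μ, P x) : ∀ᵐ x ∂μ, P (x + incl μ h) := by
  set D := toMeasurable μ {x | ¬ P x} with hDdef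
  have hD0 : ∀ᵐ x ∂μ, x ∉ D := by
    rw [← measure_eq_zero_iff_ae_notMem, hDdef, measure_toMeasurable]
    exact hP
  have hD : MeasurableSet ((fun x : X => x + incl μ h) ⁻¹' D) :=
    (measurable_add_const _) (measurableSet_toMeasurable _ _)
  have : ∀ᵐ x ∂μ, x ∉ (fun x : X => x + incl μ h) ⁻¹' D := by
    refine ae_notMem_of_ae_ae hμ h hD ?_
    filter_upwards [ae_ae_add_smul hμ h hD0] with x hx
    filter_upwards [ae_add_const hx 1] with s hs
    simpa [add_smul, add_assoc] using hs
  filter_upwards [this] with x hx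
  by_contra hc
  exact hx (subset_toMeasurable μ _ hc)

/-- Quasi-invariance under a measurable family of Cameron–Martin translations. -/
theorem ae_ae_add_incl [IsGaussian μ] (hμ : ∀ L : StrongDual ℝ X, ∫ x, L x ∂μ = 0)
    {Z : Type*} [MeasurableSpace Z] (ν : Measure Z) [SFinite ν] (a : Z → CM μ)
    (ha : Measurable fun z => incl μ (a z)) {P : X → Prop} (hP : ∀ᵐ x ∂μ, P x) :
    ∀ᵐ x ∂μ, ∀ᵐ z ∂ν, P (x + incl μ (a z)) := by
  set D := toMeasurable μ {x | ¬ P x} with hDdef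
  have hD0 : ∀ᵐ x ∂μ, x ∉ D := by
    rw [← measure_eq_zero_iff_ae_notMem, hDdef, measure_toMeasurable]
    exact hP
  have hm : MeasurableSet {q : Z × X | q.2 + incl μ (a q.1) ∉ D} := by
    have : Measurable fun q : Z × X => q.2 + incl μ (a q.1) :=
      measurable_snd.add (ha.comp measurable_fst)
    exact this (measurableSet_toMeasurable _ _).compl
  have h1 : ∀ᵐ z ∂ν, ∀ᵐ x ∂μ, x + incl μ (a z) ∉ D :=
    Eventually.of_forall fun z => ae_add_incl hμ (a z) hD0
  filter_upwards [(Measure.ae_ae_comm hm).1 h1] with x hx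
  filter_upwards [hx] with z hz
  by_contra hc
  exact hz (subset_toMeasurable μ _ hc)

/-- Fubini along lines: an integrable function is integrable on the compact pieces of almost all
lines. -/
theorem LineDecomp.ae_lintegral_ne_top [IsGaussian μ] {u : CM μ} {ℓ : X → ℝ} {v : ℝ≥0}
    (h : LineDecomp μ u ℓ v)
    {F : X → ℝ≥0∞} (hF : Measurable F) (hfin : ∫⁻ x, F x ∂μ ≠ ⊤) :
    ∀ᵐ x ∂μ, ∀ R : ℝ, ∫⁻ t in Set.Icc (-R) R, F (x + (t - ℓ x) • incl μ u) ≠ ⊤ := by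
  have hmap := measurable_line_map h.1 (incl μ u)
  have h1 : ∫⁻ x, ∫⁻ t, F (x + (t - ℓ x) • incl μ u) ∂(gaussianReal 0 v) ∂μ ≠ ⊤ := by
    rw [← h.2.2, lintegral_map hF hmap] at hfin
    rwa [← lintegral_prod (μ := μ) (ν := gaussianReal 0 v)
      (fun q : X × ℝ => F (q.1 + (q.2 - ℓ q.1) • incl μ u)) (hF.comp hmap).aemeasurable]
  have hm2 : Measurable fun x => ∫⁻ t, F (x + (t - ℓ x) • incl μ u) ∂(gaussianReal 0 v) :=
    Measurable.lintegral_prod_right' (f := fun q : X × ℝ => F (q.1 + (q.2 - ℓ q.1) • incl μ u))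
      (hF.comp hmap)
  filter_upwards [ae_lt_top hm2 h1] with x hx R
  have hFx : Measurable fun t : ℝ => F (x + (t - ℓ x) • incl μ u) :=
    (hF.comp hmap).comp (measurable_prodMk_left (x := x))
  -- On `[-R, R]` the Gaussian density is at least its value at `R`.
  set κ := gaussianPDF 0 v R with hκ
  have hκ0 : κ ≠ 0 := (gaussianPDF_pos 0 h.2.1 R).ne'
  have hle : κ * ∫⁻ t in Set.Icc (-R) R, F (x + (t - ℓ x) • incl μ u)
      ≤ ∫⁻ t, F (x + (t - ℓ x) • incl μ u) ∂(gaussianReal 0 v) := by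
    rw [gaussianReal_of_var_ne_zero _ h.2.1, lintegral_withDensity_eq_lintegral_mul _
      (measurable_gaussianPDF 0 v) hFx, ← lintegral_const_mul _ hFx]
    refine (setLIntegral_mono' measurableSet_Icc fun t ht => ?_).trans
      (setLIntegral_le_lintegral _ _)
    simp only [Pi.mul_apply]
    gcongr
    rw [hκ, gaussianPDF, gaussianPDF, gaussianPDFReal, gaussianPDFReal]
    have : (t - 0) ^ 2 ≤ (R - 0) ^ 2 := by
      rw [sub_zero, sub_zero]
      exact sq_le_sq' ht.1 ht.2
    gcongr
  intro htop
  rw [htop, ENNReal.mul_top hκ0] at hle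
  exact hx.ne (top_le_iff.1 hle)

/-! ### Null sets of spherical Hausdorff measures. -/

section SphericalHausdorff

variable {F : Type*} [MetricSpace F] [MeasurableSpace F] [BorelSpace F]

/-- The gauge on sets that defines `sphericalHausdorff`. -/
noncomputable def ballGauge (k : ℕ) (s : Set F) : ℝ≥0∞ :=
  ⨅ (c : F) (r : ℝ) (_ : 0 < r) (_ : s = Metric.closedBall c r),
      ENNReal.ofReal (Real.pi ^ ((k : ℝ) / 2) / Real.Gamma ((k : ℝ) / 2 + 1) * r ^ k)

theorem sphericalHausdorff_eq (k : ℕ) :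
    sphericalHausdorff k F = Measure.mkMetric' (ballGauge k) := rfl

/-- In dimension zero every ball has gauge one, so the measure dominates each Dirac mass. -/
theorem sphericalHausdorff_zero_ne_zero {A : Set F} (hA : A.Nonempty) :
    sphericalHausdorff 0 F A ≠ 0 := by
  obtain ⟨z, hz⟩ := hA
  have h1 : OuterMeasure.dirac z ≤ OuterMeasure.mkMetric' (ballGauge (F := F) 0) := by
    refine le_iSup₂_of_le (1 : ℝ≥0∞) one_pos ?_
    refine OuterMeasure.mkMetric'.le_pre.2 fun s _ => ?_
    refine le_iInf fun c => le_iInf fun r => le_iInf fun hr => le_iInf fun _ => ?_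
    rw [OuterMeasure.dirac_apply]
    refine (Set.indicator_le_self' (fun _ _ => zero_le) z).trans ?_
    simp
  have h2 : (1 : ℝ≥0∞) ≤ sphericalHausdorff 0 F A := by
    rw [sphericalHausdorff_eq]
    refine le_trans ?_ (le_toMeasure_apply _ _ _)
    refine le_trans ?_ (h1 A)
    simp [OuterMeasure.dirac_apply, hz]
  exact fun h => by simp [h] at h2

/-- Each nonempty set of a Hausdorff covering is enlarged to a ball centered at one of its points.
The radius exceeds the diameter by some `δ > 0`, since the gauge ignores degenerate balls; the extra
cost is absorbed by a summable `η`. Radii are at most `2 * ε`, whence diameters at most `4 * ε`. -/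
theorem exists_ball_cover {k : ℕ} {Z : Set F} (hZ : μH[(k : ℝ)] Z = 0) {ε : ℝ} (hε : 0 < ε) :
    ∃ U : Set F, MeasurableSet U ∧ Z ⊆ U ∧
      OuterMeasure.mkMetric'.pre (ballGauge k) (ENNReal.ofReal (4 * ε)) U
        ≤ ENNReal.ofReal (Real.pi ^ ((k : ℝ) / 2) / Real.Gamma ((k : ℝ) / 2 + 1)) *
          (2 * ENNReal.ofReal ε) := by
  set κ : ℝ := Real.pi ^ ((k : ℝ) / 2) / Real.Gamma ((k : ℝ) / 2 + 1) with hκ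
  have hκ0 : 0 ≤ κ := div_nonneg (by positivity) (Real.Gamma_pos_of_pos (by positivity)).le
  have hε' : (0 : ℝ≥0∞) < ENNReal.ofReal ε := ENNReal.ofReal_pos.2 hε
  have h0 : (⨅ (t : ℕ → Set F) (_ : Z ⊆ ⋃ n, t n) (_ : ∀ n, Metric.ediam (t n) ≤ ENNReal.ofReal ε),
      ∑' n, ⨆ _ : (t n).Nonempty, Metric.ediam (t n) ^ (k : ℝ)) < ENNReal.ofReal ε := by
    refine lt_of_le_of_lt ?_ hε'
    rw [← hZ, Measure.hausdorffMeasure_apply]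
    exact le_iSup₂ (f := fun (r : ℝ≥0∞) (_ : 0 < r) =>
      ⨅ (t : ℕ → Set F) (_ : Z ⊆ ⋃ n, t n) (_ : ∀ n, Metric.ediam (t n) ≤ r),
          ∑' n, ⨆ _ : (t n).Nonempty, Metric.ediam (t n) ^ (k : ℝ)) _ hε'
  simp only [iInf_lt_iff] at h0
  obtain ⟨t, hcov, hdiam, hsum⟩ := h0
  obtain ⟨η, hη0, hηs⟩ := ENNReal.exists_pos_sum_of_countable hε'.ne' ℕ
  have hB : ∀ n, ∃ B : Set F, MeasurableSet B ∧ t n ⊆ B ∧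
      OuterMeasure.mkMetric'.pre (ballGauge k) (ENNReal.ofReal (4 * ε)) B
        ≤ ENNReal.ofReal κ * ((⨆ _ : (t n).Nonempty, Metric.ediam (t n) ^ (k : ℝ)) + η n) := by
    intro n
    rcases (t n).eq_empty_or_nonempty with hn | hn
    · exact ⟨∅, MeasurableSet.empty, hn.subset, by simp⟩
    obtain ⟨c, hc⟩ := hn
    have hfin : Metric.ediam (t n) ≠ ⊤ := ((hdiam n).trans_lt ENNReal.ofReal_lt_top).ne
    set d := (Metric.ediam (t n)).toReal with hd
    have hd0 : 0 ≤ d := ENNReal.toReal_nonneg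
    have hdε : d ≤ ε := ENNReal.toReal_le_of_le_ofReal hε.le (hdiam n)
    obtain ⟨δ, hδ0, hδε, hδ⟩ : ∃ δ : ℝ, 0 < δ ∧ δ ≤ ε ∧ (d + δ) ^ k ≤ d ^ k + η n := by
      have hcont : Tendsto (fun δ : ℝ => (d + δ) ^ k) (𝓝 0) (𝓝 ((d + 0) ^ k)) :=
        (Continuous.tendsto (by fun_prop) 0)
      rw [add_zero] at hcont
      have hlt : d ^ k < d ^ k + η n := lt_add_of_pos_right _ (hη0 n)
      have h1 : ∀ᶠ δ : ℝ in 𝓝[>] 0, (d + δ) ^ k < d ^ k + η n :=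
        (hcont.eventually_lt_const hlt).filter_mono nhdsWithin_le_nhds
      have h2 : ∀ᶠ δ : ℝ in 𝓝[>] 0, δ ∈ Set.Ioc 0 ε := Ioc_mem_nhdsGT hε
      obtain ⟨δ, h1, h2⟩ := (h1.and h2).exists
      exact ⟨δ, h2.1, h2.2, h1.le⟩
    have hr : 0 < d + δ := by positivity
    refine ⟨Metric.closedBall c (d + δ), measurableSet_closedBall, fun y hy => ?_, ?_⟩
    · rw [Metric.mem_closedBall]
      have : dist y c ≤ d := by
        rw [hd, dist_edist]
        exact ENNReal.toReal_mono hfin (Metric.edist_le_ediam_of_mem hy hc)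
      linarith
    · refine (OuterMeasure.mkMetric'.pre_le ?_).trans ?_
      · rw [← Metric.closedEBall_ofReal hr.le]
        refine Metric.ediam_closedEBall_le.trans ?_
        rw [show (2 : ℝ≥0∞) = ENNReal.ofReal 2 by simp, ← ENNReal.ofReal_mul (by norm_num)]
        exact ENNReal.ofReal_le_ofReal (by linarith)
      · refine (iInf₂_le_of_le c (d + δ) ((iInf_le _ hr).trans (iInf_le _ rfl))).trans ?_
        rw [← hκ, ENNReal.ofReal_mul hκ0]
        gcongr
        rw [ciSup_pos ⟨c, hc⟩]
        refine (ENNReal.ofReal_le_ofReal hδ).trans ?_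
        rw [ENNReal.ofReal_add (by positivity) (by positivity), ENNReal.ofReal_coe_nnreal,
          ENNReal.ofReal_pow hd0, hd, ENNReal.ofReal_toReal hfin, ENNReal.rpow_natCast]
  choose B hBm hBt hBle using hB
  refine ⟨⋃ n, B n, MeasurableSet.iUnion hBm, hcov.trans (Set.iUnion_mono hBt), ?_⟩
  refine (measure_iUnion_le B).trans ((ENNReal.tsum_le_tsum hBle).trans ?_)
  rw [ENNReal.tsum_mul_left, ENNReal.tsum_add, two_mul]
  gcongr

/-- The spherical Hausdorff measure is absolutely continuous with respect to the Hausdorff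
measure of the same dimension. -/
theorem sphericalHausdorff_eq_zero {k : ℕ} {Z : Set F} (hZ : μH[(k : ℝ)] Z = 0) :
    sphericalHausdorff k F Z = 0 := by
  have hpos : ∀ n : ℕ, (0 : ℝ) < 1 / ((n : ℝ) + 1) := fun n => by positivity
  choose U hUm hZU hU using fun n : ℕ => exists_ball_cover hZ (hpos n)
  -- The measure agrees with its outer measure only on measurable sets; the intersection of the
  -- covers is a measurable superset of `Z`.
  refine measure_mono_null (Set.subset_iInter hZU) ?_
  rw [sphericalHausdorff_eq, Measure.mkMetric', toMeasure_apply _ _ (MeasurableSet.iInter hUm),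
    OuterMeasure.mkMetric', OuterMeasure.iSup_apply]
  refine le_antisymm (iSup_le fun r => ?_) zero_le
  rw [OuterMeasure.iSup_apply]
  refine iSup_le fun hr => ?_
  have hlim : Tendsto (fun n : ℕ => (1 : ℝ) / ((n : ℝ) + 1)) atTop (𝓝 0) :=
    tendsto_one_div_add_atTop_nhds_zero_nat
  have hl1 : Tendsto (fun n : ℕ => ENNReal.ofReal (4 * (1 / ((n : ℝ) + 1)))) atTop (𝓝 0) := by
    have := ENNReal.tendsto_ofReal (hlim.const_mul 4)
    simpa only [mul_zero, ENNReal.ofReal_zero] using this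
  have hl2 : Tendsto (fun n : ℕ =>
      ENNReal.ofReal (Real.pi ^ ((k : ℝ) / 2) / Real.Gamma ((k : ℝ) / 2 + 1)) *
        (2 * ENNReal.ofReal (1 / ((n : ℝ) + 1)))) atTop (𝓝 0) := by
    have h3 := ENNReal.tendsto_ofReal hlim
    rw [ENNReal.ofReal_zero] at h3
    have h4 := ENNReal.Tendsto.const_mul (a := 2) h3 (Or.inr (by simp))
    have h5 := ENNReal.Tendsto.const_mul
      (a := ENNReal.ofReal (Real.pi ^ ((k : ℝ) / 2) / Real.Gamma ((k : ℝ) / 2 + 1))) h4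
      (Or.inr ENNReal.ofReal_ne_top)
    simpa only [mul_zero] using h5
  refine ge_of_tendsto hl2 ?_
  filter_upwards [hl1.eventually_lt_const hr] with n hn
  calc _ ≤ OuterMeasure.mkMetric'.pre (ballGauge k)
            (ENNReal.ofReal (4 * (1 / ((n : ℝ) + 1)))) (⋂ i, U i) :=
        OuterMeasure.mkMetric'.mono_pre _ hn.le _
    _ ≤ OuterMeasure.mkMetric'.pre (ballGauge k)
            (ENNReal.ofReal (4 * (1 / ((n : ℝ) + 1)))) (U n) :=
        measure_mono (Set.iInter_subset _ _)
    _ ≤ _ := hU n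

end SphericalHausdorff

/-- If on `P` the map `σ` is controlled by the map `π`, then the image of `P` under `σ` is null
as soon as the one under `π` is. -/
theorem hausdorffMeasure_image_eq_zero {α E E' : Type*} [EMetricSpace E] [MeasurableSpace E]
    [BorelSpace E] [EMetricSpace E'] [MeasurableSpace E'] [BorelSpace E'] {P : Set α}
    {π : α → E} {σ : α → E'} {C : ℝ≥0} {d : ℝ} (hd : 0 ≤ d)
    (h : ∀ p ∈ P, ∀ q ∈ P, edist (σ p) (σ q) ≤ C * edist (π p) (π q))
    (h0 : μH[d] (π '' P) = 0) : μH[d] (σ '' P) = 0 := by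
  rcases P.eq_empty_or_nonempty with rfl | ⟨p₀, -⟩
  · simp
  have : Nonempty α := ⟨p₀⟩
  -- A section of `π` over `π '' P`. The control makes `σ ∘ g` Lipschitz, and it also forces `σ` to
  -- be constant on the fibres of `π` in `P`, so no image point is lost.
  set g : E → α := Function.invFunOn π P
  have hg : ∀ p ∈ P, g (π p) ∈ P ∧ π (g (π p)) = π p := fun p hp =>
    ⟨Function.invFunOn_mem ⟨p, hp, rfl⟩, Function.invFunOn_eq ⟨p, hp, rfl⟩⟩
  have hL : LipschitzOnWith C (σ ∘ g) (π '' P) := by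
    rintro _ ⟨p, hp, rfl⟩ _ ⟨q, hq, rfl⟩
    have := h _ (hg p hp).1 _ (hg q hq).1
    rwa [(hg p hp).2, (hg q hq).2] at this
  have him : σ '' P ⊆ (σ ∘ g) '' (π '' P) := by
    rintro _ ⟨p, hp, rfl⟩
    refine ⟨π p, ⟨p, hp, rfl⟩, ?_⟩
    have := h _ (hg p hp).1 p hp
    rw [(hg p hp).2, edist_self, mul_zero] at this
    exact edist_eq_zero.1 (le_antisymm this zero_le)
  refine measure_mono_null him (le_antisymm ?_ zero_le)
  refine (hL.hausdorffMeasure_image_le hd).trans ?_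
  rw [h0, mul_zero]

/-- A set that is a Lipschitz graph over a Lebesgue null set of a coordinate hyperplane is null
for the spherical Hausdorff measure of codimension one. -/
theorem sphericalHausdorff_graph_eq_zero {m : ℕ} {Z : Set (EuclideanSpace ℝ (Fin (m + 1)))}
    (i : Fin (m + 1)) {C : ℝ≥0}
    (h : ∀ z ∈ Z, ∀ z' ∈ Z, dist z z' ≤
      C * dist (fun j => z (i.succAbove j)) (fun j => z' (i.succAbove j)))
    (h0 : volume ((fun (z : EuclideanSpace ℝ (Fin (m + 1))) (j : Fin m) =>
      z (i.succAbove j)) '' Z) = 0) :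
    sphericalHausdorff m (EuclideanSpace ℝ (Fin (m + 1))) Z = 0 := by
  refine sphericalHausdorff_eq_zero ?_
  have h1 : μH[(m : ℝ)] ((fun (z : EuclideanSpace ℝ (Fin (m + 1))) (j : Fin m) =>
      z (i.succAbove j)) '' Z) = 0 := by
    have := hausdorffMeasure_pi_real (ι := Fin m)
    rw [Fintype.card_fin] at this
    rw [this, h0]
  have h2 := hausdorffMeasure_image_eq_zero (P := Z) (σ := id) (C := C) (Nat.cast_nonneg m)
    (fun p hp q hq => ?_) h1
  · rwa [Set.image_id] at h2
  · rw [id, id, edist_dist, edist_dist, ← ENNReal.ofReal_coe_nnreal,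
      ← ENNReal.ofReal_mul C.coe_nonneg]
    exact ENNReal.ofReal_le_ofReal (h p hp q hq)

/-! ### Upper integrals, slices and `ρ`-null sets. -/

theorem exists_measurable_majorant {f : X → ℝ≥0∞} (hf : upperLIntegral μ f ≠ ⊤) {ε : ℝ≥0∞}
    (hε : ε ≠ 0) : ∃ g : X → ℝ≥0∞, Measurable g ∧ (∀ x, f x ≤ g x) ∧
      ∫⁻ x, g x ∂μ ≤ upperLIntegral μ f + ε := by
  have h : upperLIntegral μ f < upperLIntegral μ f + ε := ENNReal.lt_add_right hf hε
  conv_lhs at h => rw [upperLIntegral]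
  simp only [iInf_lt_iff] at h
  obtain ⟨g, hg, hfg, hlt⟩ := h
  exact ⟨g, hg, hfg, hlt.le⟩

/-- The terms need not be measurable; measurable majorants with summable errors reduce this to
monotone convergence. -/
theorem ae_tsum_ne_top_of_upperLIntegral {f : ℕ → X → ℝ≥0∞}
    (hf : ∑' n, upperLIntegral μ (f n) ≠ ⊤) : ∀ᵐ x ∂μ, ∑' n, f n x ≠ ⊤ := by
  obtain ⟨η, hη0, hη⟩ := ENNReal.exists_pos_sum_of_countable' (one_ne_zero (α := ℝ≥0∞)) ℕ
  choose g hgm hfg hg using fun n =>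
    exists_measurable_majorant (ENNReal.ne_top_of_tsum_ne_top hf n) (hη0 n).ne'
  have h1 : ∫⁻ x, ∑' n, g n x ∂μ ≠ ⊤ := by
    rw [lintegral_tsum fun n => (hgm n).aemeasurable]
    refine ((ENNReal.tsum_le_tsum hg).trans_lt ?_).ne
    rw [ENNReal.tsum_add]
    exact ENNReal.add_lt_top.2 ⟨hf.lt_top, hη.trans ENNReal.one_lt_top⟩
  filter_upwards [ae_lt_top (Measurable.tsum hgm) h1] with x hx
  exact ((ENNReal.tsum_le_tsum fun n => hfg n x).trans_lt hx).ne

theorem upperLIntegral_eq_zero_iff {f : X → ℝ≥0∞} :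
    upperLIntegral μ f = 0 ↔ ∀ᵐ x ∂μ, f x = 0 := by
  constructor
  · intro h
    -- A constant series is finite only where its term vanishes.
    have := ae_tsum_ne_top_of_upperLIntegral (μ := μ) (f := fun _ => f) (by simp [h])
    filter_upwards [this] with x hx
    by_contra hc
    exact hx (ENNReal.tsum_const_eq_top_of_ne_zero hc)
  · intro h
    have h0 : μ {x | f x ≠ 0} = 0 := h
    set N := toMeasurable μ {x | f x ≠ 0}
    have hN : MeasurableSet N := measurableSet_toMeasurable _ _
    refine le_antisymm ?_ zero_le
    have hle : ∀ x, f x ≤ N.indicator (fun _ => ⊤) x := by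
      intro x
      by_cases hx : x ∈ N
      · simp [hx]
      · rw [Set.indicator_of_notMem hx]
        by_contra hc
        exact hx (subset_toMeasurable μ _ (fun h => hc h.le))
    calc upperLIntegral μ f ≤ ∫⁻ x, N.indicator (fun _ => ⊤) x ∂μ :=
          iInf_le_of_le _ ((iInf_le _ (measurable_const.indicator hN)).trans (iInf_le _ hle))
      _ = 0 := by rw [lintegral_indicator_const hN, measure_toMeasurable, h0, mul_zero]

/-- The point with coordinates `z` of the slice through `x` parallel to the span of `u`. -/
noncomputable def slicePt (μ : Measure X) {m : ℕ} (u : Fin (m + 1) → CM μ) (x : X)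
    (z : EuclideanSpace ℝ (Fin (m + 1))) : X :=
  x - (∑ i, ((u i : Lp ℝ 2 μ) x) • incl μ (u i)) + ∑ i, z i • incl μ (u i)

theorem measurable_slicePt {m : ℕ} (u : Fin (m + 1) → CM μ) (x : X) :
    Measurable (slicePt μ u x) := by
  have : Continuous (slicePt μ u x) := by
    unfold slicePt
    fun_prop
  exact this.measurable

/-- The Gaussian density on a slice. -/
noncomputable def sliceDensity (m : ℕ) (z : EuclideanSpace ℝ (Fin (m + 1))) : ℝ≥0∞ :=
  ENNReal.ofReal ((2 * Real.pi) ^ (-((m + 1 : ℕ) : ℝ) / 2) * Real.exp (-‖z‖ ^ 2 / 2))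

theorem sliceDensity_ne_zero (m : ℕ) (z : EuclideanSpace ℝ (Fin (m + 1))) :
    sliceDensity m z ≠ 0 := by
  unfold sliceDensity
  exact (ENNReal.ofReal_pos.2 (by positivity)).ne'

theorem measurable_sliceDensity (m : ℕ) : Measurable (sliceDensity m) := by
  unfold sliceDensity
  fun_prop

theorem sliceIntegral_eq {m : ℕ} (u : Fin (m + 1) → CM μ) (f : X → ℝ≥0∞) (x : X) :
    sliceIntegral μ u f x = ∫⁻ z, f (slicePt μ u x z) * sliceDensity m z
      ∂(sphericalHausdorff m (EuclideanSpace ℝ (Fin (m + 1)))) := rfl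

theorem sliceIntegral_indicator_eq_zero_iff {m : ℕ} (u : Fin (m + 1) → CM μ) {N : Set X}
    (hN : MeasurableSet N) (x : X) :
    sliceIntegral μ u (N.indicator fun _ => 1) x = 0 ↔
      sphericalHausdorff m (EuclideanSpace ℝ (Fin (m + 1))) {z | slicePt μ u x z ∈ N} = 0 := by
  rw [sliceIntegral_eq, lintegral_eq_zero_iff]
  · rw [measure_eq_zero_iff_ae_notMem]
    refine eventually_congr (Eventually.of_forall fun z => ?_)
    simp [sliceDensity_ne_zero]
  · exact ((measurable_const.indicator hN).comp (measurable_slicePt u x)).mul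
      (measurable_sliceDensity m)

/-- The slice density is positive, so it does not affect null sets; this is the form in which
`ρ`-null sets are tested and produced. -/
theorem rho_eq_zero_iff {N : Set X} (hN : MeasurableSet N) :
    rho μ N = 0 ↔ ∀ (m : ℕ) (u : Fin (m + 1) → CM μ), Orthonormal ℝ u → ∀ᵐ x ∂μ,
      sphericalHausdorff m (EuclideanSpace ℝ (Fin (m + 1))) {z | slicePt μ u x z ∈ N} = 0 := by
  rw [rho, rhoIntegral]
  simp only [ENNReal.iSup_eq_zero, upperLIntegral_eq_zero_iff,
    sliceIntegral_indicator_eq_zero_iff _ hN]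

theorem rho_iUnion_eq_zero {N : ℕ → Set X} (hN : ∀ n, MeasurableSet (N n))
    (h : ∀ n, rho μ (N n) = 0) : rho μ (⋃ n, N n) = 0 := by
  rw [rho_eq_zero_iff (MeasurableSet.iUnion hN)]
  intro m u hu
  filter_upwards [ae_all_iff.2 fun n => (rho_eq_zero_iff (hN n)).1 (h n) m u hu] with x hx
  rw [← measure_iUnion_null_iff] at hx
  refine measure_mono_null (fun z hz => ?_) hx
  obtain ⟨n, hn⟩ := Set.mem_iUnion.1 hz
  exact Set.mem_iUnion.2 ⟨n, hn⟩

theorem RhoAE.mono {S : Set X} {P Q : X → Prop} (h : RhoAE μ S P) (hPQ : ∀ x ∈ S, P x → Q x) :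
    RhoAE μ S Q := by
  obtain ⟨N, hN, h0, hP⟩ := h
  exact ⟨N, hN, h0, fun x hx hxN => hPQ x hx (hP x hx hxN)⟩

theorem RhoAE.forall {κ : Type*} [Countable κ] {S : Set X} {P : κ → X → Prop}
    (h : ∀ k, RhoAE μ S (P k)) : RhoAE μ S fun x => ∀ k, P k x := by
  rcases isEmpty_or_nonempty κ with hκ | hκ
  · refine ⟨∅, MeasurableSet.empty, ?_, fun x _ _ k => (hκ.false k).elim⟩
    rw [rho_eq_zero_iff MeasurableSet.empty]
    intro m u hu
    simp
  choose N hN h0 hP using h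
  obtain ⟨g, hg⟩ := exists_surjective_nat κ
  refine ⟨⋃ n, N (g n), MeasurableSet.iUnion fun n => hN _,
    rho_iUnion_eq_zero (fun n => hN _) fun n => h0 _, fun x hx hxN k => ?_⟩
  obtain ⟨n, rfl⟩ := hg k
  exact hP _ x hx fun hc => hxN (Set.mem_iUnion.2 ⟨n, hc⟩)

theorem RhoAE.and {S : Set X} {P Q : X → Prop} (hP : RhoAE μ S P) (hQ : RhoAE μ S Q) :
    RhoAE μ S fun x => P x ∧ Q x := by
  have := RhoAE.forall (κ := Bool) (P := fun b => bif b then P else Q) (S := S) (μ := μ)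
    (by rintro (_ | _) <;> assumption)
  exact this.mono fun x _ hx => ⟨hx true, hx false⟩

/-- Summability of `ρ`-integrals bounds the series for each orthonormal family separately, and
almost every slice then sees a finite sum almost everywhere. -/
theorem rhoAE_tendsto_zero {S : Set X} (hS : MeasurableSet S) {h : ℕ → X → ℝ≥0∞}
    (hm : ∀ n, Measurable (h n))
    (hsum : ∑' n, rhoIntegral μ (S.indicator (h n)) ≠ ⊤) :
    RhoAE μ S fun x => Tendsto (fun n => h n x) atTop (𝓝 0) := by
  have hms : ∀ n, Measurable (S.indicator (h n)) := fun n => (hm n).indicator hS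
  have hmt : Measurable fun x => ∑' n, S.indicator (h n) x := Measurable.tsum hms
  have hN : MeasurableSet {x | ∑' n, S.indicator (h n) x = ⊤} :=
    hmt (measurableSet_singleton _)
  refine ⟨_, hN, (rho_eq_zero_iff hN).2 fun m u hu => ?_, fun x hx hxN => ?_⟩
  · have h1 : ∑' n, upperLIntegral μ (sliceIntegral μ u (S.indicator (h n))) ≠ ⊤ := by
      refine ((ENNReal.tsum_le_tsum fun n => ?_).trans_lt hsum.lt_top).ne
      exact le_iSup_of_le m (le_iSup_of_le u (le_iSup_of_le hu le_rfl))
    filter_upwards [ae_tsum_ne_top_of_upperLIntegral h1] with x hx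
    have hmz : ∀ n, Measurable fun z => S.indicator (h n) (slicePt μ u x z) * sliceDensity m z :=
      fun n => ((hms n).comp (measurable_slicePt u x)).mul (measurable_sliceDensity m)
    simp only [sliceIntegral_eq] at hx
    rw [← lintegral_tsum fun n => (hmz n).aemeasurable] at hx
    have h2 := ae_lt_top (Measurable.tsum hmz) hx
    rw [measure_eq_zero_iff_ae_notMem]
    filter_upwards [h2] with z hz hc
    rw [ENNReal.tsum_mul_right] at hz
    change ∑' n, S.indicator (h n) (slicePt μ u x z) = ⊤ at hc
    rw [hc, ENNReal.top_mul (sliceDensity_ne_zero m z)] at hz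
    exact lt_irrefl _ hz
  · have : ∑' n, h n x ≠ ⊤ := by
      intro hc
      refine hxN ?_
      change ∑' n, S.indicator (h n) x = ⊤
      simpa only [Set.indicator_of_mem hx] using hc
    exact ENNReal.tendsto_atTop_zero_of_tsum_ne_top this

/-- A property that holds `ρ`-almost everywhere on `S` holds at all points of `S` on almost all
lines of a given direction. -/
theorem RhoAE.ae_line [IsGaussian μ] {S : Set X} {P : X → Prop} (h : RhoAE μ S P) {w : CM μ}
    (hw : w ≠ 0) :
    ∀ᵐ x ∂μ, ∀ t : ℝ, x + t • incl μ w ∈ S → P (x + t • incl μ w) := by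
  obtain ⟨N, hN, h0, hP⟩ := h
  have hn : ‖w‖ ≠ 0 := norm_ne_zero_iff.2 hw
  -- For one-dimensional `F` the slice measure is zero-dimensional and charges every point: a null
  -- set misses almost every line altogether.
  have ho : Orthonormal ℝ (fun _ : Fin (0 + 1) => ‖w‖⁻¹ • w) := by
    refine ⟨fun i => ?_, fun i j hij => (hij (Fin.ext (by omega))).elim⟩
    rw [norm_smul, norm_inv, norm_norm, inv_mul_cancel₀ hn]
  filter_upwards [(rho_eq_zero_iff hN).1 h0 0 _ ho] with x hx t ht
  refine hP _ ht fun hc => ?_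
  refine sphericalHausdorff_zero_ne_zero ?_ hx
  refine ⟨WithLp.toLp 2 fun i => (((‖w‖⁻¹ • w : CM μ) : Lp ℝ 2 μ) x) + t * ‖w‖, ?_⟩
  change slicePt μ _ x _ ∈ N
  convert hc using 1
  simp only [slicePt, Fin.sum_univ_succ, Finset.univ_eq_empty, Finset.sum_empty, add_zero]
  rw [add_smul, incl_smul, smul_smul (t * ‖w‖), mul_assoc, mul_inv_cancel₀ hn, mul_one]
  abel

/-! ### Differentiability along `H`, subgradients and finite-dimensional convexity. -/

theorem inner_smul_CM (a b : CM μ) (c : ℝ) : ⟪a, c • b⟫_ℝ = c * ⟪a, b⟫_ℝ :=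
  real_inner_smul_right a b c

section Differentiability

variable {E : Type*} [NormedAddCommGroup E] [NormedSpace ℝ E]

/-- Uniformity over the unit sphere is Fréchet differentiability at the origin of `H`: use `t = ‖k‖`
and the direction `‖k‖⁻¹ • k`. -/
theorem HasHDerivAt.hasFDerivAt [IsGaussian μ] {F : X → E} {A : CM μ →L[ℝ] E} {x : X}
    (h : HasHDerivAt F A x) : HasFDerivAt (fun k : CM μ => F (x + incl μ k)) A 0 := by
  rw [hasFDerivAt_iff_isLittleO_nhds_zero, Asymptotics.isLittleO_iff]
  intro ε hε
  have h1 := (Metric.tendstoUniformlyOn_iff.1 h) ε hε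
  obtain ⟨δ, hδ, h2⟩ := Metric.eventually_nhds_iff.1 (eventually_nhdsWithin_iff.1 h1)
  refine Metric.eventually_nhds_iff.2 ⟨δ, hδ, fun k hk => ?_⟩
  rw [dist_zero_right] at hk
  simp only [zero_add, incl_zero, add_zero]
  by_cases hk0 : k = 0
  · simp [hk0, incl_zero]
  have hn : 0 < ‖k‖ := norm_pos_iff.2 hk0
  have h3 := h2 (y := ‖k‖) (by simpa using hk) hn.ne' (‖k‖⁻¹ • k)
    (by rw [mem_sphere_zero_iff_norm, norm_smul, norm_inv, norm_norm, inv_mul_cancel₀ hn.ne'])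
  rw [dist_comm, dist_eq_norm, incl_smul, smul_smul, mul_inv_cancel₀ hn.ne', one_smul,
    map_smul, ← smul_sub, norm_smul, norm_inv, norm_norm] at h3
  calc _ = ‖k‖ * (‖k‖⁻¹ * ‖F (x + incl μ k) - F x - A k‖) := by
        rw [← mul_assoc, mul_inv_cancel₀ hn.ne', one_mul]
    _ ≤ ‖k‖ * ε := by gcongr
    _ = ε * ‖k‖ := mul_comm _ _

end Differentiability

/-- `DG y` is a subgradient of `G` at `y` along the Cameron–Martin space. -/
def IsSubgradAt (G : X → ℝ) (DG : X → CM μ) (y : X) : Prop :=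
  ∀ k : CM μ, G y + ⟪DG y, k⟫_ℝ ≤ G (y + incl μ k)

theorem HasHDerivAt.isSubgradAt [IsGaussian μ] {G : X → ℝ} (hG : ConvexOn ℝ Set.univ G)
    {DG : X → CM μ} {y : X} (h : HasHDerivAt G (innerSL ℝ (DG y)) y) : IsSubgradAt G DG y := by
  intro k
  have h1 := h.hasFDerivAt.lim_real k
  simp only [zero_add, incl_zero, add_zero, innerSL_apply_apply, incl_smul, smul_eq_mul] at h1
  have h2 : ⟪DG y, k⟫_ℝ ≤ G (y + incl μ k) - G y := by
    refine le_of_tendsto h1 ?_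
    filter_upwards [eventually_ge_atTop (1 : ℝ)] with c hc
    have hc0 : 0 < c := by linarith
    have hc1 : 0 ≤ 1 - c⁻¹ := by linarith [inv_le_one_of_one_le₀ hc]
    have h3 := hG.2 (Set.mem_univ y) (Set.mem_univ (y + incl μ k)) hc1
      (inv_nonneg.2 hc0.le) (by ring)
    have h4 : (1 - c⁻¹) • y + c⁻¹ • (y + incl μ k) = y + c⁻¹ • incl μ k := by
      rw [smul_add, sub_smul, one_smul]
      abel
    rw [h4, smul_eq_mul, smul_eq_mul] at h3
    calc c * (G (y + c⁻¹ • incl μ k) - G y)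
        ≤ c * ((1 - c⁻¹) * G y + c⁻¹ * G (y + incl μ k) - G y) := by gcongr
      _ = (c * c⁻¹) * (G (y + incl μ k) - G y) := by ring
      _ = _ := by rw [mul_inv_cancel₀ hc0.ne', one_mul]
  linarith

/-- Finite-dimensional convex functions are locally Lipschitz; this supplies continuity on slices,
where `G` is not assumed continuous on `X`. -/
theorem continuous_convex_comp_linear {G : X → ℝ} (hG : ConvexOn ℝ Set.univ G)
    {E : Type*} [NormedAddCommGroup E] [NormedSpace ℝ E] [FiniteDimensional ℝ E] (x : X)
    (T : E →ₗ[ℝ] X) : Continuous fun z => G (x + T z) := by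
  have h : ConvexOn ℝ Set.univ fun z => G (x + T z) := by
    have := (hG.translate_right x).comp_linearMap T
    simpa [Function.comp_def] using this
  exact h.locallyLipschitz.continuous

/-! ### Transversal points and the transfer between directions. -/

/-- `P` holds at the points of `G⁻¹(0)` where almost all lines, of any given direction, leave
`{G ≤ 0}` transversally. -/
def TransversalAE (G : X → ℝ) (DG : X → CM μ) (P : X → Prop) : Prop :=
  ∀ w : CM μ, ∀ᵐ x ∂μ, ∀ t : ℝ, G (x + t • incl μ w) = 0 →
    0 < ⟪DG (x + t • incl μ w), w⟫_ℝ → P (x + t • incl μ w)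

theorem RhoAE.transversalAE [IsGaussian μ] {G : X → ℝ} (DG : X → CM μ) {P : X → Prop}
    (h : RhoAE μ (G ⁻¹' {0}) P) : TransversalAE G DG P := by
  intro w
  by_cases hw : w = 0
  · exact Eventually.of_forall fun x t _ h2 => by simp [hw] at h2
  filter_upwards [h.ae_line hw] with x hx t ht _
  exact hx t ht

theorem TransversalAE.forall {κ : Type*} [Countable κ] {G : X → ℝ} {DG : X → CM μ}
    {P : κ → X → Prop} (h : ∀ k, TransversalAE G DG (P k)) :
    TransversalAE G DG fun x => ∀ k, P k x := by
  intro w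
  filter_upwards [ae_all_iff.2 fun k => h k w] with x hx t h1 h2 k
  exact hx k t h1 h2

theorem TransversalAE.and {G : X → ℝ} {DG : X → CM μ} {P Q : X → Prop}
    (hP : TransversalAE G DG P) (hQ : TransversalAE G DG Q) :
    TransversalAE G DG fun x => P x ∧ Q x := by
  intro w
  filter_upwards [hP w, hQ w] with x hx hx' t h1 h2
  exact ⟨hx t h1 h2, hx' t h1 h2⟩

theorem TransversalAE.mono {G : X → ℝ} {DG : X → CM μ} {P Q : X → Prop}
    (hP : TransversalAE G DG P) (hPQ : ∀ x, G x = 0 → P x → Q x) :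
    TransversalAE G DG Q := by
  intro w
  filter_upwards [hP w] with x hx t h1 h2
  exact hPQ _ h1 (hx t h1 h2)

/-- A measurable hull `M` of the bad set need not be invariant. The points whose line meets `M` in a
non-null set of parameters form a set that is, and Fubini makes it measurable and null. -/
theorem exists_invariant_null_superset [IsGaussian μ]
    (hμ : ∀ L : StrongDual ℝ X, ∫ x, L x ∂μ = 0) {u : CM μ} {Q : X → Prop}
    (hinv : ∀ x (s : ℝ), Q x → Q (x + s • incl μ u)) (hQ : ∀ᵐ x ∂μ, Q x) :
    ∃ N : Set X, MeasurableSet N ∧ (∀ᵐ x ∂μ, x ∉ N) ∧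
      (∀ x (s : ℝ), x + s • incl μ u ∈ N → x ∈ N) ∧ ∀ x, ¬ Q x → x ∈ N := by
  set M := toMeasurable μ {x | ¬ Q x} with hM
  have hMm : MeasurableSet M := measurableSet_toMeasurable _ _
  have hM0 : ∀ᵐ x ∂μ, x ∉ M := by
    rw [← measure_eq_zero_iff_ae_notMem, hM, measure_toMeasurable]
    exact hQ
  have hmap : Measurable fun q : X × ℝ => q.1 + q.2 • incl μ u := by fun_prop
  refine ⟨{x | ¬ ∀ᵐ s : ℝ, x + s • incl μ u ∉ M}, ?_, ?_, ?_, ?_⟩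
  · have h1 : Measurable fun x => (volume : Measure ℝ) {s | x + s • incl μ u ∈ M} :=
      measurable_measure_prodMk_left (hmap hMm)
    have h2 : {x | ¬ ∀ᵐ s : ℝ, x + s • incl μ u ∉ M}
        = (fun x => (volume : Measure ℝ) {s | x + s • incl μ u ∈ M}) ⁻¹' {0}ᶜ := by
      ext x
      change (¬ ∀ᵐ s : ℝ, s ∉ {s | x + s • incl μ u ∈ M}) ↔ _
      rw [← measure_eq_zero_iff_ae_notMem]
      rfl
    rw [h2]
    exact h1 (measurableSet_singleton _).compl
  · filter_upwards [ae_ae_add_smul hμ u hM0] with x hx hc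
    exact hc hx
  · intro x s hx hc
    refine hx ?_
    filter_upwards [ae_add_const hc s] with t ht
    rwa [add_comm t s, add_smul, ← add_assoc] at ht
  · intro x hx hc
    obtain ⟨s, hs⟩ := hc.exists
    refine hs (subset_toMeasurable μ _ fun hq => hx ?_)
    have := hinv _ (-s) hq
    rwa [add_assoc, ← add_smul, add_neg_cancel, zero_smul, add_zero] at this

/-- A property of the lines of direction `u` that holds for almost all of them holds at
almost all points where these lines leave `{G ≤ 0}` transversally. -/
theorem transversalAE_of_invariant [IsGaussian μ]
    (hμ : ∀ L : StrongDual ℝ X, ∫ x, L x ∂μ = 0) {G : X → ℝ} {DG : X → CM μ}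
    (hGm : Measurable G) (hDm : ∀ w : CM μ, Measurable fun x => ⟪DG x, w⟫_ℝ)
    (hsub : RhoAE μ (G ⁻¹' {0}) (IsSubgradAt G DG)) {u : CM μ} {Q : X → Prop}
    (hinv : ∀ x (s : ℝ), Q x → Q (x + s • incl μ u)) (hQ : ∀ᵐ x ∂μ, Q x) :
    TransversalAE G DG fun y => 0 < ⟪DG y, u⟫_ℝ → Q y := by
  obtain ⟨N, hNm, hN0, hNinv, hNQ⟩ := exists_invariant_null_superset hμ hinv hQ
  obtain ⟨N₀, hN₀m, hN₀, hsub'⟩ := hsub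
  intro w
  by_cases hw : w = 0
  · exact Eventually.of_forall fun x t _ h2 => by simp [hw] at h2
  set S : Set X := {y | G y = 0 ∧ y ∉ N₀ ∧ 0 < ⟪DG y, w⟫_ℝ ∧ 0 < ⟪DG y, u⟫_ℝ ∧ y ∈ N} with hS
  have hSsub : ∀ y ∈ S, IsSubgradAt G DG y := fun y hy => hsub' y hy.1 hy.2.1
  have hSm : MeasurableSet S := by
    refine MeasurableSet.inter (hGm (measurableSet_singleton 0)) (hN₀m.compl.inter ?_)
    exact ((measurableSet_lt measurable_const (hDm w)).inter
      ((measurableSet_lt measurable_const (hDm u)).inter hNm))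
  have hmap : Measurable fun q : X × ℝ => q.1 + q.2 • incl μ w := by fun_prop
  -- The base points whose `w`-line hits the bad set. A subgradient of positive slope along `w`
  -- allows at most one such hit per line, so the projection is injective and its image is Borel.
  set D : Set X := Prod.fst '' ((fun q : X × ℝ => q.1 + q.2 • incl μ w) ⁻¹' S) with hD
  have hDmeas : MeasurableSet D := by
    refine (hmap hSm).image_of_measurable_injOn measurable_fst ?_
    rintro ⟨x, t₁⟩ h₁ ⟨x', t₂⟩ h₂ hx
    obtain rfl : x = x' := hx
    have key : ∀ t₁ t₂ : ℝ, x + t₁ • incl μ w ∈ S → x + t₂ • incl μ w ∈ S → t₂ ≤ t₁ := by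
      intro t₁ t₂ h₁ h₂
      have h3 := hSsub _ h₁ ((t₂ - t₁) • w)
      have h4 : x + t₁ • incl μ w + incl μ ((t₂ - t₁) • w) = x + t₂ • incl μ w := by
        rw [incl_smul, sub_smul]; abel
      have h5 : ⟪DG (x + t₁ • incl μ w), (t₂ - t₁) • w⟫_ℝ
          = (t₂ - t₁) * ⟪DG (x + t₁ • incl μ w), w⟫_ℝ := inner_smul_CM _ _ _
      rw [h4, h5, h₁.1, h₂.1, zero_add] at h3
      have h6 := h₁.2.2.1
      nlinarith
    exact Prod.ext rfl (le_antisymm (key _ _ h₂ h₁) (key _ _ h₁ h₂))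
  have hDnull : ∀ᵐ x ∂μ, x ∉ D := by
    refine ae_notMem_of_ae_ae hμ u hDmeas ?_
    filter_upwards [ae_ae_add_smul hμ w hN0] with x hx
    -- Coordinates `(t, s)` in the plane through `x` spanned by `w` and `u`. The bounds by `K` make
    -- each piece a Lipschitz graph of `s` over `t`.
    set P : ℕ → Set (ℝ × ℝ) := fun K => {q | x + q.2 • incl μ u + q.1 • incl μ w ∈ S ∧
      1 ≤ K * ⟪DG (x + q.2 • incl μ u + q.1 • incl μ w), u⟫_ℝ ∧
      |⟪DG (x + q.2 • incl μ u + q.1 • incl μ w), w⟫_ℝ| ≤ K} with hP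
    have hcov : {s : ℝ | x + s • incl μ u ∈ D} ⊆ ⋃ K, Prod.snd '' P K := by
      rintro s ⟨⟨x', t⟩, ht, rfl : x' = _⟩
      change x + s • incl μ u + t • incl μ w ∈ S at ht
      set a := ⟪DG (x + s • incl μ u + t • incl μ w), u⟫_ℝ with ha
      set b := ⟪DG (x + s • incl μ u + t • incl μ w), w⟫_ℝ with hb
      have ha0 : 0 < a := ht.2.2.2.1
      obtain ⟨K, hK⟩ := exists_nat_ge (max (1 / a) |b|)
      refine Set.mem_iUnion.2 ⟨K, (t, s), ⟨ht, ?_, (le_max_right _ _).trans hK⟩, rfl⟩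
      have := (le_max_left _ _).trans hK
      rwa [div_le_iff₀ ha0] at this
    refine measure_eq_zero_iff_ae_notMem (s := {s : ℝ | x + s • incl μ u ∈ D}) |>.1 ?_
    refine measure_mono_null hcov (measure_iUnion_null fun K => ?_)
    rw [← hausdorffMeasure_real]
    -- Since `N` is invariant along `u`, membership depends on `t` alone, and the bad `t` are null
    -- for almost every `x`. The Lipschitz graph carries this to the parameters `s`.
    have hfst : μH[1] (Prod.fst '' P K) = 0 := by
      rw [hausdorffMeasure_real]
      refine measure_mono_null ?_ (measure_eq_zero_iff_ae_notMem
        (s := {t | x + t • incl μ w ∈ N}) |>.2 hx)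
      rintro _ ⟨⟨t, s⟩, hq, rfl⟩
      refine hNinv _ s ?_
      have := hq.1.2.2.2.2
      rwa [add_right_comm] at this
    have key : ∀ p ∈ P K, ∀ q ∈ P K, q.2 - p.2 ≤ (K : ℝ) * K * |q.1 - p.1| := by
      rintro ⟨t₁, s₁⟩ ⟨h₁, ha, hb⟩ ⟨t₂, s₂⟩ ⟨h₂, -, -⟩
      simp only at h₁ ha hb h₂ ⊢
      have h3 := hSsub _ h₁ ((s₂ - s₁) • u + (t₂ - t₁) • w)
      have h4 : x + s₁ • incl μ u + t₁ • incl μ w + incl μ ((s₂ - s₁) • u + (t₂ - t₁) • w)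
          = x + s₂ • incl μ u + t₂ • incl μ w := by
        rw [incl_add, incl_smul, incl_smul, sub_smul, sub_smul]; abel
      set y := x + s₁ • incl μ u + t₁ • incl μ w
      have h5 : ⟪DG y, (s₂ - s₁) • u + (t₂ - t₁) • w⟫_ℝ
          = (s₂ - s₁) * ⟪DG y, u⟫_ℝ + (t₂ - t₁) * ⟪DG y, w⟫_ℝ := by
        rw [inner_add_right]
        exact congrArg₂ _ (inner_smul_CM _ _ _) (inner_smul_CM _ _ _)
      rw [h4, h5, h₁.1, h₂.1, zero_add] at h3
      have h6 : -((t₂ - t₁) * ⟪DG y, w⟫_ℝ) ≤ |t₂ - t₁| * K :=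
        (neg_le_abs _).trans (by rw [abs_mul]; gcongr)
      have h7 : (s₂ - s₁) * ⟪DG y, u⟫_ℝ ≤ K * |t₂ - t₁| := by linarith
      rcases le_or_gt (s₂ - s₁) 0 with h8 | h8
      · exact h8.trans (by positivity)
      · have hK : (0 : ℝ) ≤ K := Nat.cast_nonneg K
        calc s₂ - s₁ ≤ (s₂ - s₁) * (K * ⟪DG y, u⟫_ℝ) := le_mul_of_one_le_right h8.le ha
          _ = K * ((s₂ - s₁) * ⟪DG y, u⟫_ℝ) := by ring
          _ ≤ K * (K * |t₂ - t₁|) := by gcongr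
          _ = _ := by ring
    refine hausdorffMeasure_image_eq_zero (C := (K : ℝ≥0) * K) zero_le_one
      (fun p hp q hq => ?_) hfst
    rw [edist_dist, edist_dist, ← ENNReal.ofReal_coe_nnreal, ← ENNReal.ofReal_mul (by positivity)]
    refine ENNReal.ofReal_le_ofReal ?_
    rw [Real.dist_eq, Real.dist_eq]
    push_cast
    refine abs_sub_le_iff.2 ⟨key q hq p hp, ?_⟩
    rw [abs_sub_comm]
    exact key p hp q hq
  have hN₀' : RhoAE μ (G ⁻¹' {0}) fun y => y ∉ N₀ := ⟨N₀, hN₀m, hN₀, fun _ _ h => h⟩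
  filter_upwards [hDnull, hN₀'.ae_line hw] with x hx hx' t h1 h2 h3
  by_contra hc
  exact hx ⟨(x, t), ⟨h1, hx' t h1, h2, h3, hNQ _ hc⟩, rfl⟩

/-! ### Exceptional slices, and the return to `ρ`-a.e. statements. -/

/-- Minimal points of a convex function with minimum value zero on a finite-dimensional slice:
for a fixed direction `u` along which the function takes negative values, almost no slice has
minimum zero. -/
theorem ae_slice_inf_ne_zero [IsGaussian μ] (hμ : ∀ L : StrongDual ℝ X, ∫ x, L x ∂μ = 0)
    {G : X → ℝ} (hGm : Measurable G) (hG : ConvexOn ℝ Set.univ G)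
    {E : Type*} [NormedAddCommGroup E] [NormedSpace ℝ E] [FiniteDimensional ℝ E]
    (V : E →ₗ[ℝ] CM μ) (u : CM μ) :
    ∀ᵐ x ∂μ, ∀ z₀ : E, G (x + incl μ (V z₀)) = 0 → (∀ z, 0 ≤ G (x + incl μ (V z))) →
      ∀ s : ℝ, 0 ≤ G (x + incl μ (V z₀) + s • incl μ u) := by
  set T : E →ₗ[ℝ] X := (inclCLM μ).toLinearMap ∘ₗ V with hT
  have hTV : ∀ z, incl μ (V z) = T z := fun z => rfl
  set T₂ : E × ℝ →ₗ[ℝ] X :=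
    T.coprod (LinearMap.toSpanSingleton ℝ X (incl μ u)) with hT₂
  have hT₂' : ∀ z s, T₂ (z, s) = T z + s • incl μ u := fun z s => by
    simp [hT₂, LinearMap.coprod_apply]
  have hcont : ∀ x, Continuous fun z => G (x + T z) := fun x =>
    continuous_convex_comp_linear hG x T
  have hcont₂ : ∀ x, Continuous fun q => G (x + T₂ q) := fun x =>
    continuous_convex_comp_linear hG x T₂
  set d := TopologicalSpace.denseSeq E
  set d₂ := TopologicalSpace.denseSeq (E × ℝ)
  have hd : DenseRange d := TopologicalSpace.denseRange_denseSeq E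
  have hd₂ : DenseRange d₂ := TopologicalSpace.denseRange_denseSeq _
  -- The slice has infimum exactly zero while the slice enlarged by `u` reaches a negative value;
  -- dense sequences make this Borel.
  set A : Set X := {x | (∀ n, 0 ≤ G (x + T (d n))) ∧ (∀ k : ℕ, ∃ n, G (x + T (d n)) < 1 / (k + 1))
    ∧ ∃ n, G (x + T₂ (d₂ n)) < 0} with hA
  have hAm : MeasurableSet A := by
    have hm : ∀ c : X, Measurable fun x => G (x + c) := fun c => hGm.comp (measurable_add_const c)
    simp only [hA, Set.ofPred_and, Set.ofPred_forall, Set.ofPred_exists]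
    refine (MeasurableSet.iInter fun n => measurableSet_le measurable_const (hm _)).inter
      ((MeasurableSet.iInter fun k => MeasurableSet.iUnion fun n =>
        measurableSet_lt (hm _) measurable_const).inter
      (MeasurableSet.iUnion fun n => measurableSet_lt (hm _) measurable_const))
  have hA0 : ∀ᵐ x ∂μ, x ∉ A := by
    refine ae_notMem_of_ae_ae hμ u hAm (Eventually.of_forall fun x => ?_)
    refine measure_eq_zero_iff_ae_notMem (s := {s : ℝ | x + s • incl μ u ∈ A}) |>.1 ?_
    rcases Set.eq_empty_or_nonempty {s : ℝ | x + s • incl μ u ∈ A} with hB | ⟨s', hs'⟩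
    · rw [hB, measure_empty]
    obtain ⟨n₀, hn₀⟩ := hs'.2.2
    obtain ⟨z₀, r₀, hz₀⟩ : ∃ z₀ r₀, d₂ n₀ = (z₀, r₀) := ⟨_, _, rfl⟩
    rw [hz₀, hT₂'] at hn₀
    set s₀ := s' + r₀ with hs₀
    have hneg : G (x + s₀ • incl μ u + T z₀) < 0 := by
      convert hn₀ using 2
      rw [hs₀, add_smul]; abel
    -- The slice infimum is convex in `s` and negative at `s₀`, so a zero at `s₂` makes it negative
    -- strictly between. Hence there is at most one zero on each side of `s₀`.
    have key : ∀ s₁ s₂ c : ℝ, x + s₁ • incl μ u ∈ A → x + s₂ • incl μ u ∈ A → 0 < c → c < 1 →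
        s₁ = c * s₀ + (1 - c) * s₂ → False := by
      intro s₁ s₂ c h₁ h₂ hc0 hc1 hs
      have hge : ∀ z, 0 ≤ G (x + s₁ • incl μ u + T z) := by
        intro z
        have hcl : IsClosed {z | 0 ≤ G (x + s₁ • incl μ u + T z)} :=
          isClosed_le continuous_const (hcont _)
        exact hd.induction_on (p := fun z => 0 ≤ G (x + s₁ • incl μ u + T z)) z hcl h₁.1
      set ε := -c * G (x + s₀ • incl μ u + T z₀) with hε
      have hε0 : 0 < ε := by nlinarith
      obtain ⟨k, hk⟩ := exists_nat_one_div_lt hε0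
      obtain ⟨n, hn⟩ := h₂.2.1 k
      have h3 := hG.2 (Set.mem_univ (x + s₀ • incl μ u + T z₀))
        (Set.mem_univ (x + s₂ • incl μ u + T (d n))) hc0.le (sub_nonneg.2 hc1.le) (by ring)
      have h4 : c • (x + s₀ • incl μ u + T z₀) + (1 - c) • (x + s₂ • incl μ u + T (d n))
          = x + s₁ • incl μ u + T (c • z₀ + (1 - c) • d n) := by
        rw [hs, map_add, map_smul, map_smul]
        module
      rw [h4, smul_eq_mul, smul_eq_mul] at h3
      have h5 := hge (c • z₀ + (1 - c) • d n)
      have h6 : G (x + s₂ • incl μ u + T (d n)) < ε := hn.trans hk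
      nlinarith
    have hsub : {s : ℝ | x + s • incl μ u ∈ A}
        ⊆ ({s : ℝ | x + s • incl μ u ∈ A} ∩ Set.Ioi s₀)
          ∪ (({s : ℝ | x + s • incl μ u ∈ A} ∩ Set.Iio s₀) ∪ {s₀}) := by
      intro s hs
      rcases lt_trichotomy s s₀ with h | h | h
      · exact Or.inr (Or.inl ⟨hs, h⟩)
      · exact Or.inr (Or.inr h)
      · exact Or.inl ⟨hs, h⟩
    have hgt : ∀ s₁ s₂ : ℝ, x + s₁ • incl μ u ∈ A → x + s₂ • incl μ u ∈ A → s₀ < s₁ →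
        s₁ < s₂ → False := by
      intro s₁ s₂ h₁ h₂ h h'
      have hp : 0 < s₂ - s₀ := by linarith
      refine key s₁ s₂ ((s₂ - s₁) / (s₂ - s₀)) h₁ h₂ (div_pos (by linarith) hp) ?_ ?_
      · rw [div_lt_one hp]; linarith
      · field_simp; ring
    have hlt : ∀ s₁ s₂ : ℝ, x + s₁ • incl μ u ∈ A → x + s₂ • incl μ u ∈ A → s₁ < s₀ →
        s₂ < s₁ → False := by
      intro s₁ s₂ h₁ h₂ h h'
      have hp : 0 < s₀ - s₂ := by linarith
      refine key s₁ s₂ ((s₁ - s₂) / (s₀ - s₂)) h₁ h₂ (div_pos (by linarith) hp) ?_ ?_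
      · rw [div_lt_one hp]; linarith
      · field_simp; ring
    have hs1 : ({s : ℝ | x + s • incl μ u ∈ A} ∩ Set.Ioi s₀).Subsingleton := by
      intro a ha b hb
      rcases lt_trichotomy a b with h | h | h
      · exact (hgt a b ha.1 hb.1 ha.2 h).elim
      · exact h
      · exact (hgt b a hb.1 ha.1 hb.2 h).elim
    have hs2 : ({s : ℝ | x + s • incl μ u ∈ A} ∩ Set.Iio s₀).Subsingleton := by
      intro a ha b hb
      rcases lt_trichotomy a b with h | h | h
      · exact (hlt b a hb.1 ha.1 hb.2 h).elim
      · exact h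
      · exact (hlt a b ha.1 hb.1 ha.2 h).elim
    refine measure_mono_null hsub (Set.Countable.measure_zero ?_ volume)
    exact hs1.countable.union (hs2.countable.union (Set.countable_singleton _))
  filter_upwards [hA0] with x hx z₀ h0 hmin s
  by_contra! hneg
  refine hx ⟨fun n => hmin _, fun k => ?_, ?_⟩
  · have hopen : IsOpen {z | G (x + T z) < 1 / ((k : ℝ) + 1)} :=
      isOpen_lt (hcont x) continuous_const
    obtain ⟨n, hn⟩ := hd.exists_mem_open hopen ⟨z₀, by
      change G (x + T z₀) < _
      rw [← hTV, h0]
      positivity⟩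
    exact ⟨n, hn⟩
  · have hopen : IsOpen {q | G (x + T₂ q) < 0} := isOpen_lt (hcont₂ x) continuous_const
    obtain ⟨n, hn⟩ := hd₂.exists_mem_open hopen ⟨(z₀, s), by
      change G (x + T₂ (z₀, s)) < 0
      rwa [hT₂', ← add_assoc]⟩
    exact ⟨n, hn⟩

/-- On almost all finite-dimensional slices, the gradient has a nonzero component in the slice at
all regular points of the zero level. -/
theorem ae_slice_gradient_ne_zero [IsGaussian μ] (hμ : ∀ L : StrongDual ℝ X, ∫ x, L x ∂μ = 0)
    {ι : Type*} [Countable ι] (e : HilbertBasis ι ℝ (CM μ))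
    {G : X → ℝ} (hGm : Measurable G) (hG : ConvexOn ℝ Set.univ G) {DG : X → CM μ}
    {E : Type*} [NormedAddCommGroup E] [NormedSpace ℝ E] [FiniteDimensional ℝ E]
    (V : E →ₗ[ℝ] CM μ) :
    ∀ᵐ x ∂μ, ∀ z₀ : E, G (x + incl μ (V z₀)) = 0 →
      HasHDerivAt G (innerSL ℝ (DG (x + incl μ (V z₀)))) (x + incl μ (V z₀)) →
      DG (x + incl μ (V z₀)) ≠ 0 → ∃ z, ⟪DG (x + incl μ (V z₀)), V z⟫_ℝ ≠ 0 := by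
  filter_upwards [ae_all_iff.2 fun i => ae_slice_inf_ne_zero hμ hGm hG V (e i)] with x hx z₀ h0 hd hne
  by_contra! hc
  set y := x + incl μ (V z₀) with hy
  -- If `DG y` is orthogonal to the slice, zero is the minimum of `G` on it. For almost every slice
  -- `G` is then nonnegative on every `e i`-line through `y`, and `y` is a minimum on each; all
  -- components of `DG y` vanish.
  have hsub : IsSubgradAt G DG y := hd.isSubgradAt hG
  have hmin : ∀ z, 0 ≤ G (x + incl μ (V z)) := by
    intro z
    have h1 := hsub (V (z - z₀))
    rw [hc, h0, add_zero] at h1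
    convert h1 using 2
    rw [hy, map_sub, incl_sub]
    abel
  refine hne ?_
  refine (e.repr.map_eq_zero_iff).1 (lp.ext (funext fun i => ?_))
  rw [e.repr_apply_apply, lp.coeFn_zero, Pi.zero_apply, real_inner_comm]
  have hge : ∀ s : ℝ, 0 ≤ G (y + s • incl μ (e i)) := fun s => hx i z₀ h0 hmin s
  have h1 := hd.hasFDerivAt.lim_real (e i)
  have h2 := hd.hasFDerivAt.lim_real (-(e i))
  simp only [zero_add, incl_zero, add_zero, innerSL_apply_apply, incl_smul, smul_eq_mul, h0,
    sub_zero] at h1 h2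
  have h3 : 0 ≤ ⟪DG y, e i⟫_ℝ := by
    refine ge_of_tendsto h1 ?_
    filter_upwards [eventually_ge_atTop (0 : ℝ)] with c hc
    exact mul_nonneg hc (hge _)
  have h4 : 0 ≤ ⟪DG y, -(e i)⟫_ℝ := by
    refine ge_of_tendsto h2 ?_
    filter_upwards [eventually_ge_atTop (0 : ℝ)] with c hc
    refine mul_nonneg hc ?_
    have := hge (-c⁻¹)
    rwa [neg_smul, ← smul_neg, ← incl_neg] at this
  rw [inner_neg_right] at h4
  linarith

/-- The map `z ↦ ∑ zᵢ uᵢ`. -/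
noncomputable def sliceMap {m : ℕ} (u : Fin m → CM μ) : EuclideanSpace ℝ (Fin m) →ₗ[ℝ] CM μ :=
  (Fintype.linearCombination ℝ u) ∘ₗ (WithLp.linearEquiv 2 ℝ (Fin m → ℝ)).toLinearMap

theorem sliceMap_apply {m : ℕ} (u : Fin m → CM μ) (z : EuclideanSpace ℝ (Fin m)) :
    sliceMap u z = ∑ i, z i • u i := by
  simp [sliceMap, Fintype.linearCombination_apply]

theorem slicePt_eq [IsGaussian μ] {m : ℕ} (u : Fin (m + 1) → CM μ) (x : X)
    (z : EuclideanSpace ℝ (Fin (m + 1))) :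
    slicePt μ u x z = x + incl μ (sliceMap u
      (z - WithLp.toLp 2 fun i => (u i : Lp ℝ 2 μ) x)) := by
  rw [slicePt, sliceMap_apply, incl_sum]
  simp only [PiLp.sub_apply, sub_smul, incl_sub, Finset.sum_sub_distrib, incl_smul]
  abel

theorem euclidean_dist_le_sum {m : ℕ} (z z' : EuclideanSpace ℝ (Fin m)) :
    dist z z' ≤ ∑ j, |z j - z' j| := by
  rw [EuclideanSpace.dist_eq]
  simp only [Real.dist_eq]
  rw [Real.sqrt_le_left (Finset.sum_nonneg fun _ _ => abs_nonneg _)]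
  exact Finset.sum_sq_le_sq_sum_of_nonneg fun _ _ => abs_nonneg _

/-- A piece of the zero level of a convex function on a slice on which the slope in the `i`-th
direction is bounded below is a Lipschitz graph over the other coordinates. -/
theorem dist_le_of_isSubgradAt [IsGaussian μ] {G : X → ℝ} {DG : X → CM μ} {m : ℕ}
    {u : Fin (m + 1) → CM μ} {x : X} (i : Fin (m + 1)) {ε K : ℝ} (hε : ε = 1 ∨ ε = -1)
    (hK : 0 ≤ K) {Z : Set (EuclideanSpace ℝ (Fin (m + 1)))}
    (hZ : ∀ z ∈ Z, G (slicePt μ u x z) = 0 ∧ IsSubgradAt G DG (slicePt μ u x z) ∧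
      1 ≤ K * (ε * ⟪DG (slicePt μ u x z), u i⟫_ℝ) ∧
      ∀ j, |⟪DG (slicePt μ u x z), u j⟫_ℝ| ≤ K) :
    ∀ z ∈ Z, ∀ z' ∈ Z, dist z z' ≤ (K * (m * K) + m) *
      dist (fun j => z (i.succAbove j)) (fun j => z' (i.succAbove j)) := by
  -- The subgradient at one zero, tested at another, bounds the signed displacement in direction
  -- `i`; exchanging the points gives the other sign.
  have key : ∀ z ∈ Z, ∀ z' ∈ Z, ε * (z' i - z i) ≤ K * (m * K) *
      dist (fun j => z (i.succAbove j)) (fun j => z' (i.succAbove j)) := by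
    intro z hz z' hz'
    set δ := dist (fun j => z (i.succAbove j)) (fun j => z' (i.succAbove j)) with hδ
    have hδ0 : 0 ≤ δ := dist_nonneg
    obtain ⟨h0, hs, ha, hb⟩ := hZ z hz
    have h1 := hs (sliceMap u (z' - z))
    have h2 : slicePt μ u x z + incl μ (sliceMap u (z' - z)) = slicePt μ u x z' := by
      simp only [slicePt_eq, map_sub, incl_sub]
      abel
    rw [h2, h0, (hZ z' hz').1, zero_add, sliceMap_apply, inner_sum, Fin.sum_univ_succAbove _ i]
      at h1
    set y := slicePt μ u x z
    have h3 : -(m * (K * δ)) ≤ ∑ j : Fin m,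
        ⟪DG y, (z' - z) (i.succAbove j) • u (i.succAbove j)⟫_ℝ := by
      have : ∑ _j : Fin m, -(K * δ) = -(m * (K * δ)) := by simp
      rw [← this]
      refine Finset.sum_le_sum fun j _ => ?_
      rw [inner_smul_CM]
      have h4 : |(z' - z) (i.succAbove j)| ≤ δ := by
        rw [PiLp.sub_apply, abs_sub_comm, ← Real.dist_eq]
        exact dist_le_pi_dist (fun j => z (i.succAbove j)) (fun j => z' (i.succAbove j)) j
      have h5 : |(z' - z) (i.succAbove j) * ⟪DG y, u (i.succAbove j)⟫_ℝ| ≤ K * δ := by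
        rw [abs_mul, mul_comm]
        gcongr
        exact hb _
      exact (abs_le.1 h5).1
    rw [inner_smul_CM, PiLp.sub_apply] at h1
    set a := ⟪DG y, u i⟫_ℝ
    have h6 : (ε * (z' i - z i)) * (ε * a) ≤ m * (K * δ) := by
      have : (ε * (z' i - z i)) * (ε * a) = (z' i - z i) * a := by
        rcases hε with h | h <;> rw [h] <;> ring
      rw [this]
      linarith
    rcases le_or_gt (ε * (z' i - z i)) 0 with h7 | h7
    · exact h7.trans (by positivity)
    · calc ε * (z' i - z i) ≤ (ε * (z' i - z i)) * (K * (ε * a)) :=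
            le_mul_of_one_le_right h7.le ha
        _ = K * ((ε * (z' i - z i)) * (ε * a)) := by ring
        _ ≤ K * (m * (K * δ)) := by gcongr
        _ = _ := by ring
  intro z hz z' hz'
  set δ := dist (fun j => z (i.succAbove j)) (fun j => z' (i.succAbove j)) with hδ
  refine (euclidean_dist_le_sum z z').trans ?_
  rw [Fin.sum_univ_succAbove _ i, add_mul]
  refine add_le_add ?_ ?_
  · have h1 := key z hz z' hz'
    have h2 := key z' hz' z hz
    rw [dist_comm] at h2
    rw [abs_le]
    rcases hε with h | h <;> rw [h] at h1 h2 <;> constructor <;> linarith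
  · have : ∑ _j : Fin m, δ = m * δ := by simp
    rw [← this]
    refine Finset.sum_le_sum fun j _ => ?_
    rw [← Real.dist_eq]
    exact dist_le_pi_dist (fun j => z (i.succAbove j)) (fun j => z' (i.succAbove j)) j

/-- A property that holds at almost all transversal points holds `ρ`-almost everywhere on the
zero level, if almost all points of the level are regular. -/
theorem TransversalAE.rhoAE [IsGaussian μ] (hμ : ∀ L : StrongDual ℝ X, ∫ x, L x ∂μ = 0)
    {ι : Type*} [Countable ι] (e : HilbertBasis ι ℝ (CM μ))
    {G : X → ℝ} (hGm : Measurable G) (hG : ConvexOn ℝ Set.univ G) {DG : X → CM μ}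
    (hreg : RhoAE μ (G ⁻¹' {0}) fun y => HasHDerivAt G (innerSL ℝ (DG y)) y ∧ DG y ≠ 0)
    {P : X → Prop} (hPm : MeasurableSet {y | G y = 0 ∧ ¬ P y}) (hP : TransversalAE G DG P) :
    RhoAE μ (G ⁻¹' {0}) P := by
  refine ⟨{y | G y = 0 ∧ ¬ P y}, hPm, ?_, fun y hy hyN => by_contra fun hc => hyN ⟨hy, hc⟩⟩
  obtain ⟨N₀, hN₀m, hN₀, hreg⟩ := hreg
  rw [rho_eq_zero_iff hPm]
  intro m u hu
  have hline : ∀ (i : Fin (m + 1)) (ε : ℝ), ∀ᵐ x ∂μ, ∀ᵐ z : Fin m → ℝ, ∀ t : ℝ,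
      G (x + incl μ (∑ j, z j • u (i.succAbove j)) + t • incl μ (ε • u i)) = 0 →
      0 < ⟪DG (x + incl μ (∑ j, z j • u (i.succAbove j)) + t • incl μ (ε • u i)), ε • u i⟫_ℝ →
      P (x + incl μ (∑ j, z j • u (i.succAbove j)) + t • incl μ (ε • u i)) := by
    intro i ε
    refine ae_ae_add_incl hμ volume (fun z : Fin m → ℝ => ∑ j, z j • u (i.succAbove j)) ?_
      (hP (ε • u i))
    have : Continuous fun z : Fin m → ℝ => incl μ (∑ j, z j • u (i.succAbove j)) :=
      continuous_incl.comp (by fun_prop)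
    exact this.measurable
  filter_upwards [(rho_eq_zero_iff hN₀m).1 hN₀ m u hu,
    ae_slice_gradient_ne_zero hμ e hGm hG (DG := DG) (sliceMap u),
    ae_all_iff.2 fun i => hline i 1, ae_all_iff.2 fun i => hline i (-1)] with x hx0 hxg hx1 hx2
  have hx12 : ∀ ε : ℝ, (ε = 1 ∨ ε = -1) → ∀ i, ∀ᵐ z : Fin m → ℝ, ∀ t : ℝ,
      G (x + incl μ (∑ j, z j • u (i.succAbove j)) + t • incl μ (ε • u i)) = 0 →
      0 < ⟪DG (x + incl μ (∑ j, z j • u (i.succAbove j)) + t • incl μ (ε • u i)), ε • u i⟫_ℝ →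
      P (x + incl μ (∑ j, z j • u (i.succAbove j)) + t • incl μ (ε • u i)) := by
    rintro ε (rfl | rfl) i
    · exact hx1 i
    · exact hx2 i
  clear hx1 hx2
  -- The bad points of the slice, sorted by a direction of nonzero slope, its sign and quantitative
  -- bounds. Each piece is a Lipschitz graph over the hyperplane orthogonal to `u i`, and its
  -- projection is null because almost all lines of direction `ε • u i` are good.
  set Z : Fin (m + 1) → ℝ → ℕ → Set (EuclideanSpace ℝ (Fin (m + 1))) := fun i ε K =>
    {z | G (slicePt μ u x z) = 0 ∧ ¬ P (slicePt μ u x z) ∧ IsSubgradAt G DG (slicePt μ u x z) ∧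
      1 ≤ K * (ε * ⟪DG (slicePt μ u x z), u i⟫_ℝ) ∧
      ∀ j, |⟪DG (slicePt μ u x z), u j⟫_ℝ| ≤ K} with hZdef
  have hZ0 : ∀ i ε K, (ε = 1 ∨ ε = -1) →
      sphericalHausdorff m (EuclideanSpace ℝ (Fin (m + 1))) (Z i ε K) = 0 := by
    intro i ε K hε
    have hε2 : ε * ε = 1 := by rcases hε with h | h <;> rw [h] <;> norm_num
    refine sphericalHausdorff_graph_eq_zero i (C := K * (m * K) + m) ?_ ?_
    · have := dist_le_of_isSubgradAt (G := G) (DG := DG) (u := u) (x := x) i hε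
        (Nat.cast_nonneg K) (Z := Z i ε K) (fun z hz => ⟨hz.1, hz.2.2⟩)
      simpa using this
    · set p : Fin m → ℝ := fun j => (u (i.succAbove j) : Lp ℝ 2 μ) x
      have h1 := (measurePreserving_sub_right (volume : Measure (Fin m → ℝ)) p
        ).quasiMeasurePreserving.ae (hx12 ε hε i)
      rw [measure_eq_zero_iff_ae_notMem]
      filter_upwards [h1] with z' hz'
      rintro ⟨z, hz, rfl⟩
      -- `slicePt` removes the coordinates of `x` before adding `z`; since `ε * ε = 1`, this
      -- parameter on the line of direction `ε • u i` restores the coordinate `z i`.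
      set t := ε * (z i - (u i : Lp ℝ 2 μ) x)
      have hpt : x + incl μ (∑ j, ((fun j => z (i.succAbove j)) - p) j • u (i.succAbove j))
          + t • incl μ (ε • u i) = slicePt μ u x z := by
        rw [slicePt_eq, sliceMap_apply, Fin.sum_univ_succAbove _ i, incl_add, incl_smul,
          incl_smul, smul_smul, add_comm (_ • incl μ (u i)), ← add_assoc]
        congr 2
        simp only [t, PiLp.sub_apply]
        linear_combination (z i - (u i : Lp ℝ 2 μ) x) * hε2
      have h2 := hz' t
      rw [hpt] at h2
      refine hz.2.1 (h2 hz.1 ?_)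
      rw [inner_smul_CM]
      have h3 := hz.2.2.2.1
      by_contra! hc
      have hK : (0 : ℝ) ≤ K := Nat.cast_nonneg K
      nlinarith
  have hcov : {z | slicePt μ u x z ∈ {y | G y = 0 ∧ ¬ P y}} ⊆
      {z | slicePt μ u x z ∈ N₀} ∪ ⋃ i, ⋃ K, (Z i 1 K ∪ Z i (-1) K) := by
    rintro z ⟨hz0, hzP⟩
    by_cases hzN : slicePt μ u x z ∈ N₀
    · exact Or.inl hzN
    refine Or.inr ?_
    obtain ⟨hd, hne⟩ := hreg _ hz0 hzN
    have hsub := hd.isSubgradAt hG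
    obtain ⟨i, hi⟩ : ∃ i, ⟪DG (slicePt μ u x z), u i⟫_ℝ ≠ 0 := by
      by_contra! hc
      have h1 := hxg (z - WithLp.toLp 2 fun i => (u i : Lp ℝ 2 μ) x)
      rw [← slicePt_eq] at h1
      obtain ⟨w, hw⟩ := h1 hz0 hd hne
      refine hw ?_
      rw [sliceMap_apply, inner_sum]
      refine Finset.sum_eq_zero fun j _ => ?_
      rw [inner_smul_CM, hc j, mul_zero]
    set a := ⟪DG (slicePt μ u x z), u i⟫_ℝ with ha
    obtain ⟨K, hK⟩ := exists_nat_ge (1 / |a| + ∑ j, |⟪DG (slicePt μ u x z), u j⟫_ℝ|)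
    have ha0 : 0 < |a| := abs_pos.2 hi
    have hS0 : 0 ≤ ∑ j, |⟪DG (slicePt μ u x z), u j⟫_ℝ| :=
      Finset.sum_nonneg fun _ _ => abs_nonneg _
    have hKa : 1 ≤ K * |a| := by
      rw [← div_le_iff₀ ha0]
      linarith
    have hKj : ∀ j, |⟪DG (slicePt μ u x z), u j⟫_ℝ| ≤ K := by
      intro j
      have h1 := Finset.single_le_sum (f := fun j => |⟪DG (slicePt μ u x z), u j⟫_ℝ|)
        (fun _ _ => abs_nonneg _) (Finset.mem_univ j)
      have h2 : 0 < 1 / |a| := by positivity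
      linarith
    refine Set.mem_iUnion.2 ⟨i, Set.mem_iUnion.2 ⟨K, ?_⟩⟩
    rcases le_or_gt 0 a with h | h
    · refine Or.inl ⟨hz0, hzP, hsub, ?_, hKj⟩
      rwa [← ha, one_mul, ← abs_of_nonneg h]
    · refine Or.inr ⟨hz0, hzP, hsub, ?_, hKj⟩
      rwa [← ha, neg_one_mul, ← abs_of_neg h]
  refine measure_mono_null hcov (measure_union_null hx0 (measure_iUnion_null fun i =>
    measure_iUnion_null fun K => measure_union_null (hZ0 i 1 K (Or.inl rfl))
      (hZ0 i (-1) K (Or.inr rfl))))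

/-! ### Absolute continuity on lines. -/

/-- On `[a, b]` the function `φ` is almost everywhere equal to `C + ∫ₐᵗ γ`. -/
def PrimitiveOn (φ γ : ℝ → ℝ) (a b C : ℝ) : Prop :=
  IntegrableOn γ (Set.Icc a b) ∧
    ∀ᵐ t ∂(volume.restrict (Set.Icc a b)), φ t = C + ∫ s in a..t, γ s

theorem PrimitiveOn.continuousOn {φ γ : ℝ → ℝ} {a b C : ℝ} (hab : a ≤ b)
    (h : PrimitiveOn φ γ a b C) :
    ContinuousOn (fun t => C + ∫ s in a..t, γ s) (Set.Icc a b) := by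
  have := intervalIntegral.continuousOn_primitive_interval (a := a) (b := b) (f := γ) (μ := volume)
    (by rw [Set.uIcc_of_le hab]; exact h.1)
  rw [Set.uIcc_of_le hab] at this
  exact continuousOn_const.add this

/-- The integrals converge at every `t` and the functions at almost every `t`; one common point
forces the constants to converge. -/
theorem PrimitiveOn.limit {a b : ℝ} (hab : a < b) {f g : ℕ → ℝ → ℝ} {φ γ : ℝ → ℝ}
    (hfm : ∀ n, Measurable (f n)) (hgm : ∀ n, Measurable (g n)) (hφ : Measurable φ)
    (hγ : Measurable γ) {C : ℕ → ℝ} (h : ∀ n, PrimitiveOn (f n) (g n) a b (C n))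
    (hf : ∑' n, ∫⁻ t in Set.Icc a b, ‖f n t - φ t‖ₑ ≠ ⊤)
    (hg : ∑' n, ∫⁻ t in Set.Icc a b, ‖g n t - γ t‖ₑ ≠ ⊤) :
    (∀ t ∈ Set.Icc a b, Tendsto (fun n => ∫ s in a..t, g n s) atTop (𝓝 (∫ s in a..t, γ s))) ∧
      ∃ c, Tendsto C atTop (𝓝 c) ∧ PrimitiveOn φ γ a b c := by
  have hdiff : ∀ n, IntegrableOn (fun t => g n t - γ t) (Set.Icc a b) := fun n =>
    ⟨((hgm n).sub hγ).aestronglyMeasurable, (ENNReal.ne_top_of_tsum_ne_top hg n).lt_top⟩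
  have hγi : IntegrableOn γ (Set.Icc a b) := by
    have := (h 0).1.sub (hdiff 0)
    refine this.congr (Eventually.of_forall fun t => ?_)
    simp
  have hint : ∀ t ∈ Set.Icc a b,
      Tendsto (fun n => ∫ s in a..t, g n s) atTop (𝓝 (∫ s in a..t, γ s)) := by
    intro t ht
    have hsub : Set.Ioc a t ⊆ Set.Icc a b := fun s hs => ⟨hs.1.le, hs.2.trans ht.2⟩
    simp only [intervalIntegral.integral_of_le ht.1]
    refine tendsto_integral_of_L1 _ (hγi.mono_set hsub).1
      (Eventually.of_forall fun n => (h n).1.mono_set hsub) ?_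
    refine tendsto_of_tendsto_of_tendsto_of_le_of_le tendsto_const_nhds
      (ENNReal.tendsto_atTop_zero_of_tsum_ne_top hg) (fun n => zero_le) fun n => ?_
    exact lintegral_mono_set hsub
  have hconv : ∀ᵐ t ∂(volume.restrict (Set.Icc a b)),
      Tendsto (fun n => f n t) atTop (𝓝 (φ t)) := by
    have hm : ∀ n, Measurable fun t => ‖f n t - φ t‖ₑ := fun n => ((hfm n).sub hφ).enorm
    rw [← lintegral_tsum fun n => (hm n).aemeasurable] at hf
    filter_upwards [ae_lt_top (Measurable.tsum hm) hf] with t ht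
    have := ENNReal.tendsto_atTop_zero_of_tsum_ne_top ht.ne
    rw [tendsto_iff_edist_tendsto_0]
    simpa only [edist_eq_enorm_sub] using this
  have hall : ∀ᵐ t ∂(volume.restrict (Set.Icc a b)),
      Tendsto C atTop (𝓝 (φ t - ∫ s in a..t, γ s)) := by
    filter_upwards [hconv, ae_all_iff.2 fun n => (h n).2,
      ae_restrict_mem measurableSet_Icc] with t h1 h2 h3
    have := h1.sub (hint t h3)
    refine this.congr fun n => ?_
    rw [h2 n]
    ring
  have hne : (ae (volume.restrict (Set.Icc a b))).NeBot := by
    rw [ae_neBot, Ne, Measure.restrict_eq_zero, Real.volume_Icc]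
    simpa using hab
  obtain ⟨t₀, ht₀⟩ := hall.exists
  refine ⟨hint, _, ht₀, hγi, ?_⟩
  filter_upwards [hall] with t ht
  have := tendsto_nhds_unique ht ht₀
  linarith

/-- `φ` is absolutely continuous with derivative `γ` on the segments in `Ω` of almost all lines of
direction `u`; the lines are those through the points `x - ℓ x • u`. -/
def LineAC (u : CM μ) (ℓ : X → ℝ) (Ω : Set X) (φ γ : X → ℝ) : Prop :=
  ∀ᵐ x ∂μ, ∀ a b : ℝ, a < b → (∀ t ∈ Set.Icc a b, x + (t - ℓ x) • incl μ u ∈ Ω) →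
    ∃ C, PrimitiveOn (fun t => φ (x + (t - ℓ x) • incl μ u))
      (fun t => γ (x + (t - ℓ x) • incl μ u)) a b C

theorem LineDecomp.ae_tsum_ne_top [IsGaussian μ] {u : CM μ} {ℓ : X → ℝ} {v : ℝ≥0}
    (h : LineDecomp μ u ℓ v) {Ω : Set X} (hΩ : MeasurableSet Ω) {F : ℕ → X → ℝ≥0∞}
    (hF : ∀ n, Measurable (F n)) (hfin : ∑' n, ∫⁻ x in Ω, F n x ∂μ ≠ ⊤) :
    ∀ᵐ x ∂μ, ∀ a b : ℝ, (∀ t ∈ Set.Icc a b, x + (t - ℓ x) • incl μ u ∈ Ω) →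
      ∑' n, ∫⁻ t in Set.Icc a b, F n (x + (t - ℓ x) • incl μ u) ≠ ⊤ := by
  have hm : Measurable fun x => Ω.indicator (fun x => ∑' n, F n x) x :=
    (Measurable.tsum hF).indicator hΩ
  have h1 : ∫⁻ x, Ω.indicator (fun x => ∑' n, F n x) x ∂μ ≠ ⊤ := by
    rw [lintegral_indicator hΩ, lintegral_tsum fun n => (hF n).aemeasurable]
    exact hfin
  filter_upwards [h.ae_lintegral_ne_top hm h1] with x hx a b hab
  have hmt : ∀ n, Measurable fun t : ℝ => F n (x + (t - ℓ x) • incl μ u) := fun n =>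
    (hF n).comp (by fun_prop)
  rw [← lintegral_tsum fun n => (hmt n).aemeasurable]
  refine ne_top_of_le_ne_top (hx (max |a| |b|)) ?_
  have hsub : Set.Icc a b ⊆ Set.Icc (-(max |a| |b|)) (max |a| |b|) := by
    intro t ht
    have h1 := neg_abs_le a
    have h2 := le_abs_self b
    exact ⟨by linarith [le_max_left |a| |b|, ht.1], by linarith [le_max_right |a| |b|, ht.2]⟩
  refine le_trans ?_ (lintegral_mono_set hsub)
  refine setLIntegral_mono' measurableSet_Icc fun t ht => ?_
  rw [Set.indicator_of_mem (hab t ht)]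

/-- Limits of functions that are absolutely continuous on lines. -/
theorem LineAC.limit [IsGaussian μ] {u : CM μ} {ℓ : X → ℝ} {v : ℝ≥0} (hd : LineDecomp μ u ℓ v)
    {Ω : Set X} (hΩ : MeasurableSet Ω) {f g : ℕ → X → ℝ} {φ γ : X → ℝ}
    (hfm : ∀ n, Measurable (f n)) (hgm : ∀ n, Measurable (g n)) (hφ : Measurable φ)
    (hγ : Measurable γ) (h : ∀ n, LineAC u ℓ Ω (f n) (g n))
    (hf : ∑' n, ∫⁻ x in Ω, ‖f n x - φ x‖ₑ ∂μ ≠ ⊤)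
    (hg : ∑' n, ∫⁻ x in Ω, ‖g n x - γ x‖ₑ ∂μ ≠ ⊤) :
    ∀ᵐ x ∂μ, ∀ a b : ℝ, a < b → (∀ t ∈ Set.Icc a b, x + (t - ℓ x) • incl μ u ∈ Ω) →
      ∃ C, PrimitiveOn (fun t => φ (x + (t - ℓ x) • incl μ u))
        (fun t => γ (x + (t - ℓ x) • incl μ u)) a b C ∧
        ((∀ n, ContinuousOn (f n) Ω) → ∀ t ∈ Set.Icc a b, ∀ τ,
          Tendsto (fun n => f n (x + (t - ℓ x) • incl μ u)) atTop (𝓝 τ) →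
          C + ∫ s in a..t, γ (x + (s - ℓ x) • incl μ u) = τ) := by
  filter_upwards [ae_all_iff.2 h,
    hd.ae_tsum_ne_top hΩ (fun n => ((hfm n).sub hφ).enorm) hf,
    hd.ae_tsum_ne_top hΩ (fun n => ((hgm n).sub hγ).enorm) hg] with x hx hxf hxg a b hab hmem
  choose C hC using fun n => hx n a b hab hmem
  have hline : Continuous fun t : ℝ => x + (t - ℓ x) • incl μ u := by fun_prop
  obtain ⟨hint, c, hc, hprim⟩ := PrimitiveOn.limit hab
    (fun n => (hfm n).comp hline.measurable) (fun n => (hgm n).comp hline.measurable)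
    (hφ.comp hline.measurable) (hγ.comp hline.measurable) hC (hxf a b hmem) (hxg a b hmem)
  refine ⟨c, hprim, fun hcont t ht τ hτ => ?_⟩
  -- Continuity upgrades the a.e. equality to every point of the segment, its end points included,
  -- which lets boundary values pass to the limit.
  have heq : ∀ n, f n (x + (t - ℓ x) • incl μ u)
      = C n + ∫ s in a..t, g n (x + (s - ℓ x) • incl μ u) := by
    intro n
    have h1 := Measure.eqOn_Icc_of_ae_eq volume hab.ne (hC n).2
      ((hcont n).comp hline.continuousOn hmem) ((hC n).continuousOn hab.le)
    exact h1 ht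
  simp only [heq] at hτ
  exact tendsto_nhds_unique (hc.add (hint t ht)) hτ

theorem lineAC_of_contDiff {u : CM μ} {ℓ : X → ℝ} (Ω : Set X) {f : X → ℝ}
    (hf : ContDiff ℝ 1 f) : LineAC u ℓ Ω f fun x => fderiv ℝ f x (incl μ u) := by
  refine Eventually.of_forall fun x a b _ _ => ⟨f (x + (a - ℓ x) • incl μ u), ?_, ?_⟩
  all_goals
    have hcont : Continuous fun t : ℝ =>
        fderiv ℝ f (x + (t - ℓ x) • incl μ u) (incl μ u) := by
      have h1 : Continuous (fderiv ℝ f) := hf.continuous_fderiv one_ne_zero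
      exact (h1.comp (by fun_prop)).clm_apply continuous_const
  · exact hcont.continuousOn.integrableOn_Icc
  · refine Eventually.of_forall fun t => ?_
    have hder : ∀ s : ℝ, HasDerivAt (fun t : ℝ => f (x + (t - ℓ x) • incl μ u))
        (fderiv ℝ f (x + (s - ℓ x) • incl μ u) (incl μ u)) s := by
      intro s
      have h1 : HasDerivAt (fun t : ℝ => x + (t - ℓ x) • incl μ u) (incl μ u) s := by
        simpa using ((((hasDerivAt_id s).sub_const (ℓ x)).smul_const (incl μ u)).const_add x)
      exact ((hf.differentiable one_ne_zero) _).hasFDerivAt.comp_hasDerivAt s h1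
    rw [intervalIntegral.integral_eq_sub_of_hasDerivAt (fun s _ => hder s)
      (hcont.intervalIntegrable _ _)]
    ring

/-- The indices need not increase; only summability along `θ` matters. -/
theorem exists_subseq_tsum_ne_top {a : ℕ → ℝ≥0∞} (h : Tendsto a atTop (𝓝 0)) :
    ∃ θ : ℕ → ℕ, ∑' n, a (θ n) ≠ ⊤ := by
  obtain ⟨η, hη0, hη⟩ := ENNReal.exists_pos_sum_of_countable' (one_ne_zero (α := ℝ≥0∞)) ℕ
  choose θ hθ using fun n => (h.eventually_le_const (hη0 n)).exists
  exact ⟨θ, ((ENNReal.tsum_le_tsum hθ).trans_lt (hη.trans ENNReal.one_lt_top)).ne⟩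

theorem enorm_le_l2norm {α : Type*} (a : α → ℝ) (s : α) : ‖a s‖ₑ ≤ l2norm a := by
  have h1 : ENNReal.ofReal (a s ^ 2) ≤ ∑' s, ENNReal.ofReal (a s ^ 2) :=
    ENNReal.le_tsum (f := fun s => ENNReal.ofReal (a s ^ 2)) s
  have h2 : ‖a s‖ₑ = ENNReal.ofReal (a s ^ 2) ^ (1 / 2 : ℝ) := by
    rw [← sq_abs, ENNReal.ofReal_pow (abs_nonneg _), ← ENNReal.rpow_natCast, ← ENNReal.rpow_mul,
      ← Real.enorm_eq_ofReal_abs]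
    norm_num
  rw [h2]
  exact ENNReal.rpow_le_rpow h1 (by norm_num)

theorem tendsto_lintegral_of_rpow {ν : Measure X} [IsFiniteMeasure ν] {p : ℝ} (hp : 1 < p)
    {h : ℕ → X → ℝ≥0∞} (hm : ∀ n, Measurable (h n))
    (hlim : Tendsto (fun n => ∫⁻ x, h n x ^ p ∂ν) atTop (𝓝 0)) :
    Tendsto (fun n => ∫⁻ x, h n x ∂ν) atTop (𝓝 0) := by
  have hpq := Real.HolderConjugate.conjExponent hp
  have hp0 : 0 < p := by linarith
  have hle : ∀ n, ∫⁻ x, h n x ∂ν ≤ (∫⁻ x, h n x ^ p ∂ν) ^ (1 / p) *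
      (ν Set.univ) ^ (1 / p.conjExponent) := by
    intro n
    have := ENNReal.lintegral_mul_le_Lp_mul_Lq ν hpq (hm n).aemeasurable
      (aemeasurable_const (b := (1 : ℝ≥0∞)))
    simpa using this
  have h1 : Tendsto (fun n => (∫⁻ x, h n x ^ p ∂ν) ^ (1 / p) *
      (ν Set.univ) ^ (1 / p.conjExponent)) atTop (𝓝 0) := by
    have h2 := (ENNReal.continuous_rpow_const (y := 1 / p)).tendsto 0 |>.comp hlim
    rw [ENNReal.zero_rpow_of_pos (by positivity)] at h2
    have h3 := ENNReal.Tendsto.mul_const (b := (ν Set.univ) ^ (1 / p.conjExponent)) h2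
      (Or.inr (ENNReal.rpow_ne_top_of_nonneg (one_div_nonneg.2 hpq.symm.pos.le)
        (measure_ne_top ν _)))
    simpa using h3
  exact tendsto_of_tendsto_of_tendsto_of_le_of_le tendsto_const_nhds h1 (fun _ => zero_le) hle

theorem tendsto_lintegral_combination {ν : Measure X} [IsFiniteMeasure ν] {p : ℝ} (hp : 1 < p)
    {κ : Type*} {a : ℕ → X → κ → ℝ} (hm : ∀ n s, Measurable fun x => a n x s)
    (hlim : Tendsto (fun n => ∫⁻ x, l2norm (a n x) ^ p ∂ν) atTop (𝓝 0)) (α β : ℝ) (s s' : κ) :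
    Tendsto (fun n => ∫⁻ x, ‖α * a n x s + β * a n x s'‖ₑ ∂ν) atTop (𝓝 0) := by
  have h1 : ∀ s, Tendsto (fun n => ∫⁻ x, ‖a n x s‖ₑ ∂ν) atTop (𝓝 0) := by
    intro s
    refine tendsto_lintegral_of_rpow hp (fun n => (hm n s).enorm) ?_
    refine tendsto_of_tendsto_of_tendsto_of_le_of_le tendsto_const_nhds hlim
      (fun _ => zero_le) fun n => lintegral_mono fun x => ?_
    exact ENNReal.rpow_le_rpow (enorm_le_l2norm _ s) (by linarith)
  have h2 := (ENNReal.Tendsto.const_mul (a := ‖α‖ₑ) (h1 s) (Or.inr enorm_ne_top)).add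
    (ENNReal.Tendsto.const_mul (a := ‖β‖ₑ) (h1 s') (Or.inr enorm_ne_top))
  rw [mul_zero, mul_zero, add_zero] at h2
  refine tendsto_of_tendsto_of_tendsto_of_le_of_le tendsto_const_nhds h2
    (fun _ => zero_le) fun n => ?_
  have hms : ∀ s, Measurable fun x => ‖a n x s‖ₑ := fun s => (hm n s).enorm
  rw [← lintegral_const_mul _ (hms s), ← lintegral_const_mul _ (hms s'),
    ← lintegral_add_left ((hms s).const_mul _)]
  refine lintegral_mono fun x => ?_
  refine (enorm_add_le _ _).trans ?_
  rw [enorm_mul, enorm_mul]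

theorem IsCyl.contDiff {f : X → ℝ} {k : ℕ∞} (hf : IsCyl k f) : ContDiff ℝ k f := by
  obtain ⟨n, L, g, hg, rfl⟩ := hf
  exact hg.1.comp (contDiff_pi.2 fun i => (L i).contDiff)

/-! ### Sobolev functions and traces on lines. -/

section Sobolev

variable {ι : Type*} [IsGaussian μ] (e : HilbertBasis ι ℝ (CM μ))

theorem hPartial_zero (f : X → ℝ) (x : X) (s : Fin 0 → ι) : hPartial e f 0 x s = f x := by
  simp [hPartial]

theorem hPartial_one (f : X → ℝ) (x : X) (s : Fin 1 → ι) :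
    hPartial e f 1 x s = fderiv ℝ f x (incl μ (e (s 0))) := by
  simp [hPartial, iteratedFDeriv_one_apply]

theorem hPartial_two (f : X → ℝ) (x : X) (s : Fin 2 → ι) :
    hPartial e f 2 x s = fderiv ℝ (fderiv ℝ f) x (incl μ (e (s 0))) (incl μ (e (s 1))) := by
  simp [hPartial, iteratedFDeriv_two_apply]

theorem measurable_hPartial {f : X → ℝ} (hf : ContDiff ℝ (⊤ : ℕ∞) f) (j : ℕ) (s : Fin j → ι) :
    Measurable fun x => hPartial e f j x s := by
  have h1 : Continuous (iteratedFDeriv ℝ j f) :=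
    hf.continuous_iteratedFDeriv (by exact_mod_cast le_top)
  have h2 : Continuous fun x => hPartial e f j x s :=
    (continuous_eval_const (fun a => incl μ (e (s a)))).comp h1
  exact h2.measurable

variable {e} {u : CM μ} {ℓ : X → ℝ} {v : ℝ≥0}

/-- Functions in `W^{1,p}(Ω)` are absolutely continuous on almost all lines. -/
theorem IsSobolev.lineAC (hd : LineDecomp μ u ℓ v) {Ω : Set X} (hΩ : MeasurableSet Ω) {p : ℝ}
    (hp : 1 < p) {D : (j : ℕ) → X → (Fin j → ι) → ℝ} (hD : IsSobolev e Ω 1 p D) {φ : X → ℝ}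
    (hφ : D 0 = coeff₀ ι φ) {α β : ℝ} {j k : ι} (hu : u = α • e j + β • e k) :
    LineAC u ℓ Ω φ fun x => α * D 1 x (fun _ => j) + β * D 1 x (fun _ => k) := by
  obtain ⟨hm, f, hf, hlim⟩ := hD
  have hC : ∀ n, ContDiff ℝ (⊤ : ℕ∞) (f n) := fun n => (hf n).contDiff
  have hφm : Measurable φ := by
    have := hm 0 (by norm_num) Fin.elim0
    simpa only [hφ, coeff₀] using this
  have h0 := tendsto_lintegral_combination hp
    (a := fun n x s => D 0 x s - hPartial e (f n) 0 x s)
    (fun n s => (hm 0 (by norm_num) s).sub (measurable_hPartial e (hC n) 0 s))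
    (hlim 0 (by norm_num)) 1 0 Fin.elim0 Fin.elim0
  have h1 := tendsto_lintegral_combination hp
    (a := fun n x s => D 1 x s - hPartial e (f n) 1 x s)
    (fun n s => (hm 1 le_rfl s).sub (measurable_hPartial e (hC n) 1 s))
    (hlim 1 le_rfl) α β (fun _ => j) (fun _ => k)
  have h01 := h0.add h1
  rw [add_zero] at h01
  obtain ⟨θ, hθ⟩ := exists_subseq_tsum_ne_top h01
  rw [ENNReal.tsum_add, ENNReal.add_ne_top] at hθ
  have hgm : ∀ n, Measurable fun x => α * hPartial e (f n) 1 x (fun _ => j)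
      + β * hPartial e (f n) 1 x (fun _ => k) := fun n =>
    ((measurable_hPartial e (hC n) 1 _).const_mul α).add
      ((measurable_hPartial e (hC n) 1 _).const_mul β)
  have key := LineAC.limit hd hΩ (f := fun n => f (θ n))
    (g := fun n x => α * hPartial e (f (θ n)) 1 x (fun _ => j)
      + β * hPartial e (f (θ n)) 1 x (fun _ => k)) (φ := φ)
    (γ := fun x => α * D 1 x (fun _ => j) + β * D 1 x (fun _ => k))
    (fun n => (hC _).continuous.measurable) (fun n => hgm _) hφm
    (((hm 1 le_rfl _).const_mul α).add ((hm 1 le_rfl _).const_mul β)) (fun n => ?_) ?_ ?_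
  · filter_upwards [key] with x hx a b hab hmem
    obtain ⟨C, hC, -⟩ := hx a b hab hmem
    exact ⟨C, hC⟩
  · have := lineAC_of_contDiff (μ := μ) (u := u) (ℓ := ℓ) Ω
      ((hC (θ n)).of_le (by exact_mod_cast le_top))
    convert this using 2 with x
    rw [hPartial_one, hPartial_one, hu, incl_add, incl_smul, incl_smul, map_add, map_smul,
      map_smul, smul_eq_mul, smul_eq_mul]
  · convert hθ.1 using 5 with n x
    rw [hφ, hPartial_zero, coeff₀, one_mul, zero_mul, add_zero, enorm_sub_rev]
  · convert hθ.2 using 5 with n x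
    rw [enorm_sub_rev]
    congr 1
    ring

/-- The components of the gradient of a function in `W^{2,p}(X)` are absolutely continuous on
almost all lines. -/
theorem IsSobolev.lineAC_gradient (hd : LineDecomp μ u ℓ v) {p : ℝ}
    (hp : 1 < p) {D : (j : ℕ) → X → (Fin j → ι) → ℝ} (hD : IsSobolev e Set.univ 3 p D)
    {DG : X → CM μ} {D2G : X → CM μ →L[ℝ] CM μ} (h1 : D 1 = coeff₁ e DG) (h2 : D 2 = coeff₂ e D2G)
    {α β : ℝ} {j k : ι} (hu : u = α • e j + β • e k) (i : ι) :
    LineAC u ℓ Set.univ (fun x => ⟪DG x, e i⟫_ℝ)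
      fun x => α * ⟪D2G x (e j), e i⟫_ℝ + β * ⟪D2G x (e k), e i⟫_ℝ := by
  obtain ⟨hm, f, hf, hlim⟩ := hD
  have hC : ∀ n, ContDiff ℝ (⊤ : ℕ∞) (f n) := fun n => (hf n).contDiff
  have hm1 : Measurable fun x => ⟪DG x, e i⟫_ℝ := by
    have := hm 1 (by norm_num) (fun _ => i)
    simpa only [h1, coeff₁] using this
  have hm2 : ∀ j, Measurable fun x => ⟪D2G x (e j), e i⟫_ℝ := fun j => by
    have := hm 2 (by norm_num) ![j, i]
    rw [h2] at this
    exact this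
  have hl1 := tendsto_lintegral_combination hp
    (a := fun n x s => D 1 x s - hPartial e (f n) 1 x s)
    (fun n s => (hm 1 (by norm_num) s).sub (measurable_hPartial e (hC n) 1 s))
    (hlim 1 (by norm_num)) 1 0 (fun _ => i) (fun _ => i)
  have hl2 := tendsto_lintegral_combination hp
    (a := fun n x s => D 2 x s - hPartial e (f n) 2 x s)
    (fun n s => (hm 2 (by norm_num) s).sub (measurable_hPartial e (hC n) 2 s))
    (hlim 2 (by norm_num)) α β ![j, i] ![k, i]
  have hl := hl1.add hl2
  rw [add_zero] at hl
  obtain ⟨θ, hθ⟩ := exists_subseq_tsum_ne_top hl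
  rw [ENNReal.tsum_add, ENNReal.add_ne_top] at hθ
  have key := LineAC.limit hd MeasurableSet.univ
    (f := fun n x => hPartial e (f (θ n)) 1 x (fun _ => i))
    (g := fun n x => α * hPartial e (f (θ n)) 2 x ![j, i]
      + β * hPartial e (f (θ n)) 2 x ![k, i]) (φ := fun x => ⟪DG x, e i⟫_ℝ)
    (γ := fun x => α * ⟪D2G x (e j), e i⟫_ℝ + β * ⟪D2G x (e k), e i⟫_ℝ)
    (fun n => measurable_hPartial e (hC _) 1 _)
    (fun n => ((measurable_hPartial e (hC _) 2 _).const_mul α).add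
      ((measurable_hPartial e (hC _) 2 _).const_mul β)) hm1
    (((hm2 j).const_mul α).add ((hm2 k).const_mul β)) (fun n => ?_) ?_ ?_
  · filter_upwards [key] with x hx a b hab hmem
    obtain ⟨C, hC, -⟩ := hx a b hab hmem
    exact ⟨C, hC⟩
  · have hfd : ContDiff ℝ 1 (fderiv ℝ (f (θ n))) :=
      (hC (θ n)).fderiv_right (WithTop.coe_le_coe.2 le_top : ((2 : ℕ∞) : WithTop ℕ∞) ≤ _)
    have hcd : ContDiff ℝ 1 fun x => hPartial e (f (θ n)) 1 x (fun _ => i) := by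
      simp only [hPartial_one]
      exact hfd.clm_apply contDiff_const
    have := lineAC_of_contDiff (μ := μ) (u := u) (ℓ := ℓ) Set.univ hcd
    convert this using 2 with x
    have hfdx : DifferentiableAt ℝ (fderiv ℝ (f (θ n))) x := hfd.differentiable one_ne_zero x
    have hder : fderiv ℝ (fun x => hPartial e (f (θ n)) 1 x (fun _ => i)) x (incl μ u)
        = fderiv ℝ (fderiv ℝ (f (θ n))) x (incl μ u) (incl μ (e i)) := by
      simp only [hPartial_one]
      rw [fderiv_clm_apply hfdx (differentiableAt_const _)]
      simp
    rw [hder, hPartial_two, hPartial_two, hu, incl_add, incl_smul, incl_smul, map_add, map_smul,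
      map_smul]
    simp
  · convert hθ.1 using 5 with n x
    rw [h1, coeff₁, one_mul, zero_mul, add_zero, enorm_sub_rev]
  · convert hθ.2 using 5 with n x
    rw [enorm_sub_rev, h2]
    simp only [coeff₂, Matrix.cons_val_zero, Matrix.cons_val_one]
    congr 1
    ring

/-- On the segments in `{G ≤ 0}` of almost all lines, a function with a trace has a continuous
version, and its value at the points of `G⁻¹(0)` is the trace, up to a `ρ`-null set. -/
theorem IsTrace.line (hd : LineDecomp μ u ℓ v) {G : X → ℝ} (hGm : Measurable G) {p : ℝ}
    (hp : 1 < p) {φ T : X → ℝ} (hT : IsTrace e G p φ T)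
    {α β : ℝ} {j k : ι} (hu : u = α • e j + β • e k) :
    ∃ S : X → Prop, RhoAE μ (G ⁻¹' {0}) S ∧ ∀ᵐ x ∂μ, ∀ a b : ℝ, a < b →
      (∀ t ∈ Set.Icc a b, G (x + (t - ℓ x) • incl μ u) ≤ 0) →
      ∃ φ' : ℝ → ℝ, ContinuousOn φ' (Set.Icc a b) ∧
        (∀ᵐ t ∂(volume.restrict (Set.Icc a b)), φ (x + (t - ℓ x) • incl μ u) = φ' t) ∧
        ∀ t ∈ Set.Icc a b, S (x + (t - ℓ x) • incl μ u) → φ' t = T (x + (t - ℓ x) • incl μ u) := by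
  obtain ⟨hTm, D, ψ, Dψ, hD, hφ, hψ, hlim, hρ⟩ := hT
  have hΩ : MeasurableSet {x | G x ≤ 0} := hGm measurableSet_Iic
  have hm := hD.1
  have hmψ := fun n => (hψ n).2.2.1.1
  have hφm : Measurable φ := by
    have := hm 0 (by norm_num) Fin.elim0
    simpa only [hφ, coeff₀] using this
  have hψm : ∀ n, Measurable (ψ n) := fun n => by
    have := hmψ n 0 (by norm_num) Fin.elim0
    simpa only [(hψ n).2.2.2, coeff₀] using this
  have h0 := tendsto_lintegral_combination hp
    (a := fun n x s => D 0 x s - Dψ n 0 x s)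
    (fun n s => (hm 0 (by norm_num) s).sub (hmψ n 0 (by norm_num) s))
    (hlim 0 (by norm_num)) 1 0 Fin.elim0 Fin.elim0
  have h1 := tendsto_lintegral_combination hp
    (a := fun n x s => D 1 x s - Dψ n 1 x s)
    (fun n s => (hm 1 le_rfl s).sub (hmψ n 1 le_rfl s))
    (hlim 1 le_rfl) α β (fun _ => j) (fun _ => k)
  have h01 := (h0.add h1).add hρ
  rw [add_zero, add_zero] at h01
  -- One choice of indices serves the functions, the directional derivatives and the boundary values
  -- at once.
  obtain ⟨θ, hθ⟩ := exists_subseq_tsum_ne_top h01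
  rw [ENNReal.tsum_add, ENNReal.tsum_add, ENNReal.add_ne_top, ENNReal.add_ne_top] at hθ
  obtain ⟨⟨hθ0, hθ1⟩, hθρ⟩ := hθ
  refine ⟨fun x => Tendsto (fun n => ψ (θ n) x) atTop (𝓝 (T x)), ?_, ?_⟩
  · have := rhoAE_tendsto_zero (hGm (measurableSet_singleton 0))
      (fun n => ((hψm (θ n)).sub hTm).enorm) hθρ
    refine this.mono fun x _ hx => ?_
    rw [tendsto_iff_edist_tendsto_0]
    simpa only [edist_eq_enorm_sub, Pi.sub_apply] using hx
  have key := LineAC.limit hd hΩ (f := fun n => ψ (θ n))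
    (g := fun n x => α * Dψ (θ n) 1 x (fun _ => j) + β * Dψ (θ n) 1 x (fun _ => k)) (φ := φ)
    (γ := fun x => α * D 1 x (fun _ => j) + β * D 1 x (fun _ => k))
    (fun n => hψm _)
    (fun n => ((hmψ _ 1 le_rfl _).const_mul α).add ((hmψ _ 1 le_rfl _).const_mul β)) hφm
    (((hm 1 le_rfl _).const_mul α).add ((hm 1 le_rfl _).const_mul β))
    (fun n => (hψ (θ n)).2.2.1.lineAC hd hΩ hp (hψ (θ n)).2.2.2 hu) ?_ ?_
  · filter_upwards [key] with x hx a b hab hmem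
    obtain ⟨C, hC, hC'⟩ := hx a b hab hmem
    refine ⟨_, hC.continuousOn hab.le, hC.2, fun t ht hS => ?_⟩
    refine hC' (fun n => ?_) t ht _ hS
    obtain ⟨K, hK⟩ := (hψ (θ n)).1
    exact hK.continuousOn
  · convert hθ0 using 5 with n x
    rw [hφ, (hψ (θ n)).2.2.2, coeff₀, coeff₀, one_mul, zero_mul, add_zero, enorm_sub_rev]
  · convert hθ1 using 5 with n x
    rw [enorm_sub_rev]
    congr 1
    ring

end Sobolev

/-! ### One-sided limits and derivatives at the end of an interval. -/

section OneDim

theorem frequently_left_of_ae {a b : ℝ} (hab : a < b) {P : ℝ → Prop}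
    (h : ∀ᵐ t ∂(volume.restrict (Set.Icc a b)), P t) : ∃ᶠ t in 𝓝[<] b, P t := by
  intro hc
  obtain ⟨l, hl, hsub⟩ := mem_nhdsLT_iff_exists_Ioo_subset.1 hc
  have hlt : max l a < b := max_lt hl hab
  have h1 : ∀ᵐ t ∂(volume.restrict (Set.Ioo (max l a) b)), False := by
    have h2 := ae_mono (Measure.restrict_mono (μ := (volume : Measure ℝ)) (ν := volume)
      (fun t (ht : t ∈ Set.Ioo (max l a) b) =>
        (⟨(le_max_right l a).trans ht.1.le, ht.2.le⟩ : t ∈ Set.Icc a b)) le_rfl) h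
    filter_upwards [h2, ae_restrict_mem measurableSet_Ioo] with t ht ht'
    exact hsub ⟨(le_max_left l a).trans_lt ht'.1, ht'.2⟩ ht
  have h3 : volume.restrict (Set.Ioo (max l a) b) = 0 :=
    ae_eq_bot.1 (eventually_false_iff_eq_bot.1 h1)
  rw [Measure.restrict_eq_zero, Real.volume_Ioo] at h3
  simp at h3
  rcases h3 with h3 | h3
  · exact absurd hl (not_lt.2 h3)
  · exact absurd hab (not_lt.2 h3)

theorem eq_right_of_ae_eq {a b : ℝ} (hab : a < b) {f g : ℝ → ℝ}
    (h : ∀ᵐ t ∂(volume.restrict (Set.Icc a b)), f t = g t)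
    (hf : ContinuousWithinAt f (Set.Iio b) b) (hg : ContinuousOn g (Set.Icc a b)) :
    f b = g b := by
  have hg' : ContinuousWithinAt g (Set.Iio b) b :=
    ((hg b ⟨hab.le, le_rfl⟩).mono_of_mem_nhdsWithin (Icc_mem_nhdsLT hab))
  exact tendsto_nhds_unique_of_frequently_eq hf hg' (frequently_left_of_ae hab h)

/-- If `f` is differentiable at `b` and is on `[a, b]` a primitive of a function with a continuous
version `g`, then its derivative at `b` is `g b`. -/
theorem PrimitiveOn.deriv_right {a b C : ℝ} (hab : a < b) {f γ g : ℝ → ℝ} {f' : ℝ}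
    (hp : PrimitiveOn f γ a b C) (hf : HasDerivAt f f' b) (hg : ContinuousOn g (Set.Icc a b))
    (h : ∀ᵐ t ∂(volume.restrict (Set.Icc a b)), γ t = g t) : f' = g b := by
  -- Extending `g` continuously beyond `b` makes its primitive differentiable at `b`; left slopes of
  -- the two functions then agree frequently, so the derivatives agree.
  set g₁ : ℝ → ℝ := Set.IccExtend hab.le ((Set.Icc a b).domRestrict g) with hg₁
  have hg₁c : Continuous g₁ := (continuousOn_iff_continuous_domRestrict.1 hg).Icc_extend'
  have hg₁e : ∀ t ∈ Set.Icc a b, g₁ t = g t := fun t ht => by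
    rw [hg₁, Set.IccExtend_of_mem _ _ ht]; rfl
  set F : ℝ → ℝ := fun t => C + ∫ s in a..t, g₁ s with hF
  have hFd : HasDerivAt F (g₁ b) b := by
    have := intervalIntegral.integral_hasDerivAt_right (hg₁c.intervalIntegrable a b)
      hg₁c.stronglyMeasurable.stronglyMeasurableAtFilter hg₁c.continuousAt
    exact this.const_add C
  have hfF : ∀ᵐ t ∂(volume.restrict (Set.Icc a b)), f t = F t := by
    filter_upwards [hp.2, ae_restrict_mem measurableSet_Icc] with t ht htm
    rw [ht, hF]
    simp only
    congr 1
    rw [intervalIntegral.integral_of_le htm.1, intervalIntegral.integral_of_le htm.1]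
    have hsub : Set.Ioc a t ⊆ Set.Icc a b := fun s hs => ⟨hs.1.le, hs.2.trans htm.2⟩
    refine integral_congr_ae ?_
    filter_upwards [ae_mono (Measure.restrict_mono hsub le_rfl) h,
      ae_restrict_mem measurableSet_Ioc] with s hs hsm
    rw [hs, hg₁e s (hsub hsm)]
  have hb : f b = F b := by
    refine eq_right_of_ae_eq hab hfF hf.continuousAt.continuousWithinAt ?_
    intro t ht
    have h1 : Continuous F := by
      have := intervalIntegral.continuous_primitive (μ := volume)
        (fun a b => hg₁c.intervalIntegrable a b) a
      exact continuous_const.add this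
    exact h1.continuousWithinAt
  have hs1 : Tendsto (slope f b) (𝓝[<] b) (𝓝 f') :=
    (hasDerivAt_iff_tendsto_slope.1 hf).mono_left (nhdsWithin_mono _ fun t ht => (Set.mem_Iio.1 ht).ne)
  have hs2 : Tendsto (slope F b) (𝓝[<] b) (𝓝 (g₁ b)) :=
    (hasDerivAt_iff_tendsto_slope.1 hFd).mono_left (nhdsWithin_mono _ fun t ht => (Set.mem_Iio.1 ht).ne)
  rw [← hg₁e b ⟨hab.le, le_rfl⟩]
  refine tendsto_nhds_unique_of_frequently_eq hs1 hs2 ?_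
  refine (frequently_left_of_ae hab hfF).mono fun t ht => ?_
  rw [slope_def_field, slope_def_field, ht, hb]

end OneDim

/-! ### Traces are restrictions at transversal points. -/

section Trace

variable [IsGaussian μ] {ι : Type*} {e : HilbertBasis ι ℝ (CM μ)} {G : X → ℝ} {DG : X → CM μ}
  {D2G : X → CM μ →L[ℝ] CM μ}

/-- `G` decreases initially along `-u`, which gives one further point with `G ≤ 0`; convexity fills
in the segment. -/
theorem exists_segment (hG : ConvexOn ℝ Set.univ G) {y : X} {u : CM μ} (h0 : G y = 0)
    (hd : HasHDerivAt G (innerSL ℝ (DG y)) y) (hu : 0 < ⟪DG y, u⟫_ℝ) :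
    ∃ δ : ℝ, 0 < δ ∧ ∀ r ∈ Set.Icc (-δ) (0 : ℝ), G (y + r • incl μ u) ≤ 0 := by
  have h1 := hd.hasFDerivAt.lim_real (-u)
  simp only [zero_add, incl_zero, add_zero, innerSL_apply_apply, incl_smul, smul_eq_mul, h0,
    sub_zero, inner_neg_right, incl_neg] at h1
  obtain ⟨c, hc, hc0⟩ := ((h1.eventually_lt_const (neg_lt_zero.2 hu)).and
    (eventually_gt_atTop (0 : ℝ))).exists
  refine ⟨c⁻¹, inv_pos.2 hc0, fun r hr => ?_⟩
  have hneg : G (y + c⁻¹ • -incl μ u) ≤ 0 := by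
    by_contra! h
    nlinarith
  have hr1 : 0 ≤ -r * c := mul_nonneg (by linarith [hr.2]) hc0.le
  have hr2 : 0 ≤ 1 - -r * c := by
    have : -r * c ≤ c⁻¹ * c := by gcongr; linarith [hr.1]
    rw [inv_mul_cancel₀ hc0.ne'] at this
    linarith
  have h3 := hG.2 (Set.mem_univ y) (Set.mem_univ (y + c⁻¹ • -incl μ u)) hr2 hr1 (by ring)
  have h4 : (1 - -r * c) • y + (-r * c) • (y + c⁻¹ • -incl μ u) = y + r • incl μ u := by
    have : (-r * c) • c⁻¹ • -incl μ u = r • incl μ u := by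
      rw [smul_smul, mul_assoc, mul_inv_cancel₀ hc0.ne', smul_neg, mul_one, neg_smul, neg_neg]
    rw [smul_add, this]
    module
  rw [h4, h0, smul_zero, zero_add, smul_eq_mul] at h3
  nlinarith

/-- Quantifying over the offset `s₀` makes a statement about parametrised lines invariant along `u`.
-/
theorem transversalAE_of_line (hμ : ∀ L : StrongDual ℝ X, ∫ x, L x ∂μ = 0)
    (hGm : Measurable G) (hDm : ∀ w : CM μ, Measurable fun x => ⟪DG x, w⟫_ℝ)
    (hsub : RhoAE μ (G ⁻¹' {0}) (IsSubgradAt G DG)) {u : CM μ} {ℓ : X → ℝ}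
    {R : (ℝ → X) → Prop} (h : ∀ᵐ x ∂μ, R fun t => x + (t - ℓ x) • incl μ u) :
    TransversalAE G DG fun y => 0 < ⟪DG y, u⟫_ℝ →
      ∃ s₀ : ℝ, R fun t => y + (t - s₀) • incl μ u := by
  refine transversalAE_of_invariant hμ hGm hDm hsub (u := u)
    (Q := fun y => ∃ s₀ : ℝ, R fun t => y + (t - s₀) • incl μ u) ?_ ?_
  · rintro x s ⟨s₀, hs⟩
    refine ⟨s₀ + s, ?_⟩
    convert hs using 2 with t
    module
  · filter_upwards [h] with x hx
    exact ⟨_, hx⟩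

/-- The trace of a function that is continuous along `H` at the points of `G⁻¹(0)` is its
restriction. -/
theorem IsTrace.eq_of_continuousAt (hμ : ∀ L : StrongDual ℝ X, ∫ x, L x ∂μ = 0)
    (hGm : Measurable G) (hG : ConvexOn ℝ Set.univ G)
    (hDm : ∀ w : CM μ, Measurable fun x => ⟪DG x, w⟫_ℝ)
    {φ T : X → ℝ} (hreg : RhoAE μ (G ⁻¹' {0}) fun y =>
      HasHDerivAt G (innerSL ℝ (DG y)) y ∧ ContinuousAt (fun k : CM μ => φ (y + incl μ k)) 0)
    {p : ℝ} (hp : 1 < p) (hT : IsTrace e G p φ T)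
    {u : CM μ} {α β : ℝ} {j k : ι} (hu : u = α • e j + β • e k) :
    TransversalAE G DG fun y => 0 < ⟪DG y, u⟫_ℝ → T y = φ y := by
  by_cases hu0 : u = 0
  · refine (hreg.transversalAE DG).mono fun y _ _ h => ?_
    simp [hu0] at h
  obtain ⟨ℓ, v, hd⟩ := exists_lineDecomp hμ u hu0
  obtain ⟨S, hS, hline⟩ := hT.line hd hGm hp hu
  have hsub : RhoAE μ (G ⁻¹' {0}) (IsSubgradAt G DG) :=
    hreg.mono fun y _ hy => hy.1.isSubgradAt hG
  have h1 := transversalAE_of_line hμ hGm hDm hsub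
    (R := fun c : ℝ → X => ∀ a b : ℝ, a < b → (∀ t ∈ Set.Icc a b, G (c t) ≤ 0) →
      ∃ φ' : ℝ → ℝ, ContinuousOn φ' (Set.Icc a b) ∧
        (∀ᵐ t ∂(volume.restrict (Set.Icc a b)), φ (c t) = φ' t) ∧
        ∀ t ∈ Set.Icc a b, S (c t) → φ' t = T (c t)) hline
  refine ((h1.and (hS.transversalAE DG)).and (hreg.transversalAE DG)).mono ?_
  rintro y hy0 ⟨⟨hy, hyS⟩, hdy, hcy⟩ hpos
  obtain ⟨s₀, hs₀⟩ := hy hpos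
  obtain ⟨δ, hδ, hseg⟩ := exists_segment hG hy0 hdy hpos
  obtain ⟨φ', hφ'c, hφ'e, hφ't⟩ := hs₀ (s₀ - δ) s₀ (by linarith) fun t ht =>
    hseg (t - s₀) ⟨by linarith [ht.1], by linarith [ht.2]⟩
  have hmem : s₀ ∈ Set.Icc (s₀ - δ) s₀ := ⟨by linarith, le_rfl⟩
  have hys : y + (s₀ - s₀) • incl μ u = y := by rw [sub_self, zero_smul, add_zero]
  have h2 : S y → φ' s₀ = T y := by simpa only [hys] using hφ't s₀ hmem
  rw [← h2 hyS]
  have hcont : ContinuousAt (fun t : ℝ => φ (y + (t - s₀) • incl μ u)) s₀ := by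
    have h3 : ContinuousAt (fun t : ℝ => (t - s₀) • u) s₀ := by fun_prop
    have h4 : (fun t : ℝ => φ (y + (t - s₀) • incl μ u))
        = (fun k : CM μ => φ (y + incl μ k)) ∘ fun t : ℝ => (t - s₀) • u := by
      funext t
      simp only [Function.comp_apply, incl_smul]
    rw [h4]
    refine ContinuousAt.comp ?_ h3
    simpa using hcy
  have h5 := eq_right_of_ae_eq (by linarith : s₀ - δ < s₀) hφ'e hcont.continuousWithinAt hφ'c
  rw [← h5]
  simp only [hys]

/-- The trace of the second derivative, applied to a transversal direction, is the derivative of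
the gradient. -/
theorem IsTrace.secondDeriv_eq (hμ : ∀ L : StrongDual ℝ X, ∫ x, L x ∂μ = 0)
    (hGm : Measurable G) (hG : ConvexOn ℝ Set.univ G)
    (hDm : ∀ w : CM μ, Measurable fun x => ⟪DG x, w⟫_ℝ)
    (hreg : RhoAE μ (G ⁻¹' {0}) fun y =>
      HasHDerivAt G (innerSL ℝ (DG y)) y ∧ HasHDerivAt DG (D2G y) y)
    {p : ℝ} (hp : 1 < p) {q : ℝ} (hq : 1 < q) {D : (j : ℕ) → X → (Fin j → ι) → ℝ}
    (hD : IsSobolev e Set.univ 3 q D) (hD1 : D 1 = coeff₁ e DG) (hD2 : D 2 = coeff₂ e D2G)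
    {i j k : ι} {Tj Tk : X → ℝ}
    (hTj : IsTrace e G p (fun x => ⟪D2G x (e j), e i⟫_ℝ) Tj)
    (hTk : IsTrace e G p (fun x => ⟪D2G x (e k), e i⟫_ℝ) Tk)
    {u : CM μ} {α β : ℝ} (hu : u = α • e j + β • e k) :
    TransversalAE G DG fun y => 0 < ⟪DG y, u⟫_ℝ →
      α * Tj y + β * Tk y = α * ⟪D2G y (e j), e i⟫_ℝ + β * ⟪D2G y (e k), e i⟫_ℝ := by
  by_cases hu0 : u = 0
  · refine (hreg.transversalAE DG).mono fun y _ _ h => ?_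
    simp [hu0] at h
  obtain ⟨ℓ, v, hd⟩ := exists_lineDecomp hμ u hu0
  obtain ⟨Sj, hSj, hlinej⟩ := hTj.line hd hGm hp hu
  obtain ⟨Sk, hSk, hlinek⟩ := hTk.line hd hGm hp hu
  have hgrad := hD.lineAC_gradient hd hq hD1 hD2 hu i
  have hsub : RhoAE μ (G ⁻¹' {0}) (IsSubgradAt G DG) :=
    hreg.mono fun y _ hy => hy.1.isSubgradAt hG
  -- The three facts go into one `R` because they must share the offset `s₀`.
  have h1 := transversalAE_of_line hμ hGm hDm hsub
    (R := fun c : ℝ → X => ∀ a b : ℝ, a < b → (∀ t ∈ Set.Icc a b, G (c t) ≤ 0) →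
      (∃ φ' : ℝ → ℝ, ContinuousOn φ' (Set.Icc a b) ∧
        (∀ᵐ t ∂(volume.restrict (Set.Icc a b)), ⟪D2G (c t) (e j), e i⟫_ℝ = φ' t) ∧
        ∀ t ∈ Set.Icc a b, Sj (c t) → φ' t = Tj (c t)) ∧
      (∃ φ' : ℝ → ℝ, ContinuousOn φ' (Set.Icc a b) ∧
        (∀ᵐ t ∂(volume.restrict (Set.Icc a b)), ⟪D2G (c t) (e k), e i⟫_ℝ = φ' t) ∧
        ∀ t ∈ Set.Icc a b, Sk (c t) → φ' t = Tk (c t)) ∧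
      ∃ C, PrimitiveOn (fun t => ⟪DG (c t), e i⟫_ℝ)
        (fun t => α * ⟪D2G (c t) (e j), e i⟫_ℝ + β * ⟪D2G (c t) (e k), e i⟫_ℝ) a b C)
    (u := u) (ℓ := ℓ) (by
      filter_upwards [hlinej, hlinek, hgrad] with x hx1 hx2 hx3 a b hab hmem
      exact ⟨hx1 a b hab hmem, hx2 a b hab hmem, hx3 a b hab fun _ _ => Set.mem_univ _⟩)
  refine ((h1.and ((hSj.and hSk).transversalAE DG)).and (hreg.transversalAE DG)).mono ?_
  rintro y hy0 ⟨⟨hy, hySj, hySk⟩, hdy, hd2y⟩ hpos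
  obtain ⟨s₀, hs₀⟩ := hy hpos
  obtain ⟨δ, hδ, hseg⟩ := exists_segment hG hy0 hdy hpos
  obtain ⟨⟨φj, hjc, hje, hjt⟩, ⟨φk, hkc, hke, hkt⟩, C, hC⟩ :=
    hs₀ (s₀ - δ) s₀ (by linarith) fun t ht =>
      hseg (t - s₀) ⟨by linarith [ht.1], by linarith [ht.2]⟩
  have hmem : s₀ ∈ Set.Icc (s₀ - δ) s₀ := ⟨by linarith, le_rfl⟩
  have hys : y + (s₀ - s₀) • incl μ u = y := by rw [sub_self, zero_smul, add_zero]
  have h2 : Sj y → φj s₀ = Tj y := by simpa only [hys] using hjt s₀ hmem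
  have h3 : Sk y → φk s₀ = Tk y := by simpa only [hys] using hkt s₀ hmem
  rw [← h2 hySj, ← h3 hySk]
  have hder : HasDerivAt (fun t : ℝ => ⟪DG (y + (t - s₀) • incl μ u), e i⟫_ℝ)
      ⟪D2G y u, e i⟫_ℝ s₀ := by
    have h4 : HasDerivAt (fun t : ℝ => (t - s₀) • u) u s₀ := by
      simpa using ((hasDerivAt_id s₀).sub_const s₀).smul_const u
    have h5 : HasFDerivAt (fun k : CM μ => DG (y + incl μ k)) (D2G y) ((s₀ - s₀) • u) := by
      simpa using hd2y.hasFDerivAt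
    have h6 := h5.comp_hasDerivAt s₀ h4
    have h7 := h6.inner ℝ (hasDerivAt_const s₀ (e i))
    simp only [Function.comp_apply, incl_smul, inner_zero_right, zero_add] at h7
    exact h7
  have hlin : ⟪D2G y u, e i⟫_ℝ
      = α * ⟪D2G y (e j), e i⟫_ℝ + β * ⟪D2G y (e k), e i⟫_ℝ := by
    rw [hu, map_add, map_smul, map_smul, inner_add_left, real_inner_comm, inner_smul_CM,
      real_inner_comm (e i) (β • _), inner_smul_CM, real_inner_comm, real_inner_comm (D2G y (e k))]
  rw [← hlin]
  refine (hC.deriv_right (by linarith) hder ((hjc.const_mul α).add (hkc.const_mul β)) ?_).symm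
  filter_upwards [hje, hke] with t ht1 ht2
  rw [ht1, ht2]
  rfl

end Trace

/-! ### The product rule along the level. -/

section Tangential

variable [IsGaussian μ] {G : X → ℝ} {DG : X → CM μ} {D2G : X → CM μ →L[ℝ] CM μ}

/-- Near a point `y` of `G⁻¹(0)`, a tangent direction is approximated by directions of points of
`G⁻¹(0)` in almost all of the lines parallel to a transversal direction `u`. -/
theorem exists_levelSet_approx (hG : ConvexOn ℝ Set.univ G) {y : X} (h0 : G y = 0)
    (hd : HasHDerivAt G (innerSL ℝ (DG y)) y) {u : CM μ} (hu : 0 < ⟪DG y, u⟫_ℝ)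
    {n : ℕ} (T : (Fin n → ℝ) →L[ℝ] CM μ) (a : Fin n → ℝ) (ha : ⟪DG y, T a⟫_ℝ = 0)
    {R : X → Prop}
    (hR : ∀ᵐ z : Fin n → ℝ, ∀ t : ℝ, G (y + incl μ (T z) + t • incl μ u) = 0 →
      R (y + incl μ (T z) + t • incl μ u)) {η : ℝ} (hη : 0 < η) :
    ∃ (t : ℝ) (k : CM μ), 0 < t ∧ t < η ∧ ‖t⁻¹ • k - T a‖ < η ∧ R (y + incl μ k) := by
  have hdense := Measure.dense_of_ae hR
  -- Good parameters are dense; an error below `t²` still vanishes after division by `t`.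
  have hz : ∀ t : ℝ, 0 < t → ∃ z : Fin n → ℝ, ‖T z - T (t • a)‖ < t * t ∧
      ∀ s : ℝ, G (y + incl μ (T z) + s • incl μ u) = 0 →
        R (y + incl μ (T z) + s • incl μ u) := by
    intro t ht
    have hopen : IsOpen {z : Fin n → ℝ | ‖T z - T (t • a)‖ < t * t} :=
      isOpen_lt (by fun_prop) continuous_const
    obtain ⟨z, hz, hz'⟩ := hdense.exists_mem_open hopen
      ⟨t • a, by simpa using mul_pos ht ht⟩
    exact ⟨z, hz', hz⟩
  choose! z hz1 hz2 using hz
  have hlim : Tendsto (fun t : ℝ => t⁻¹ • T (z t)) (𝓝[>] 0) (𝓝 (T a)) := by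
    rw [tendsto_iff_norm_sub_tendsto_zero]
    refine squeeze_zero' (g := fun t : ℝ => t) (Eventually.of_forall fun _ => norm_nonneg _) ?_
      (tendsto_nhdsWithin_of_tendsto_nhds tendsto_id)
    filter_upwards [self_mem_nhdsWithin] with t ht
    have ht0 : 0 < t := ht
    have h1 : t⁻¹ • T (z t) - T a = t⁻¹ • (T (z t) - T (t • a)) := by
      rw [smul_sub, map_smul, smul_smul, inv_mul_cancel₀ ht0.ne', one_smul]
    rw [h1, norm_smul, norm_inv, Real.norm_eq_abs, abs_of_pos ht0]
    calc t⁻¹ * ‖T (z t) - T (t • a)‖ ≤ t⁻¹ * (t * t) := by gcongr; exact (hz1 t ht0).le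
      _ = t := by field_simp
  -- Because `T a` is tangent, only the displacement along `u` counts to first order. Taking `c =
  -- ±ε` gives a sign change of `G`, hence a zero at distance at most `ε * t` along `u`.
  have htan : ∀ c : ℝ, Tendsto (fun t : ℝ => t⁻¹ * G (y + incl μ (T (z t)) + (c * t) • incl μ u))
      (𝓝[>] 0) (𝓝 (c * ⟪DG y, u⟫_ℝ)) := by
    intro c
    have h1 : Tendsto (fun t : ℝ => t⁻¹ • (T (z t) + (c * t) • u)) (𝓝[>] 0)
        (𝓝 (T a + c • u)) := by
      refine (hlim.add (tendsto_const_nhds (x := c • u))).congr' ?_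
      filter_upwards [self_mem_nhdsWithin] with t ht
      have ht0 : t ≠ 0 := (Set.mem_Ioi.1 ht).ne'
      rw [smul_add, smul_smul, mul_comm c t, ← mul_assoc, inv_mul_cancel₀ ht0, one_mul]
    have h2 : Tendsto (fun t : ℝ => T (z t) + (c * t) • u) (𝓝[>] 0) (𝓝 0) := by
      have h3 : Tendsto (fun t : ℝ => t) (𝓝[>] 0) (𝓝 0) :=
        tendsto_nhdsWithin_of_tendsto_nhds tendsto_id
      have h4 := h3.smul h1
      rw [zero_smul] at h4
      refine h4.congr' ?_
      filter_upwards [self_mem_nhdsWithin] with t ht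
      have ht0 : t ≠ 0 := (Set.mem_Ioi.1 ht).ne'
      rw [smul_smul, mul_inv_cancel₀ ht0, one_smul]
    have h5 := (hasFDerivWithinAt_univ.2 hd.hasFDerivAt).lim h2
      (Eventually.of_forall fun _ => Set.mem_univ _) h1
    simp only [zero_add, incl_zero, add_zero, h0, sub_zero, innerSL_apply_apply, inner_add_right,
      ha, incl_add, incl_smul, smul_eq_mul, inner_smul_CM, ← add_assoc] at h5
    exact h5
  obtain ⟨ε, hε, hεu⟩ : ∃ ε : ℝ, 0 < ε ∧ ε * ‖u‖ < η / 2 := by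
    refine ⟨η / 2 / (‖u‖ + 1), by positivity, ?_⟩
    rw [div_mul_eq_mul_div, div_lt_iff₀ (by positivity)]
    have := norm_nonneg u
    nlinarith
  have hpos := (htan ε).eventually_const_lt (mul_pos hε hu)
  have hneg := (htan (-ε)).eventually_lt_const
    (by rw [neg_mul]; exact neg_lt_zero.2 (mul_pos hε hu) : -ε * ⟪DG y, u⟫_ℝ < 0)
  have hnear := (tendsto_iff_norm_sub_tendsto_zero.1 hlim).eventually_lt_const (half_pos hη)
  have hsmall : ∀ᶠ t : ℝ in 𝓝[>] 0, t < η := mem_nhdsWithin_of_mem_nhds (Iio_mem_nhds hη)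
  obtain ⟨t, ht1, ht2, ht3, ht4, ht5⟩ :=
    (hpos.and (hneg.and (hnear.and (hsmall.and self_mem_nhdsWithin)))).exists
  have ht0 : 0 < t := ht5
  have hti : 0 < t⁻¹ := inv_pos.2 ht0
  have hcont : Continuous fun s : ℝ => G (y + incl μ (T (z t)) + s • incl μ u) :=
    continuous_convex_comp_linear hG (y + incl μ (T (z t)))
      (LinearMap.toSpanSingleton ℝ X (incl μ u))
  have hεt : 0 < ε * t := mul_pos hε ht0
  obtain ⟨s, hs, hs0⟩ := intermediate_value_Icc (by linarith : -ε * t ≤ ε * t) hcont.continuousOn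
    (⟨(neg_of_mul_neg_right ht2 hti.le).le, (pos_of_mul_pos_right ht1 hti.le).le⟩ :
      (0 : ℝ) ∈ Set.Icc _ _)
  refine ⟨t, T (z t) + s • u, ht0, ht4, ?_, ?_⟩
  · have hs' : |t⁻¹ * s| ≤ ε := by
      rw [abs_mul, abs_of_pos hti, inv_mul_le_iff₀ ht0]
      exact abs_le.2 ⟨by linarith [hs.1], by linarith [hs.2]⟩
    have h6 : t⁻¹ • (T (z t) + s • u) - T a = (t⁻¹ • T (z t) - T a) + (t⁻¹ * s) • u := by
      rw [smul_add, smul_smul]; abel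
    rw [h6]
    calc _ ≤ ‖t⁻¹ • T (z t) - T a‖ + |t⁻¹ * s| * ‖u‖ := by
          refine (norm_add_le _ _).trans_eq ?_
          rw [norm_smul, Real.norm_eq_abs]
      _ ≤ ‖t⁻¹ • T (z t) - T a‖ + ε * ‖u‖ := by gcongr
      _ < η := by linarith
  · rw [incl_add, incl_smul, ← add_assoc]
    exact hz2 t ht0 s hs0

/-- Along zeros `y + k m` with `(t m)⁻¹ • k m → Φ y` the function `⟪Φ, DG⟫` vanishes identically, so
its derivative in the direction `Φ y` is zero. -/
theorem tangential_second_deriv (hG : ConvexOn ℝ Set.univ G) {y : X} (h0 : G y = 0)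
    (hd : HasHDerivAt G (innerSL ℝ (DG y)) y) (hd2 : HasHDerivAt DG (D2G y) y)
    {u : CM μ} (hu : 0 < ⟪DG y, u⟫_ℝ) {Φ : X → CM μ} (hΦ : DifferentiableAt ℝ Φ y)
    {n : ℕ} (T : (Fin n → ℝ) →L[ℝ] CM μ) (a : Fin n → ℝ) (ha : T a = Φ y)
    (hy : ⟪Φ y, DG y⟫_ℝ = 0)
    (hR : ∀ᵐ z : Fin n → ℝ, ∀ t : ℝ, G (y + incl μ (T z) + t • incl μ u) = 0 →
      ⟪Φ (y + incl μ (T z) + t • incl μ u), DG (y + incl μ (T z) + t • incl μ u)⟫_ℝ = 0) :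
    ⟪D2G y (Φ y), Φ y⟫_ℝ = -⟪hDeriv Φ y (Φ y), DG y⟫_ℝ := by
  have hex := fun m : ℕ => exists_levelSet_approx hG h0 hd hu T a
    (by rw [ha, real_inner_comm, hy]) (R := fun x => ⟪Φ x, DG x⟫_ℝ = 0) hR
    (Nat.one_div_pos_of_nat (α := ℝ) (n := m))
  choose t k ht0 ht1 hk hkR using hex
  have ht : Tendsto t atTop (𝓝 0) := squeeze_zero (fun m => (ht0 m).le) (fun m => (ht1 m).le)
    tendsto_one_div_add_atTop_nhds_zero_nat
  have hlim : Tendsto (fun m => (t m)⁻¹ • k m) atTop (𝓝 (Φ y)) := by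
    rw [← ha, tendsto_iff_norm_sub_tendsto_zero]
    exact squeeze_zero (fun m => norm_nonneg _) (fun m => (hk m).le)
      tendsto_one_div_add_atTop_nhds_zero_nat
  have hk0 : Tendsto k atTop (𝓝 0) := by
    have h1 := ht.smul hlim
    rw [zero_smul] at h1
    refine h1.congr fun m => ?_
    rw [smul_smul, mul_inv_cancel₀ (ht0 m).ne', one_smul]
  have hΦd : HasFDerivAt (fun k : CM μ => Φ (y + incl μ k))
      ((fderiv ℝ Φ y).comp (inclCLM μ)) 0 := by
    have h1 : HasFDerivAt (fun k : CM μ => y + inclCLM μ k) (inclCLM μ) 0 :=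
      (inclCLM μ).hasFDerivAt.const_add y
    have h2 : HasFDerivAt Φ (fderiv ℝ Φ y) (y + inclCLM μ 0) := by
      simpa using hΦ.hasFDerivAt
    exact h2.comp 0 h1
  have hinner := hΦd.inner ℝ hd2.hasFDerivAt
  have h1 := (hasFDerivWithinAt_univ.2 hinner).lim hk0
    (Eventually.of_forall fun _ => Set.mem_univ _) hlim
  simp only [zero_add, incl_zero, add_zero, hy, hkR, sub_zero, smul_zero] at h1
  have h2 := tendsto_nhds_unique h1 tendsto_const_nhds
  simp only [ContinuousLinearMap.comp_apply, ContinuousLinearMap.prod_apply,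
    fderivInnerCLM_apply] at h2
  rw [real_inner_comm, eq_neg_iff_add_eq_zero]
  exact h2

theorem MemZ.contDiff {TDG Φ : X → CM μ} (hΦ : MemZ G TDG Φ) : ContDiff ℝ 1 Φ := by
  obtain ⟨⟨n, h, φ, hφ, rfl⟩, -⟩ := hΦ
  refine ContDiff.sum fun i _ => ContDiff.fun_smul ?_ contDiff_const
  exact (hφ i).contDiff.of_le (WithTop.coe_le_coe.2 (by norm_num : (1 : ℕ∞) ≤ 2))

/-- All values of `Φ` lie in the span of finitely many `h i`, so one finite-dimensional family of
translations serves every `y`; orthogonality on almost all translated `u`-lines is invariant along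
`u`. -/
theorem MemZ.transversalAE (hμ : ∀ L : StrongDual ℝ X, ∫ x, L x ∂μ = 0)
    (hGm : Measurable G) (hG : ConvexOn ℝ Set.univ G)
    (hDm : ∀ w : CM μ, Measurable fun x => ⟪DG x, w⟫_ℝ)
    (hreg : RhoAE μ (G ⁻¹' {0}) fun y =>
      HasHDerivAt G (innerSL ℝ (DG y)) y ∧ HasHDerivAt DG (D2G y) y)
    {Φ : X → CM μ} (hΦ : MemZ G DG Φ) {u : CM μ} (hu : u ≠ 0) :
    TransversalAE G DG fun y => 0 < ⟪DG y, u⟫_ℝ →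
      ⟪D2G y (Φ y), Φ y⟫_ℝ = -⟪hDeriv Φ y (Φ y), DG y⟫_ℝ := by
  have hdiff : Differentiable ℝ Φ := hΦ.contDiff.differentiable one_ne_zero
  obtain ⟨⟨n, h, φ, -, hΦe⟩, hort⟩ := hΦ
  set T : (Fin n → ℝ) →L[ℝ] CM μ :=
    ∑ i, (ContinuousLinearMap.proj (R := ℝ) (φ := fun _ : Fin n => ℝ) i).smulRight (h i) with hT
  have hTa : ∀ y, T (fun i => φ i y) = Φ y := by
    intro y
    rw [hT, hΦe, _root_.sum_apply]
    rfl
  have hsub : RhoAE μ (G ⁻¹' {0}) (IsSubgradAt G DG) :=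
    hreg.mono fun y _ hy => hy.1.isSubgradAt hG
  have hTm : Measurable fun z => incl μ (T z) := (continuous_incl.comp T.continuous).measurable
  have h1 := transversalAE_of_invariant hμ hGm hDm hsub (u := u)
    (Q := fun y => ∀ᵐ z : Fin n → ℝ, ∀ t : ℝ, G (y + incl μ (T z) + t • incl μ u) = 0 →
      ⟪Φ (y + incl μ (T z) + t • incl μ u), DG (y + incl μ (T z) + t • incl μ u)⟫_ℝ = 0)
    (by
      intro x s hx
      filter_upwards [hx] with z hz t
      have h2 : x + s • incl μ u + incl μ (T z) + t • incl μ u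
          = x + incl μ (T z) + (s + t) • incl μ u := by module
      rw [h2]
      exact hz (s + t))
    (ae_ae_add_incl hμ volume T hTm (hort.ae_line hu))
  refine ((h1.and (hort.transversalAE DG)).and (hreg.transversalAE DG)).mono ?_
  rintro y hy0 ⟨⟨hyR, hy⟩, hd, hd2⟩ hpos
  exact tangential_second_deriv hG hy0 hd hd2 hpos (hdiff y) T _ (hTa y) hy (hyR hpos)

end Tangential

/-! ### Coordinates in the orthonormal basis. -/

section Basis

variable {ι : Type*} (e : HilbertBasis ι ℝ (CM μ))

theorem basis_ext {v w : CM μ} (h : ∀ i, ⟪v, e i⟫_ℝ = ⟪w, e i⟫_ℝ) : v = w := by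
  refine e.repr.injective (lp.ext (funext fun i => ?_))
  rw [e.repr_apply_apply, e.repr_apply_apply, real_inner_comm, h, real_inner_comm]

theorem basis_ext_clm {A B : CM μ →L[ℝ] CM μ}
    (h : ∀ i j, ⟪A (e j), e i⟫_ℝ = ⟪B (e j), e i⟫_ℝ) : A = B := by
  refine ContinuousLinearMap.ext_on (Submodule.dense_iff_topologicalClosure_eq_top.2 e.dense_span) ?_
  rintro _ ⟨j, rfl⟩
  exact basis_ext e fun i => h i j

theorem measurable_inner_of_coord [Countable ι] {A B : X → CM μ}
    (hA : ∀ i, Measurable fun x => ⟪A x, e i⟫_ℝ) (hB : ∀ i, Measurable fun x => ⟪B x, e i⟫_ℝ) :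
    Measurable fun x => ⟪A x, B x⟫_ℝ := by
  refine measurable_of_tendsto_metrizable' (atTop : Filter (Finset ι))
    (f := fun s x => ∑ i ∈ s, ⟪A x, e i⟫_ℝ * ⟪e i, B x⟫_ℝ) (fun s => ?_)
    (tendsto_pi_nhds.2 fun x => e.hasSum_inner_mul_inner (A x) (B x))
  refine Finset.measurable_fun_sum s fun i _ => (hA i).mul ?_
  simpa only [real_inner_comm] using hB i

theorem measurable_inner_clm_apply_of_coord [Countable ι] {A : X → CM μ →L[ℝ] CM μ}
    {B : X → CM μ} (hA : ∀ i j, Measurable fun x => ⟪A x (e j), e i⟫_ℝ)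
    (hB : ∀ i, Measurable fun x => ⟪B x, e i⟫_ℝ) (i : ι) :
    Measurable fun x => ⟪A x (B x), e i⟫_ℝ := by
  have h := measurable_inner_of_coord e (A := B)
    (B := fun x => ContinuousLinearMap.adjoint (A x) (e i)) hB fun j => by
      simp only [ContinuousLinearMap.adjoint_inner_left, real_inner_comm (A _ (e j))]
      exact hA i j
  simpa only [ContinuousLinearMap.adjoint_inner_right] using h

/-- Integer coefficients keep the family of test directions countable. -/
theorem exists_transversal {v : CM μ} (hv : v ≠ 0) : ∃ (k : ι) (σ : ℤ), 0 < σ * ⟪v, e k⟫_ℝ := by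
  obtain ⟨k, hk⟩ : ∃ k, ⟪v, e k⟫_ℝ ≠ 0 := by
    by_contra! h
    exact hv (basis_ext e fun i => by rw [h i, inner_zero_left])
  rcases lt_or_gt_of_ne hk with h | h
  · exact ⟨k, -1, by push_cast; linarith⟩
  · exact ⟨k, 1, by push_cast; linarith⟩

theorem inner_combination (v : CM μ) (α β : ℝ) (j k : ι) :
    ⟪v, α • e j + β • e k⟫_ℝ = α * ⟪v, e j⟫_ℝ + β * ⟪v, e k⟫_ℝ := by
  rw [inner_add_right, inner_smul_CM, inner_smul_CM]

end Basis

/-! ### Identification of the traces and the tangential identity. -/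

section Main

variable [IsGaussian μ] {ι : Type*} [Countable ι] {e : HilbertBasis ι ℝ (CM μ)} {G : X → ℝ}
  {DG : X → CM μ} {D2G : X → CM μ →L[ℝ] CM μ}

namespace DomainHyp

theorem measurable_level (hG : DomainHyp e G DG D2G) : Measurable G :=
  (hG.precise₀ 2 one_lt_two).1 Fin.elim0

theorem measurable_gradient (hG : DomainHyp e G DG D2G) (i : ι) :
    Measurable fun x => ⟪DG x, e i⟫_ℝ := (hG.precise₁ 2 one_lt_two).1 fun _ => i

theorem measurable_hessian (hG : DomainHyp e G DG D2G) (i j : ι) :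
    Measurable fun x => ⟪D2G x (e j), e i⟫_ℝ := (hG.precise₂ 2 one_lt_two).1 ![j, i]

theorem measurable_inner_gradient (hG : DomainHyp e G DG D2G) (w : CM μ) :
    Measurable fun x => ⟪DG x, w⟫_ℝ :=
  measurable_inner_of_coord e hG.measurable_gradient fun _ => measurable_const

theorem rhoAE_of_transversalAE (hG : DomainHyp e G DG D2G)
    (hμ : ∀ L : StrongDual ℝ X, ∫ x, L x ∂μ = 0) {f g : X → ℝ} (hf : Measurable f)
    (hg : Measurable g) (h : ∀ (j k : ι) (α β : ℤ), TransversalAE G DG fun y =>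
      0 < ⟪DG y, (α : ℝ) • e j + (β : ℝ) • e k⟫_ℝ → f y = g y) :
    RhoAE μ (G ⁻¹' {0}) fun y => f y = g y := by
  have hreg : RhoAE μ (G ⁻¹' {0}) fun y => HasHDerivAt G (innerSL ℝ (DG y)) y ∧ DG y ≠ 0 :=
    (hG.twiceDifferentiable.and hG.nonzero).mono fun y _ hy => ⟨hy.1.1, hy.2⟩
  refine TransversalAE.rhoAE hμ e hG.measurable_level hG.convex hreg
    ((hG.measurable_level (measurableSet_singleton 0)).inter (measurableSet_eq_fun hf hg).compl) ?_
  refine ((TransversalAE.forall fun k => TransversalAE.forall fun σ => h k k 0 σ).and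
    (hG.nonzero.transversalAE DG)).mono ?_
  rintro y - ⟨hy, hne⟩
  obtain ⟨k, σ, hσ⟩ := exists_transversal e hne
  refine hy k σ ?_
  rw [inner_combination]
  simpa using hσ

/-- The trace of the gradient is its restriction to `G⁻¹(0)`. -/
theorem gradient_trace_eq (hG : DomainHyp e G DG D2G)
    (hμ : ∀ L : StrongDual ℝ X, ∫ x, L x ∂μ = 0) {p : ℝ} (hp : 1 < p) {TDG : X → CM μ}
    (hT : IsVectorTrace e G p DG TDG) : RhoAE μ (G ⁻¹' {0}) fun y => TDG y = DG y := by
  refine (RhoAE.forall fun i => ?_ :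
    RhoAE μ (G ⁻¹' {0}) fun y => ∀ i, ⟪TDG y, e i⟫_ℝ = ⟪DG y, e i⟫_ℝ).mono
      fun y _ hy => basis_ext e hy
  refine hG.rhoAE_of_transversalAE hμ (hT i).1 (hG.measurable_gradient i) fun j k α β => ?_
  refine (hT i).eq_of_continuousAt hμ hG.measurable_level hG.convex hG.measurable_inner_gradient
    (hG.twiceDifferentiable.mono fun y _ hy => ⟨hy.1, ?_⟩) hp rfl
  exact hy.2.hasFDerivAt.continuousAt.inner continuousAt_const

/-- The trace of the second derivative is its restriction to `G⁻¹(0)`. -/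
theorem hessian_trace_eq (hG : DomainHyp e G DG D2G)
    (hμ : ∀ L : StrongDual ℝ X, ∫ x, L x ∂μ = 0) {p : ℝ} (hp : 1 < p)
    {TD2G : X → CM μ →L[ℝ] CM μ} (hT : IsOperatorTrace e G p D2G TD2G) :
    RhoAE μ (G ⁻¹' {0}) fun y => TD2G y = D2G y := by
  refine (RhoAE.forall fun i => RhoAE.forall fun j => ?_ : RhoAE μ (G ⁻¹' {0}) fun y =>
    ∀ i j, ⟪TD2G y (e j), e i⟫_ℝ = ⟪D2G y (e j), e i⟫_ℝ).mono fun y _ hy => basis_ext_clm e hy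
  obtain ⟨D, hD, -, hD1, hD2⟩ := hG.sobolev 2 one_lt_two
  have hline := fun (k : ι) (α β : ℤ) => IsTrace.secondDeriv_eq hμ hG.measurable_level hG.convex
    hG.measurable_inner_gradient hG.twiceDifferentiable hp one_lt_two hD hD1 hD2 (hT i j) (hT i k)
    (rfl : (α : ℝ) • e j + (β : ℝ) • e k = _)
  refine hG.rhoAE_of_transversalAE hμ (hT i j).1 (hG.measurable_hessian i j) fun _ _ _ _ => ?_
  refine ((TransversalAE.forall fun k => TransversalAE.forall fun α => TransversalAE.forall fun β =>
    hline k α β).and (hG.nonzero.transversalAE DG)).mono ?_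
  rintro y - ⟨hy, hne⟩ -
  obtain ⟨k, σ, hσ⟩ := exists_transversal e hne
  have hσ0 : (σ : ℝ) ≠ 0 := by
    rintro h
    simp [h] at hσ
  have hk : ⟪TD2G y (e k), e i⟫_ℝ = ⟪D2G y (e k), e i⟫_ℝ := by
    have := hy k 0 σ (by rw [inner_combination]; simpa using hσ)
    simpa [hσ0] using this
  -- The direction `e j` may be tangent to the level. Adding a large multiple of the transversal `σ
  -- • e k` makes it transversal, and the contribution of `e k`, already identified, is subtracted.
  obtain ⟨N, hN⟩ := exists_nat_gt (-⟪DG y, e j⟫_ℝ / (σ * ⟪DG y, e k⟫_ℝ))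
  rw [div_lt_iff₀ hσ] at hN
  have hj := hy k 1 (N * σ) (by
    rw [inner_combination]
    push_cast
    linarith)
  rw [hk] at hj
  simpa using hj

theorem tangential_identity (hG : DomainHyp e G DG D2G)
    (hμ : ∀ L : StrongDual ℝ X, ∫ x, L x ∂μ = 0) {Φ : X → CM μ} (hΦ : MemZ G DG Φ) :
    RhoAE μ (G ⁻¹' {0}) fun y => ⟪D2G y (Φ y), Φ y⟫_ℝ = -⟪hDeriv Φ y (Φ y), DG y⟫_ℝ := by
  have hC := hΦ.contDiff
  have hΦm : ∀ i, Measurable fun x => ⟪Φ x, e i⟫_ℝ := fun i =>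
    (hC.continuous.inner continuous_const).measurable
  have hDΦm : ∀ i, Measurable fun x => ⟪hDeriv Φ x (Φ x), e i⟫_ℝ := fun i => by
    have h1 : Continuous fun x => hDeriv Φ x (Φ x) :=
      (hC.continuous_fderiv one_ne_zero).clm_apply (continuous_incl.comp hC.continuous)
    exact (h1.inner continuous_const).measurable
  refine hG.rhoAE_of_transversalAE hμ
    (measurable_inner_of_coord e
      (measurable_inner_clm_apply_of_coord e hG.measurable_hessian hΦm) hΦm)
    (measurable_inner_of_coord e hDΦm hG.measurable_gradient).neg fun j k α β => ?_
  by_cases hu : (α : ℝ) • e j + (β : ℝ) • e k = 0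
  · refine (hG.nonzero.transversalAE DG).mono fun y _ _ h => ?_
    rw [hu, inner_zero_right] at h
    exact absurd h (lt_irrefl _)
  · exact hΦ.transversalAE hμ hG.measurable_level hG.convex hG.measurable_inner_gradient
      hG.twiceDifferentiable hu

end DomainHyp

end Main

end GaussLevel

theorem mainTheorem10 {X : Type*} [NormedAddCommGroup X] [NormedSpace ℝ X] [CompleteSpace X]
    [SecondCountableTopology X] [MeasurableSpace X] [BorelSpace X]
    (μ : Measure X) [IsGaussian μ] (hμ : GaussLevel.CenteredNondegenerate μ)
    {ι : Type*} [Countable ι] (e : HilbertBasis ι ℝ (GaussLevel.CM μ))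
    (he : ∀ i, ∃ L : StrongDual ℝ X, StrongDual.toLp μ 2 L = (e i : Lp ℝ 2 μ))
    (G : X → ℝ) (DG : X → GaussLevel.CM μ)
    (D2G : X → GaussLevel.CM μ →L[ℝ] GaussLevel.CM μ)
    (hG : GaussLevel.DomainHyp e G DG D2G)
    (p : ℝ) (hp : 1 < p)
    (TDG : X → GaussLevel.CM μ) (hTDG : GaussLevel.IsVectorTrace e G p DG TDG)
    (TD2G : X → GaussLevel.CM μ →L[ℝ] GaussLevel.CM μ)
    (hTD2G : GaussLevel.IsOperatorTrace e G p D2G TD2G)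
    (Φ : X → GaussLevel.CM μ) (hΦ : GaussLevel.MemZ G TDG Φ) :
    GaussLevel.RhoAE μ (G ⁻¹' {0}) fun x =>
      ⟪TD2G x (Φ x), Φ x⟫_ℝ = -⟪GaussLevel.hDeriv Φ x (Φ x), TDG x⟫_ℝ := by

  have hT := hG.gradient_trace_eq hμ.1 hp hTDG
  have hΦ' : GaussLevel.MemZ G DG Φ :=
    ⟨hΦ.1, (hΦ.2.and hT).mono fun x _ hx => by rw [← hx.2]; exact hx.1⟩
  refine ((hT.and (hG.hessian_trace_eq hμ.1 hp hTD2G)).and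
    (hG.tangential_identity hμ.1 hΦ')).mono ?_
  rintro x - ⟨⟨h1, h2⟩, h3⟩
  rw [h1, h2, h3]
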